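/- Let $G$ be a connected and simply connected Lie group of dimension $n$ whose Lie algebra $\mathfrak g$ is semisimple and unimodular (that is, $\operatorname{tr}(\operatorname{ad}_\xi)=0$ for all $\xi\in\mathfrak g$), let $k$ be the Killing form of $\mathfrak g$, let $E_1,\dots,E_n$ be a basis of $\mathfrak g$ with dual basis $\theta^1,\dots,\theta^n$, and put $|k|=|\det(k(E_a,E_b))|$. Let $\pi:P\to M$ be a smooth principal $G$-bundle over a smooth manifold, with right translations $R_g$ and fundamental vector fields $\xi^P$, and fix a connection on $P$ with connection form $\omega_\nabla$. Functions and forms take values in $\mathbb K=\mathbb R$ or $\mathbb K=\mathbb C$; where values in $\mathfrak g$ are concerned, $\mathfrak g$ stands for $\mathbb K\otimes_{\mathbb R}\mathfrak g$. Notation. * $\Gamma_G(TP)$ is the space of $G$-invariant smooth vector fields on $P$, $\Gamma_G(P,\mathfrak g)$ the space of smooth $v:P\to\mathfrak g$ with $v(pg)=\mathrm{Ad}_{g^{-1}}v(p)$, and $\Omega^q_{\mathrm{Lie}}(P,\mathfrak g)$ the space of alternating $C^\infty(M)$-multilinear maps $\Gamma_G(TP)^q\to\Gamma_G(P,\mathfrak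 g)$. * $\Omega^q_{\mathrm{TLA}}(P,\mathfrak g)=(\Omega^\bullet(P)\otimes\Lambda^\bullet\mathfrak g^*\otimes\mathfrak g)^q$ is the space of smooth $\mathfrak g$-valued $q$-forms on the trivial Lie algebroid $TP\oplus(P\times\mathfrak g)$. A form $\widehat\omega$ in it is *basic* if, for every $\xi\in\mathfrak g$, it is annihilated by the inner contraction with $\xi^P\oplus\xi$ and by the Lie derivative along $\xi^P\oplus\xi$, where $X\oplus\gamma$ acts on $\mathfrak g$-valued maps by $v\mapsto X\cdot v+[\gamma,v]$. The inclusion $\Omega^q_{\mathrm{Lie}}(P,\mathfrak g)\hookrightarrow\Omega^q_{\mathrm{TLA}}(P,\mathfrak g)$ sends $\omega$ to the unique basic $\widehat\omega$ with $\widehat\omega(\mathsf X_1\oplus0,\dots,\mathsf X_q\oplus0)=\omega(\mathsf X_1,\dots,\mathsf X_q)$ for all $\mathsf X_i\in\Gamma_G(TP)$. * $\int_{\mathrm{alg}}:\Omega^{\bullet}_{\mathrm{TLA}}(P,\mathfrak g)\to\Omega^{\bullet-n}(P)\otimes\mathfrak g$ takes the factor of $\sqrt{|k|}\,\theta^1\wedge\dots\wedge\theta^n$: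 it sends $\alpha\otimes\sqrt{|k|}\,\theta^1\wedge\dots\wedge\theta^n\otimes\xi$ to $\alpha\otimes\xi$ and vanishes on $\Omega^\bullet(P)\otimes\Lambda^s\mathfrak g^*\otimes\mathfrak g$ for $s<n$. * Let $\mathcal L=P\times_{\mathrm{Ad}}\mathfrak g$. A local section $s:U\to P$ gives $\omega\in\Omega^q_{\mathrm{Lie}}(P,\mathfrak g)$ the local expression $\omega_{\mathrm{loc}}$, a $\mathfrak g$-valued form on $TU\oplus(U\times\mathfrak g)$, with $\omega_{\mathrm{loc}}(X_1\oplus\gamma_1,\dots,X_q\oplus\gamma_q)(x)=\omega(\mathsf X_1,\dots,\mathsf X_q)(s(x))$ whenever $\mathsf X_i(s(x))=T_xs(X_i)-\gamma_i(x)^P(s(x))$ for all $i$. Let $a^1,\dots,a^n$ be the components in the basis $(E_a)$ of $X\oplus\gamma\mapsto (s^*\omega_\nabla)(X)-\gamma$. The inner integration $\int_{\mathrm{inner}}:\Omega^{\bullet}_{\mathrm{Lie}}(P,\mathfrak g)\to\Omega^{\bullet-n}(M,\mathcal L)$, for the inner metric given by $k$, sends $\omega$ to the form $\omega^{\mathrm{m.i.}}$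 such that, for every local trivialization of $P$ with section $s$, $$\omega_{\mathrm{loc}}=\omega^{\mathrm{m.i.}}_{\mathrm{loc}}\wedge(-1)^n\sqrt{|k|}\,a^1\wedge\dots\wedge a^n+(\text{terms of degree}<n\text{ in }\mathfrak g^*).$$ * $\Omega^{r}(M,\mathcal L)\hookrightarrow\Omega^{r}(P)\otimes\mathfrak g$ is the pull-back $\eta\mapsto\widetilde\eta$, $\widetilde\eta_p(Y_1,\dots,Y_r)=\eta_{\pi(p)}(\pi_*Y_1,\dots,\pi_*Y_r)$ read in $\mathfrak g$ by means of $p$; a form $\tau\in\Omega^r(P)\otimes\mathfrak g$ is *tensorial* if it vanishes when one argument is vertical and $R_g^*\tau=\mathrm{Ad}_{g^{-1}}\tau$ for all $g\in G$. Then these four maps are well defined and linear, the two inclusions are injective with images the basic forms and the tensorial forms respectively, and the diagram $$\begin{array}{ccc}\Omega^{\bullet}_{\mathrm{Lie}}(P,\mathfrak g)&\hookrightarrow&\Omega^{\bullet}_{\mathrm{TLA}}(P,\mathfrak g)\\ {\scriptstyle\int_{\mathrm{inner}}}\downarrow&&\downarrow{\scriptstyle\int_{\mathrm{alg}}}\\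 \Omega^{\bullet-n}(M,\mathcal L)&\hookrightarrow&\Omega^{\bullet-n}(P)\otimes\mathfrak g\end{array}$$ commutes: $\int_{\mathrm{alg}}\widehat\omega=\widetilde{\int_{\mathrm{inner}}\omega}$ for every $\omega\in\Omega^\bullet_{\mathrm{Lie}}(P,\mathfrak g)$. In degrees below $n$ both integrations are zero. -/

import Mathlib

open scoped Manifold ContDiff TensorProduct

noncomputable section

namespace AtiyahLie

/-! ### Smooth maps into finite-dimensional vector spaces -/

section VectorValued

variable {k : ℕ} {P : Type*} [TopologicalSpace P] [ChartedSpace (EuclideanSpace ℝ (Fin k)) P]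

/-- Smoothness of a map from a manifold to a finite-dimensional real vector space: all real linear
functionals of the map are smooth. -/
def SmoothInto (k : ℕ) {P : Type*} [TopologicalSpace P]
    [ChartedSpace (EuclideanSpace ℝ (Fin k)) P] {V : Type*} [AddCommGroup V] [Module ℝ V]
    (f : P → V) : Prop :=
  ∀ l : V →ₗ[ℝ] ℝ, ContMDiff (𝓡 k) 𝓘(ℝ, ℝ) ∞ (fun p => l (f p))

theorem SmoothInto.add {V : Type*} [AddCommGroup V] [Module ℝ V] {f g : P → V}
    (hf : SmoothInto k f) (hg : SmoothInto k g) : SmoothInto k (fun p => f p + g p) := by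
  intro l
  simpa [Pi.add_def] using (hf l).add (hg l)

theorem SmoothInto.zero {V : Type*} [AddCommGroup V] [Module ℝ V] :
    SmoothInto k (fun _ : P => (0 : V)) := by
  intro l
  simpa using contMDiff_const

theorem SmoothInto.smul {𝕜 V : Type*} [RCLike 𝕜] [AddCommGroup V] [Module ℝ V] [Module 𝕜 V]
    [SMulCommClass ℝ 𝕜 V] (c : 𝕜) {f : P → V} (hf : SmoothInto k f) :
    SmoothInto k (fun p => c • f p) := by
  intro l
  have : SMulCommClass 𝕜 ℝ V := SMulCommClass.symm ℝ 𝕜 V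
  exact hf (l ∘ₗ LinearMap.mk ⟨fun v => c • v, smul_add c⟩ (fun a v => smul_comm c a v))

/-- The derivative at `p`, in the direction `v`, of a map with values in a finite-dimensional real
vector space, computed in coordinates with respect to a basis. -/
def dirDeriv {V : Type*} [AddCommGroup V] [Module ℝ V] [Module.Finite ℝ V]
    (f : P → V) (p : P) (v : TangentSpace (𝓡 k) p) : V :=
  ∑ i, (NormedSpace.fromTangentSpace _
      (mfderiv (𝓡 k) 𝓘(ℝ, ℝ) (fun y => (Module.finBasis ℝ V).repr (f y) i) p v) : ℝ) •
    Module.finBasis ℝ V i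

/-- Smooth vector fields. -/
abbrev VF (k : ℕ) (P : Type*) [TopologicalSpace P] [ChartedSpace (EuclideanSpace ℝ (Fin k)) P]
    [IsManifold (𝓡 k) ∞ P] : Type _ :=
  ContMDiffSection (𝓡 k) (EuclideanSpace ℝ (Fin k)) ∞ (fun p : P => TangentSpace (𝓡 k) p)

end VectorValued

/-! ### The structure group and its Lie algebra -/

section Group

variable (n : ℕ) (G : Type*) [TopologicalSpace G] [ChartedSpace (EuclideanSpace ℝ (Fin n)) G]
  [Group G]

/-- The Lie algebra `𝔤` of `G`. -/
abbrev LieAlg : Type := GroupLieAlgebra (𝓡 n) G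

instance : Module.Finite ℝ (LieAlg n G) :=
  inferInstanceAs (Module.Finite ℝ (EuclideanSpace ℝ (Fin n)))

instance [LieGroup (𝓡 n) ∞ G] : LieGroup (𝓡 n) (minSmoothness ℝ 3) G :=
  LieGroup.of_le (n := ∞) (by
    rw [minSmoothness_of_isRCLikeNormedField]
    exact WithTop.coe_le_coe.mpr (le_top : (3 : ℕ∞) ≤ ⊤))

/-- The Lie algebra with scalars extended to `𝕜 = ℝ` or `𝕜 = ℂ`. -/
abbrev LieAlgK (𝕜 : Type*) [RCLike 𝕜] : Type _ := 𝕜 ⊗[ℝ] LieAlg n G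

instance (𝕜 : Type*) [RCLike 𝕜] : Module.Finite ℝ (LieAlgK n G 𝕜) :=
  inferInstanceAs (Module.Finite ℝ (𝕜 ⊗[ℝ] LieAlg n G))

variable {G}

/-- The adjoint action of `G` on `𝔤`. -/
def Ad (g : G) : LieAlg n G →ₗ[ℝ] LieAlg n G :=
  (mfderiv (𝓡 n) (𝓡 n) (fun h : G => g * h * g⁻¹) 1 :
    EuclideanSpace ℝ (Fin n) →L[ℝ] EuclideanSpace ℝ (Fin n)).toLinearMap

/-- The adjoint action of `G` on `𝕜 ⊗ 𝔤`. -/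
def AdK (𝕜 : Type*) [RCLike 𝕜] (g : G) : LieAlgK n G 𝕜 →ₗ[𝕜] LieAlgK n G 𝕜 :=
  (Ad n g).baseChange 𝕜

/-- The adjoint action of `𝔤` on `𝕜 ⊗ 𝔤`. -/
def adK (𝕜 : Type*) [RCLike 𝕜] [LieGroup (𝓡 n) ∞ G] (ξ : LieAlg n G) :
    LieAlgK n G 𝕜 →ₗ[𝕜] LieAlgK n G 𝕜 :=
  (LieAlgebra.ad ℝ (LieAlg n G) ξ).baseChange 𝕜

variable {n}

/-- The form `√|k| θ¹ ∧ ⋯ ∧ θⁿ` on `𝔤`, where `(θᵃ)` is the basis dual to `b` and `|k|` is the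
absolute value of the determinant of the matrix of the Killing form in the basis `b`. -/
def killingVolume [LieGroup (𝓡 n) ∞ G] (b : Module.Basis (Fin n) ℝ (LieAlg n G)) :
    LieAlg n G [⋀^Fin n]→ₗ[ℝ] ℝ :=
  Real.sqrt |(Matrix.of fun i j => killingForm ℝ (LieAlg n G) (b i) (b j)).det| • b.det

end Group

/-! ### Exterior algebra on `T ⊕ 𝔤` -/

section Exterior

variable {T L W : Type*} [AddCommGroup T] [Module ℝ T] [AddCommGroup L] [Module ℝ L]
  [AddCommGroup W] [Module ℝ W]

/-- The exterior product `α ∧ β` (without factorials) of a `W`-valued form `α` on `T`, pulled back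
to `T ⊕ L`, with a scalar form `β` on `T ⊕ L`. -/
def wedge {r n : ℕ} (α : T [⋀^Fin r]→ₗ[ℝ] W) (β : (T × L) [⋀^Fin n]→ₗ[ℝ] ℝ) :
    (T × L) [⋀^Fin (r + n)]→ₗ[ℝ] W :=
  (((TensorProduct.rid ℝ W).toLinearMap.compAlternatingMap
    ((α.compLinearMap (LinearMap.fst ℝ T L)).domCoprod β))).domDomCongr finSumFinEquiv

/-- All the components of `R ∈ ⨁ Λʳ T* ⊗ Λˢ L* ⊗ W` with `s ≥ n` vanish. -/
def InnerDegreeLT (n : ℕ) {q : ℕ} (R : (T × L) [⋀^Fin q]→ₗ[ℝ] W) : Prop :=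
  ∀ (v : Fin q → T × L) (S : Finset (Fin q)), S.card = n → (∀ i ∈ S, (v i).1 = 0) → R v = 0

end Exterior

/-! ### Principal bundles -/

section Bundle

/-- A local trivialization over `U` of a space `P` over `M` with a right action of `G`: the map
`p ↦ (proj p, τ p)` is a diffeomorphism from `proj ⁻¹ U` to `U × G` with inverse
`(x, g) ↦ s(x) · g`; in particular it is equivariant and `s` is the associated local section. -/
structure IsLocalTriv {n k m : ℕ} {G P M : Type*}
    [TopologicalSpace G] [ChartedSpace (EuclideanSpace ℝ (Fin n)) G]
    [TopologicalSpace P] [ChartedSpace (EuclideanSpace ℝ (Fin k)) P]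
    [TopologicalSpace M] [ChartedSpace (EuclideanSpace ℝ (Fin m)) M]
    (proj : P → M) (act : P → G → P) (U : Set M) (s : M → P) (τ : P → G) : Prop where
  isOpen : IsOpen U
  smooth_section : ContMDiffOn (𝓡 m) (𝓡 k) ∞ s U
  smooth_fibre : ContMDiffOn (𝓡 k) (𝓡 n) ∞ τ (proj ⁻¹' U)
  proj_section : ∀ x ∈ U, proj (s x) = x
  section_act : ∀ p, proj p ∈ U → act (s (proj p)) (τ p) = p
  fibre_act : ∀ x ∈ U, ∀ g, τ (act (s x) g) = g

/-- A smooth principal `G`-bundle `P → M`, with its right action. -/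
structure PrincipalBundle (n k m : ℕ) (G P M : Type*)
    [TopologicalSpace G] [ChartedSpace (EuclideanSpace ℝ (Fin n)) G] [Group G]
    [TopologicalSpace P] [ChartedSpace (EuclideanSpace ℝ (Fin k)) P]
    [TopologicalSpace M] [ChartedSpace (EuclideanSpace ℝ (Fin m)) M] where
  proj : P → M
  act : P → G → P
  smooth_proj : ContMDiff (𝓡 k) (𝓡 m) ∞ proj
  smooth_act : ContMDiff ((𝓡 k).prod (𝓡 n)) (𝓡 k) ∞ (fun z : P × G => act z.1 z.2)
  act_one : ∀ p, act p 1 = p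
  act_mul : ∀ p g h, act p (g * h) = act (act p g) h
  proj_act : ∀ p g, proj (act p g) = proj p
  locally_trivial : ∀ x, ∃ (U : Set M) (s : M → P) (τ : P → G),
    x ∈ U ∧ IsLocalTriv (n := n) (k := k) (m := m) proj act U s τ

variable {n k m : ℕ} {G P M : Type*}
  [TopologicalSpace G] [ChartedSpace (EuclideanSpace ℝ (Fin n)) G] [Group G]
  [TopologicalSpace P] [ChartedSpace (EuclideanSpace ℝ (Fin k)) P]
  [TopologicalSpace M] [ChartedSpace (EuclideanSpace ℝ (Fin m)) M]

namespace PrincipalBundle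

variable (Q : PrincipalBundle n k m G P M)

/-- The fundamental vector field `ξ^P` at `p`: the velocity at `t = 0` of `p · exp (t ξ)`. -/
def fund (ξ : LieAlg n G) (p : P) : TangentSpace (𝓡 k) p :=
  (mfderiv (𝓡 n) (𝓡 k) (fun g : G => Q.act p g) 1 :
    EuclideanSpace ℝ (Fin n) →L[ℝ] EuclideanSpace ℝ (Fin k)) ξ

/-- The differential at `p` of the right translation by `g`. -/
def dR (g : G) (p : P) : TangentSpace (𝓡 k) p →ₗ[ℝ] TangentSpace (𝓡 k) (Q.act p g) :=
  (mfderiv (𝓡 k) (𝓡 k) (fun y => Q.act y g) p).toLinearMap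

/-- The differential at `p` of the projection. -/
def dproj (p : P) : TangentSpace (𝓡 k) p →ₗ[ℝ] TangentSpace (𝓡 m) (Q.proj p) :=
  (mfderiv (𝓡 k) (𝓡 m) Q.proj p).toLinearMap

/-- A connection on `P`, given by its (ordinary) connection 1-form. -/
structure Connection [IsManifold (𝓡 k) ∞ P] where
  form : ∀ p : P, TangentSpace (𝓡 k) p →ₗ[ℝ] LieAlg n G
  smooth : ∀ Y : VF k P, SmoothInto k (fun p => form p (Y p))
  form_fund : ∀ p ξ, form p (Q.fund ξ p) = ξ
  equivariant : ∀ g p Y, form (Q.act p g) (Q.dR g p Y) = Ad n g⁻¹ (form p Y)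

/-- The Atiyah Lie algebroid `Γ_G(TP)`: smooth `G`-invariant vector fields on `P`. -/
def InvField [IsManifold (𝓡 k) ∞ P] : Submodule ℝ (VF k P) where
  carrier := {X | ∀ g p, Q.dR g p (X p) = X (Q.act p g)}
  add_mem' := by
    intro X Y hX hY g p
    simp [hX g p, hY g p]
  zero_mem' := by
    intro g p
    simp
  smul_mem' := by
    intro c X hX g p
    simp [hX g p]

variable (𝕜 : Type*) [RCLike 𝕜]

/-- The kernel `Γ_G(P, 𝔤)` of the Atiyah Lie algebroid: smooth maps `v` with
`v (p · g) = Ad_{g⁻¹} v(p)`. -/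
def EquivMap : Submodule 𝕜 (P → LieAlgK n G 𝕜) where
  carrier := {v | SmoothInto k v ∧ ∀ g p, v (Q.act p g) = AdK n 𝕜 g⁻¹ (v p)}
  add_mem' := by
    rintro v w ⟨hv, hv'⟩ ⟨hw, hw'⟩
    exact ⟨hv.add hw, fun g p => by simp [hv' g p, hw' g p]⟩
  zero_mem' := ⟨SmoothInto.zero, fun g p => by simp⟩
  smul_mem' := by
    rintro c v ⟨hv, hv'⟩
    exact ⟨hv.smul c, fun g p => by simp [hv' g p]⟩

/-- `Ω_Lie^q(P, 𝔤)`: alternating `C^∞(M)`-multilinear maps from the Atiyah Lie algebroid to its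
kernel, where `f ∈ C^∞(M)` acts as multiplication by `f ∘ proj`. -/
def LieForm [IsManifold (𝓡 k) ∞ P] (q : ℕ) :
    Submodule 𝕜 (Q.InvField [⋀^Fin q]→ₗ[ℝ] Q.EquivMap 𝕜) where
  carrier := {w | ∀ (f : M → ℝ), ContMDiff (𝓡 m) 𝓘(ℝ, ℝ) ∞ f →
    ∀ (X : Fin q → Q.InvField) (i : Fin q) (Y : Q.InvField),
      (∀ p, Y.1 p = f (Q.proj p) • (X i).1 p) →
      ∀ p, (w (Function.update X i Y)).1 p = f (Q.proj p) • (w X).1 p}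
  add_mem' := by
    intro w η hw hη f hf X i Y hY p
    have h1 := hw f hf X i Y hY p
    have h2 := hη f hf X i Y hY p
    simp [h1, h2]
  zero_mem' := by
    intro f hf X i Y hY p
    simp
  smul_mem' := by
    intro c w hw f hf X i Y hY p
    have h1 := hw f hf X i Y hY p
    simp [h1, smul_comm c]

/-- The fibre at `x` of the bundle `𝓛 = P ×_Ad 𝔤`; the class of `(p, ξ)` is the equivariant map
on the fibre of `P` at `x` with value `ξ` at `p`. -/
def AdFibre (x : M) : Submodule 𝕜 ({p : P // Q.proj p = x} → LieAlgK n G 𝕜) where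
  carrier := {v | ∀ g p, v ⟨Q.act p.1 g, (Q.proj_act p.1 g).trans p.2⟩ = AdK n 𝕜 g⁻¹ (v p)}
  add_mem' := by
    intro v w hv hw g p
    simp [hv g p, hw g p]
  zero_mem' := by
    intro g p
    simp
  smul_mem' := by
    intro c v hv g p
    simp [hv g p]

/-- `Ω^r(M, 𝓛)`: smooth de Rham forms on `M` with values in `𝓛`; they map vector fields on `M` to
smooth sections of `𝓛`, that is, to smooth equivariant maps on `P`. -/
def BundleForm [IsManifold (𝓡 m) ∞ M] (r : ℕ) :
    Submodule 𝕜 (∀ x : M, TangentSpace (𝓡 m) x [⋀^Fin r]→ₗ[ℝ] Q.AdFibre 𝕜 x) where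
  carrier := {η | ∀ X : Fin r → VF m M,
    SmoothInto k (fun p : P => (η (Q.proj p) (fun i => X i (Q.proj p))).1 ⟨p, rfl⟩)}
  add_mem' := by
    intro η ζ hη hζ X
    exact (hη X).add (hζ X)
  zero_mem' := fun X => SmoothInto.zero
  smul_mem' := by
    intro c η hη X
    exact (hη X).smul c

end PrincipalBundle

variable (n k G P) (𝕜 : Type*) [RCLike 𝕜]

/-- `Ω_TLA^q(P, 𝔤) = (Ω(P) ⊗ Λ𝔤* ⊗ 𝔤)^q`: smooth forms of degree `q` on the trivial Lie algebroid
`TP ⊕ (P × 𝔤)` with values in `𝔤`. -/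
def TLAForm [IsManifold (𝓡 k) ∞ P] (q : ℕ) :
    Submodule 𝕜 (∀ p : P, (TangentSpace (𝓡 k) p × LieAlg n G) [⋀^Fin q]→ₗ[ℝ] LieAlgK n G 𝕜) where
  carrier := {w | ∀ (Y : Fin q → VF k P) (c : Fin q → P → LieAlg n G),
    (∀ i, SmoothInto k (c i)) → SmoothInto k (fun p => w p (fun i => (Y i p, c i p)))}
  add_mem' := by
    intro w η hw hη Y c hc
    exact (hw Y c hc).add (hη Y c hc)
  zero_mem' := fun Y c hc => SmoothInto.zero
  smul_mem' := by
    intro a w hw Y c hc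
    exact (hw Y c hc).smul a

/-- `Ω^r(P) ⊗ 𝔤`. -/
def VForm [IsManifold (𝓡 k) ∞ P] (r : ℕ) :
    Submodule 𝕜 (∀ p : P, TangentSpace (𝓡 k) p [⋀^Fin r]→ₗ[ℝ] LieAlgK n G 𝕜) where
  carrier := {w | ∀ Y : Fin r → VF k P, SmoothInto k (fun p => w p (fun i => Y i p))}
  add_mem' := by
    intro w η hw hη Y
    exact (hw Y).add (hη Y)
  zero_mem' := fun Y => SmoothInto.zero
  smul_mem' := by
    intro a w hw Y
    exact (hw Y).smul a

variable {n k G P 𝕜}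

/-- The value at `p` of the bracket `[X ⊕ γ, Y ⊕ η] = [X, Y] ⊕ (X·η - Y·γ + [γ, η])` of the trivial
Lie algebroid. -/
def tlaBracket (X Y : ∀ p : P, TangentSpace (𝓡 k) p) (γ η : P → LieAlg n G) (p : P) :
    TangentSpace (𝓡 k) p × LieAlg n G :=
  (VectorField.mlieBracket (𝓡 k) X Y p,
    dirDeriv (k := k) η p (X p) - dirDeriv (k := k) γ p (Y p) + ⁅γ p, η p⁆)

namespace PrincipalBundle

variable (Q : PrincipalBundle n k m G P M) [IsManifold (𝓡 k) ∞ P]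

/-- The value at `p` of `(L_ξ w)(Y₁ ⊕ c₁, …, Y_q ⊕ c_q)`, with `L_ξ` the Lie derivative along the
element `ξ^P ⊕ ξ` of the trivial Lie algebroid, which acts on `𝔤`-valued maps `v` as
`ξ^P · v + [ξ, v]`. -/
def lieDeriv [LieGroup (𝓡 n) ∞ G] (ξ : LieAlg n G) {q : ℕ} (w : TLAForm n k G P 𝕜 q)
    (Y : Fin q → VF k P) (c : Fin q → P → LieAlg n G) (p : P) : LieAlgK n G 𝕜 :=
  dirDeriv (k := k) (fun y => w.1 y (fun i => (Y i y, c i y))) p (Q.fund ξ p)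
    + adK n 𝕜 ξ (w.1 p (fun i => (Y i p, c i p)))
    - ∑ j, w.1 p (Function.update (fun i => (Y i p, c i p)) j
        (tlaBracket (Q.fund ξ) (Y j) (fun _ => ξ) (c j) p))

/-- `𝔤_equ`-basic forms, where `𝔤_equ = {ξ^P ⊕ ξ}`: horizontal and invariant forms for the
operation of `𝔤_equ` on the forms of the trivial Lie algebroid. -/
structure IsBasic [LieGroup (𝓡 n) ∞ G] {q : ℕ} (w : TLAForm n k G P 𝕜 q) : Prop where
  horizontal : ∀ (ξ : LieAlg n G) (p : P) (v : Fin q → TangentSpace (𝓡 k) p × LieAlg n G)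
    (i : Fin q), v i = (Q.fund ξ p, ξ) → w.1 p v = 0
  invariant : ∀ (ξ : LieAlg n G) (Y : Fin q → VF k P) (c : Fin q → P → LieAlg n G),
    (∀ i, SmoothInto k (c i)) → ∀ p, Q.lieDeriv ξ w Y c p = 0

/-- `w` is the image of the basic form `w'` under the identification of basic forms of the trivial
Lie algebroid with forms of the Atiyah Lie algebroid: an invariant vector field `X` lifts to
`X ⊕ 0`. -/
def Corresponds {q : ℕ} (w' : TLAForm n k G P 𝕜 q) (w : Q.LieForm 𝕜 q) : Prop :=
  ∀ (X : Fin q → Q.InvField) (p : P), (w.1 X).1 p = w'.1 p (fun i => ((X i).1 p, 0))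

/-- Tensorial forms in `Ω^r(P) ⊗ 𝔤` (of type `Ad`): horizontal and `G`-equivariant forms. -/
structure IsTensorial {r : ℕ} (τ : VForm n k G P 𝕜 r) : Prop where
  horizontal : ∀ (p : P) (Y : Fin r → TangentSpace (𝓡 k) p) (i : Fin r),
    Q.dproj p (Y i) = 0 → τ.1 p Y = 0
  equivariant : ∀ (g : G) (p : P) (Y : Fin r → TangentSpace (𝓡 k) p),
    τ.1 (Q.act p g) (fun i => Q.dR g p (Y i)) = AdK n 𝕜 g⁻¹ (τ.1 p Y)

/-- `wloc` is, over `U`, the local expression `Ψ⁻¹ ∘ w ∘ S` of `w` in the trivialization of the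
Atiyah Lie algebroid given by the local section `s`. An invariant field `X` is trivialized at `x` as
`v ⊕ c` when `X(s(x)) = T_x s (v) - c^P(s(x))`, and `Ψ⁻¹` evaluates an equivariant map at `s(x)`. -/
def IsLocalExpr {q : ℕ} (w : Q.LieForm 𝕜 q) (U : Set M) (s : M → P)
    (wloc : ∀ x : M, (TangentSpace (𝓡 m) x × LieAlg n G) [⋀^Fin q]→ₗ[ℝ] LieAlgK n G 𝕜) : Prop :=
  ∀ (X : Fin q → Q.InvField), ∀ x ∈ U, ∀ (v : Fin q → TangentSpace (𝓡 m) x)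
    (c : Fin q → LieAlg n G),
    (∀ i, (X i).1 (s x) = mfderiv (𝓡 m) (𝓡 k) s x (v i) - Q.fund (c i) (s x)) →
      wloc x (fun i => (v i, c i)) = (w.1 X).1 (s x)

variable {Q} in
/-- The local expression `v ⊕ c ↦ A(v) - c` at `x` of the connection 1-form, with `A = s^* form`;
its components are the mixed basis of 1-forms. -/
def Connection.mixed (conn : Q.Connection) (s : M → P) (x : M) :
    TangentSpace (𝓡 m) x × LieAlg n G →ₗ[ℝ] LieAlg n G :=
  conn.form (s x) ∘ₗ (mfderiv (𝓡 m) (𝓡 k) s x).toLinearMap ∘ₗ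
    LinearMap.fst ℝ (TangentSpace (𝓡 m) x) (LieAlg n G)
    - LinearMap.snd ℝ (TangentSpace (𝓡 m) x) (LieAlg n G)

/-- The evaluation at `p` of the elements of the fibre of `𝓛` over the point under `p`. -/
def evalFibre (x : M) (p : P) (h : Q.proj p = x) : Q.AdFibre 𝕜 x →ₗ[ℝ] LieAlgK n G 𝕜 where
  toFun v := v.1 ⟨p, h⟩
  map_add' _ _ := rfl
  map_smul' _ _ := rfl

/-- `η` is the inner integral of `w` for the inner metric `h` given by the Killing form: in every
local trivialization, up to terms of inner degree less than `n`, the local expression of `w` is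
`η_loc ∧ (-1)ⁿ √|h| a¹ ∧ ⋯ ∧ aⁿ`, with `(aⁱ)` the mixed basis relative to the connection and to the
basis `b` of `𝔤`. -/
def IsInnerIntegral [IsManifold (𝓡 m) ∞ M] [LieGroup (𝓡 n) ∞ G]
    (b : Module.Basis (Fin n) ℝ (LieAlg n G)) (conn : Q.Connection)
    {r : ℕ} (w : Q.LieForm 𝕜 (r + n)) (η : Q.BundleForm 𝕜 r) : Prop :=
  ∀ (U : Set M) (s : M → P) (τ : P → G)
    (hs : IsLocalTriv (n := n) (k := k) (m := m) Q.proj Q.act U s τ),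
    ∃ wloc : ∀ x : M, (TangentSpace (𝓡 m) x × LieAlg n G) [⋀^Fin (r + n)]→ₗ[ℝ] LieAlgK n G 𝕜,
      Q.IsLocalExpr w U s wloc ∧
      ∀ (x : M) (hx : x ∈ U),
        InnerDegreeLT n (wloc x -
          wedge ((Q.evalFibre x (s x) (hs.proj_section x hx)).compAlternatingMap (η.1 x))
            ((-1 : ℝ) ^ n • (killingVolume b).compLinearMap (conn.mixed s x)))

/-- `τ` is the tensorial form on `P` which corresponds to the `𝓛`-valued form `η` on `M`. -/
def IsPullback [IsManifold (𝓡 m) ∞ M] {r : ℕ} (η : Q.BundleForm 𝕜 r) (τ : VForm n k G P 𝕜 r) :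
    Prop :=
  ∀ (p : P) (Y : Fin r → TangentSpace (𝓡 k) p),
    τ.1 p Y = (η.1 (Q.proj p) (fun i => Q.dproj p (Y i))).1 ⟨p, rfl⟩

end PrincipalBundle

/-- `η` is the algebraic integral of `w`: it is the factor of `√|k| θ¹ ∧ ⋯ ∧ θⁿ` in `w`, that is,
`w = η ∧ √|k| θ¹ ∧ ⋯ ∧ θⁿ` up to terms of degree less than `n` in `Λ𝔤*`. -/
def IsAlgIntegral [IsManifold (𝓡 k) ∞ P] [LieGroup (𝓡 n) ∞ G]
    (b : Module.Basis (Fin n) ℝ (LieAlg n G))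
    {r : ℕ} (w : TLAForm n k G P 𝕜 (r + n)) (η : VForm n k G P 𝕜 r) : Prop :=
  ∀ p : P, InnerDegreeLT n (w.1 p -
    wedge (η.1 p) ((killingVolume b).compLinearMap
      (LinearMap.snd ℝ (TangentSpace (𝓡 k) p) (LieAlg n G))))

end Bundle

end AtiyahLie

end

noncomputable section

namespace AtiyahLie

/-! ### The Lie bracket as a derivative of pulled-back fields, in a vector space -/

open Filter Topology VectorField

/-! A `C^∞(M)`-multilinear form on invariant fields is pointwise. Locally there is an invariant
frame whose coefficient functions are invariant, hence functions on `M`, so the value at `p` depends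
only on the vectors at `p` (`LieForm.apply_eq_zero`). Thus `ω` is a smooth family of alternating
forms `pointForm` on the spaces `T_pP`, equivariant under right translations, and `ω̂_p(Y_i ⊕ c_i) =
ω_p(Y_i - c_i^P)` is forced by horizontality.

Invariance under `ξ^P ⊕ ξ` is the infinitesimal form of equivariance. The bracket with `ξ^P` is the
derivative of fields pulled back by right translations along any curve through `1` with velocity
`ξ`, and `ad ξ` is the derivative of `Ad`. Differentiating equivariance gives `lieDeriv_eq_zero`.
Conversely, for a basic form restricted to invariant fields, `g ↦ Ad_g f(pg)` has zero derivative,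
hence is constant because `G` is connected (`IsBasic.equivariant`).

Both integrations extract one coefficient: the last `n` arguments are filled with `0 ⊕ E_j` and the
result is divided by `√|k|`, which is nonzero because the Killing form is nondegenerate. These
arguments exhaust `𝔤`, so the other arguments matter only through their `TP` part
(`innerDegreeLT_iff`, `apply_append_basis`). Hence the algebraic integral of a basic form is
horizontal: a vertical `ξ^P ⊕ 0` may be replaced by `ξ^P ⊕ ξ`. It is equivariant because
unimodularity and connectedness give `det Ad_g = 1` (`det_Ad_basis`). It is therefore the pull-back
of a unique `𝓛`-valued form on `M`.

That form is the inner integral. Indeed `ω_loc` is the pull-back of `ω̂` under `Ts ⊕ id`, and on `0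
⊕ E_j` the mixed forms `a` reduce to `-θ`, whose `n` signs cancel `(-1)^n`; the connection does not
affect the top coefficient (`isInnerIntegral_iff`). Equivariance makes the form with this local
property unique. -/

/-- `A` need not be a flow: only `A(·, 0) = id` near `x₀` and the velocity field at `t = 0` matter.
Near `t = 0`, `Z(t)` is the inverse of `D_x A` applied to `Y(A(x₀, t))`. The product rule gives
`DY·X - DX·Y`, with `X` the velocity field, since `∂_t D_x A = D_x ∂_t A`. -/
theorem hasDerivAt_lieBracket_of_fderiv {E : Type*} [NormedAddCommGroup E] [NormedSpace ℝ E]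
    [CompleteSpace E] {A : E × ℝ → E} {Y : E → E} {Z : ℝ → E} {x₀ : E}
    (hA : ContDiffAt ℝ 2 A (x₀, 0)) (hA0 : ∀ᶠ x in 𝓝 x₀, A (x, 0) = x)
    (hY : DifferentiableAt ℝ Y x₀)
    (hZ : ∀ᶠ t in 𝓝 (0 : ℝ), fderiv ℝ A (x₀, t) (Z t, 0) = Y (A (x₀, t))) :
    HasDerivAt Z (lieBracket ℝ (fun x => fderiv ℝ A (x, 0) (0, 1)) Y x₀) 0 := by
  have hA1 : DifferentiableAt ℝ A (x₀, 0) := hA.differentiableAt (by norm_num)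
  have hdA : HasFDerivAt (fderiv ℝ A) (fderiv ℝ (fderiv ℝ A) (x₀, 0)) (x₀, 0) :=
    ((hA.fderiv_right (m := 1) (by norm_num)).differentiableAt (by norm_num)).hasFDerivAt
  set H := fderiv ℝ (fderiv ℝ A) (x₀, 0) with hH
  have hsymm : ∀ u v, H u v = H v u := (hA.isSymmSndFDerivAt (by simp)).eq
  have hx₀ : A (x₀, 0) = x₀ := hA0.self_of_nhds
  have hcurve : HasDerivAt (fun t : ℝ => ((x₀, t) : E × ℝ)) (0, 1) 0 :=
    (hasDerivAt_const _ _).prodMk (hasDerivAt_id _)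
  have hline : HasFDerivAt (fun x : E => ((x, 0) : E × ℝ)) (ContinuousLinearMap.inl ℝ E ℝ) x₀ :=
    (ContinuousLinearMap.inl ℝ E ℝ).hasFDerivAt
  let D : ℝ → E →L[ℝ] E := fun t => (fderiv ℝ A (x₀, t)).comp (ContinuousLinearMap.inl ℝ E ℝ)
  have hD0 : D 0 = 1 := by
    have h1 : HasFDerivAt (fun x => A (x, 0)) (D 0) x₀ := hA1.hasFDerivAt.comp x₀ hline
    have h2 : HasFDerivAt (fun x => A (x, 0)) (ContinuousLinearMap.id ℝ E) x₀ :=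
      (hasFDerivAt_id x₀).congr_of_eventuallyEq hA0
    exact h1.unique h2
  let D' : E →L[ℝ] E := (H (0, 1)).comp (ContinuousLinearMap.inl ℝ E ℝ)
  have hD : HasDerivAt D D' 0 := by
    have h1 : HasDerivAt (fun t : ℝ => fderiv ℝ A (x₀, t)) (H (0, 1)) 0 :=
      HasFDerivAt.comp_hasDerivAt (0 : ℝ) hdA hcurve
    simpa using! h1.clm_comp (hasDerivAt_const (0 : ℝ) (ContinuousLinearMap.inl ℝ E ℝ))
  -- `D t` is invertible only for `t` near `0`, hence the total function `Ring.inverse`; at the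
  -- identity its derivative is `-1`.
  have hinv : HasDerivAt (fun t => Ring.inverse (D t)) (-D') 0 := by
    have h1 := hasFDerivAt_ringInverse (𝕜 := ℝ) (1 : (E →L[ℝ] E)ˣ)
    have h2 : HasFDerivAt Ring.inverse
      (-ContinuousLinearMap.mulLeftRight ℝ (E →L[ℝ] E) ↑(1 : (E →L[ℝ] E)ˣ)⁻¹ ↑(1 : (E →L[ℝ] E)ˣ)⁻¹)
        (D 0) := by rw [hD0]; exact h1
    have h3 := HasFDerivAt.comp_hasDerivAt (0 : ℝ) h2 hD
    simp only [inv_one, Units.val_one] at h3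
    refine h3.congr_deriv ?_
    ext v
    simp
  have hYA : HasDerivAt (fun t => Y (A (x₀, t))) (fderiv ℝ Y x₀ (fderiv ℝ A (x₀, 0) (0, 1))) 0 := by
    have h1 : HasDerivAt (fun t => A (x₀, t)) (fderiv ℝ A (x₀, 0) (0, 1)) 0 :=
      HasFDerivAt.comp_hasDerivAt (0 : ℝ) hA1.hasFDerivAt hcurve
    have h2 : HasFDerivAt Y (fderiv ℝ Y x₀) (A (x₀, 0)) := by rw [hx₀]; exact hY.hasFDerivAt
    exact HasFDerivAt.comp_hasDerivAt (0 : ℝ) h2 h1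
  -- Symmetry of the second derivative of `A` identifies `D'` with the derivative of the velocity
  -- field.
  have hF : fderiv ℝ (fun x => fderiv ℝ A (x, 0) (0, 1)) x₀ (Y x₀) = D' (Y x₀) := by
    have h1 : HasFDerivAt (fun x : E => fderiv ℝ A (x, 0)) (H.comp (ContinuousLinearMap.inl ℝ E ℝ))
      x₀ := HasFDerivAt.comp x₀ hdA hline
    have h2 := (ContinuousLinearMap.apply ℝ E ((0, 1) : E × ℝ)).hasFDerivAt.comp x₀ h1
    have h3 : fderiv ℝ (fun x => fderiv ℝ A (x, 0) (0, 1)) x₀ = _ := h2.fderiv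
    rw [h3]
    exact hsymm _ _
  have hmain := hinv.clm_apply hYA
  have hunit : ∀ᶠ t in 𝓝 (0 : ℝ), IsUnit (D t) := by
    have : {u : E →L[ℝ] E | IsUnit u} ∈ 𝓝 (D 0) := by
      rw [hD0]; exact Units.isOpen.mem_nhds isUnit_one
    exact hD.continuousAt this
  refine (hmain.congr_of_eventuallyEq ?_).congr_deriv ?_
  · filter_upwards [hunit, hZ] with t ht hZt
    rw [← hZt]
    have : (Ring.inverse (D t) * D t) (Z t) = Z t := by rw [Ring.inverse_mul_cancel _ ht]; rfl
    exact this.symm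
  · rw [lieBracket_eq]
    simp only [hF, hD0, Ring.inverse_one, hx₀, neg_apply,
      one_apply_eq_self]
    abel


/-! ### The bracket formula on a manifold -/

section Chart

variable {E : Type*} [NormedAddCommGroup E] [NormedSpace ℝ E] {P : Type*} [TopologicalSpace P]
  [ChartedSpace E P] [IsManifold 𝓘(ℝ, E) ∞ P]

theorem mpullbackWithin_extChartAt_symm_eq {p : P} (V : ∀ q : P, TangentSpace 𝓘(ℝ, E) q)
    {x : E} (hx : x ∈ (extChartAt 𝓘(ℝ, E) p).target) :
    mpullbackWithin 𝓘(ℝ, E) 𝓘(ℝ, E) (extChartAt 𝓘(ℝ, E) p).symm V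
      (Set.range 𝓘(ℝ, E)) x =
    mfderiv 𝓘(ℝ, E) 𝓘(ℝ, E) (extChartAt 𝓘(ℝ, E) p)
      ((extChartAt 𝓘(ℝ, E) p).symm x) (V ((extChartAt 𝓘(ℝ, E) p).symm x)) := by
  have : IsManifold 𝓘(ℝ, E) 1 P := IsManifold.of_le (n := ∞) (by simp)
  rw [mpullbackWithin_apply]
  have h := ContinuousLinearMap.inverse_eq
    (mfderivWithin_extChartAt_symm_comp_mfderiv_extChartAt (I := 𝓘(ℝ, E)) hx)
    (mfderiv_extChartAt_comp_mfderivWithin_extChartAt_symm hx)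
  exact congrFun (congrArg DFunLike.coe h) _

theorem mpullbackWithin_extChartAt_symm_extChartAt {p q : P} (V : ∀ q : P, TangentSpace 𝓘(ℝ, E) q)
    (hq : q ∈ (extChartAt 𝓘(ℝ, E) p).source) :
    mpullbackWithin 𝓘(ℝ, E) 𝓘(ℝ, E) (extChartAt 𝓘(ℝ, E) p).symm V
      (Set.range 𝓘(ℝ, E)) (extChartAt 𝓘(ℝ, E) p q) =
    mfderiv 𝓘(ℝ, E) 𝓘(ℝ, E) (extChartAt 𝓘(ℝ, E) p) q (V q) := by
  have h := mpullbackWithin_extChartAt_symm_eq V ((extChartAt 𝓘(ℝ, E) p).map_source hq)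
  rw [(extChartAt 𝓘(ℝ, E) p).left_inv hq] at h
  exact h

theorem mdifferentiableAt_extChartAt_symm {p : P} {x : E}
    (hx : x ∈ (extChartAt 𝓘(ℝ, E) p).target) :
    MDifferentiableAt 𝓘(ℝ, E) 𝓘(ℝ, E) (extChartAt 𝓘(ℝ, E) p).symm x :=
  ((contMDiffOn_extChartAt_symm (n := ∞) p).contMDiffAt
    ((isOpen_extChartAt_target p).mem_nhds hx)).mdifferentiableAt (by simp)

theorem mfderiv_extChartAt_symm_self (p : P) :
    mfderiv 𝓘(ℝ, E) 𝓘(ℝ, E) (extChartAt 𝓘(ℝ, E) p).symm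
      (extChartAt 𝓘(ℝ, E) p p) = ContinuousLinearMap.id ℝ (E) := by
  have : IsManifold 𝓘(ℝ, E) 1 P := IsManifold.of_le (n := ∞) (by simp)
  have h := mfderivWithin_range_extChartAt_symm (I := 𝓘(ℝ, E)) (x := p)
  rw [ModelWithCorners.range_eq_univ, mfderivWithin_univ] at h
  exact h

/-- The vector space formula is applied to `A`, the family `a` read in the chart at `p`. It serves
twice: for right translations on `P` and for right multiplications on `G`. -/
theorem hasDerivAt_mlieBracket_of_mfderiv [CompleteSpace E] {p : P} {a : P × ℝ → P}
    (ha : ContMDiffAt (𝓘(ℝ, E).prod 𝓘(ℝ, ℝ)) 𝓘(ℝ, E) 2 a (p, 0)) (ha0 : ∀ q, a (q, 0) = q)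
    {Y : ∀ q : P, TangentSpace 𝓘(ℝ, E) q}
    (hY : MDifferentiableAt 𝓘(ℝ, E) 𝓘(ℝ, E).tangent (fun q => (Y q : TangentBundle 𝓘(ℝ, E) P)) p)
    {Z : ℝ → E}
    (hZ : ∀ᶠ t in 𝓝 (0 : ℝ), mfderiv 𝓘(ℝ, E) 𝓘(ℝ, E) (fun q => a (q, t)) p (Z t) = Y (a (p, t))) :
    HasDerivAt Z (mlieBracket 𝓘(ℝ, E)
      (fun q => (mfderiv 𝓘(ℝ, ℝ) 𝓘(ℝ, E) (fun t => a (q, t)) 0 (1 : ℝ) :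
        TangentSpace 𝓘(ℝ, E) (a (q, 0)))) Y p) 0 := by
  have : IsManifold 𝓘(ℝ, E) 1 P := IsManifold.of_le (n := ∞) (by simp)
  have : IsManifold 𝓘(ℝ, E) 2 P := IsManifold.of_le (n := ∞) (WithTop.coe_le_coe.mpr (le_top : (2 : ℕ∞) ≤ ⊤))
  set φ := extChartAt 𝓘(ℝ, E) p with hφ
  set x₀ := φ p with hx₀
  let V : ∀ q : P, TangentSpace 𝓘(ℝ, E) q :=
    fun q => (mfderiv 𝓘(ℝ, ℝ) 𝓘(ℝ, E) (fun t => a (q, t)) 0 (1 : ℝ) : TangentSpace 𝓘(ℝ, E) (a (q, 0)))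
  let A : E × ℝ → E := fun z => φ (a (φ.symm z.1, z.2))
  have hψx₀ : φ.symm x₀ = p := extChartAt_to_inv (I := 𝓘(ℝ, E)) p
  have hψ : ContMDiffAt 𝓘(ℝ, E) 𝓘(ℝ, E) 2 φ.symm x₀ :=
    (contMDiffOn_extChartAt_symm (I := 𝓘(ℝ, E)) (n := 2) p).contMDiffAt (extChartAt_target_mem_nhds p)
  have hinner : ContMDiffAt 𝓘(ℝ, E × ℝ) (𝓘(ℝ, E).prod 𝓘(ℝ, ℝ)) 2
      (fun z : E × ℝ => (φ.symm z.1, z.2)) (x₀, 0) :=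
    (ContMDiffAt.comp (x₀, (0 : ℝ)) hψ contDiff_fst.contMDiff.contMDiffAt).prodMk
      contDiff_snd.contMDiff.contMDiffAt
  have hA2 : ContDiffAt ℝ 2 A (x₀, 0) := by
    rw [← contMDiffAt_iff_contDiffAt]
    have ha' : ContMDiffAt (𝓘(ℝ, E).prod 𝓘(ℝ, ℝ)) 𝓘(ℝ, E) 2 a (φ.symm x₀, 0) := by rwa [hψx₀]
    have h1 : ContMDiffAt 𝓘(ℝ, E × ℝ) 𝓘(ℝ, E) 2 (fun z : E × ℝ => a (φ.symm z.1, z.2)) (x₀, 0) :=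
      ContMDiffAt.comp (x₀, (0 : ℝ)) (g := a) ha' hinner
    have hφ2 : ContMDiffAt 𝓘(ℝ, E) 𝓘(ℝ, E) 2 φ (a (φ.symm x₀, 0)) := by
      rw [ha0, hψx₀]; exact contMDiffAt_extChartAt
    exact ContMDiffAt.comp (x₀, (0 : ℝ)) (g := φ) hφ2 h1
  have hAd : ∀ᶠ z in 𝓝 ((x₀, 0) : E × ℝ), DifferentiableAt ℝ A z :=
    (hA2.eventually (by simp)).mono fun z hz => hz.differentiableAt (by norm_num)
  have had : ∀ᶠ z in 𝓝 ((p, 0) : P × ℝ), MDifferentiableAt (𝓘(ℝ, E).prod 𝓘(ℝ, ℝ)) 𝓘(ℝ, E) a z :=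
    ((contMDiffAt_iff_contMDiffAt_nhds (by simp)).1 ha).mono fun z hz => hz.mdifferentiableAt (by norm_num)
  have hsrc : φ.source ∈ 𝓝 p := extChartAt_source_mem_nhds p
  have htgt : φ.target ∈ 𝓝 x₀ := extChartAt_target_mem_nhds p
  have hψc : ContinuousAt φ.symm x₀ := hψ.continuousAt
  have hA0 : ∀ᶠ x in 𝓝 x₀, A (x, 0) = x := by
    filter_upwards [htgt] with x hx
    simp only [A, ha0]
    exact φ.right_inv hx
  have hYd : DifferentiableAt ℝ
      (mpullbackWithin 𝓘(ℝ, E) 𝓘(ℝ, E) φ.symm Y (Set.range 𝓘(ℝ, E))) x₀ := by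
    have h1 := MDifferentiableWithinAt.differentiableWithinAt_mpullbackWithin_vectorField
      (I := 𝓘(ℝ, E)) (s := Set.univ) (mdifferentiableWithinAt_univ.2 hY)
    rw [Set.preimage_univ, Set.univ_inter, ModelWithCorners.range_eq_univ] at h1
    rw [ModelWithCorners.range_eq_univ]
    exact differentiableWithinAt_univ.1 h1
  have hZ' : ∀ᶠ t in 𝓝 (0 : ℝ), fderiv ℝ A (x₀, t) (Z t, 0) =
      mpullbackWithin 𝓘(ℝ, E) 𝓘(ℝ, E) φ.symm Y (Set.range 𝓘(ℝ, E)) (A (x₀, t)) := by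
    have c1 : ContinuousAt (fun t : ℝ => ((x₀, t) : E × ℝ)) 0 := by fun_prop
    have c2 : ContinuousAt (fun t : ℝ => ((p, t) : P × ℝ)) 0 := by fun_prop
    have c3 : ContinuousAt (fun t : ℝ => a (p, t)) 0 :=
      ContinuousAt.comp (f := fun t : ℝ => ((p, t) : P × ℝ)) (g := a) ha.continuousAt c2
    have hsrc' : φ.source ∈ 𝓝 (a (p, 0)) := by rw [ha0]; exact hsrc
    filter_upwards [hZ, c1.eventually hAd, c2.eventually had, c3.eventually hsrc']
      with t h1 h2 h3 h4
    have e1 : fderiv ℝ A (x₀, t) (Z t, 0) = fderiv ℝ (fun x => A (x, t)) x₀ (Z t) := by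
      have : HasFDerivAt (fun x : E => ((x, t) : E × ℝ)) (ContinuousLinearMap.inl ℝ E ℝ) x₀ :=
        (hasFDerivAt_id x₀).prodMk (hasFDerivAt_const t x₀)
      have h := h2.hasFDerivAt.comp x₀ this
      exact (congrArg (fun L => L (Z t)) h.fderiv).symm
    have d1 : MDifferentiableAt 𝓘(ℝ, E) 𝓘(ℝ, E) (fun q => a (q, t)) p :=
      MDifferentiableAt.comp p (g := a) h3 (mdifferentiableAt_id.prodMk mdifferentiableAt_const)
    have d2 : MDifferentiableAt 𝓘(ℝ, E) 𝓘(ℝ, E) φ (a (p, t)) :=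
      mdifferentiableAt_extChartAt (by rwa [← extChartAt_source 𝓘(ℝ, E)])
    have d3 : MDifferentiableAt 𝓘(ℝ, E) 𝓘(ℝ, E) φ.symm x₀ :=
      mdifferentiableAt_extChartAt_symm (mem_extChartAt_target p)
    have e2 : mfderiv 𝓘(ℝ, E) 𝓘(ℝ, E) (fun x => A (x, t)) x₀ =
        (mfderiv 𝓘(ℝ, E) 𝓘(ℝ, E) φ (a (p, t))).comp
          ((mfderiv 𝓘(ℝ, E) 𝓘(ℝ, E) (fun q => a (q, t)) p).comp
            (mfderiv 𝓘(ℝ, E) 𝓘(ℝ, E) φ.symm x₀)) := by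
      have hd : HasMFDerivAt 𝓘(ℝ, E) 𝓘(ℝ, E) φ.symm x₀ (mfderiv 𝓘(ℝ, E) 𝓘(ℝ, E) φ.symm x₀) :=
        d3.hasMFDerivAt
      have hd1 := d1.hasMFDerivAt
      have hd2 := d2.hasMFDerivAt
      rw [← hψx₀] at hd1 hd2
      have h := HasMFDerivAt.comp (x₀ : E) (g := fun q => φ (a (q, t)))
        (HasMFDerivAt.comp (φ.symm x₀) (g := φ) (f := fun q => a (q, t)) hd2 hd1) hd
      have h' := h.mfderiv
      rw [hψx₀] at h'
      exact h'
    rw [e1, ← mfderiv_eq_fderiv, mpullbackWithin_extChartAt_symm_extChartAt Y (by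
      rw [hψx₀]; exact h4), e2, mfderiv_extChartAt_symm_self p, hψx₀]
    exact congrArg (mfderiv 𝓘(ℝ, E) 𝓘(ℝ, E) φ (a (p, t))) h1
  have hV : (fun x => fderiv ℝ A (x, 0) (0, 1)) =ᶠ[𝓝 x₀]
      mpullbackWithin 𝓘(ℝ, E) 𝓘(ℝ, E) φ.symm V (Set.range 𝓘(ℝ, E)) := by
    have c1 : ContinuousAt (fun x : E => ((x, 0) : E × ℝ)) x₀ := by fun_prop
    have c2 : ContinuousAt (fun x : E => ((φ.symm x, 0) : P × ℝ)) x₀ :=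
      hψc.prodMk continuousAt_const
    have had' : ∀ᶠ z in 𝓝 ((φ.symm x₀, 0) : P × ℝ),
        MDifferentiableAt (𝓘(ℝ, E).prod 𝓘(ℝ, ℝ)) 𝓘(ℝ, E) a z := by rwa [hψx₀]
    filter_upwards [htgt, c1.eventually hAd, c2.eventually had'] with x h1 h2 h3
    have e1 : fderiv ℝ A (x, 0) (0, 1) = fderiv ℝ (fun t => A (x, t)) 0 1 := by
      have : HasFDerivAt (fun t : ℝ => ((x, t) : E × ℝ)) (ContinuousLinearMap.inr ℝ E ℝ) 0 :=
        (hasFDerivAt_const x (0 : ℝ)).prodMk (hasFDerivAt_id (0 : ℝ))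
      have h := h2.hasFDerivAt.comp (0 : ℝ) this
      exact (congrArg (fun L => L 1) h.fderiv).symm
    have d1 : MDifferentiableAt 𝓘(ℝ, ℝ) 𝓘(ℝ, E) (fun t : ℝ => a (φ.symm x, t)) 0 :=
      MDifferentiableAt.comp (0 : ℝ) (g := a) h3 (mdifferentiableAt_const.prodMk mdifferentiableAt_id)
    have hs : φ.symm x ∈ φ.source := φ.map_target h1
    have d2 : MDifferentiableAt 𝓘(ℝ, E) 𝓘(ℝ, E) φ (a (φ.symm x, 0)) := by
      rw [ha0]
      exact mdifferentiableAt_extChartAt (by rwa [← extChartAt_source 𝓘(ℝ, E)])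
    have e2 : mfderiv 𝓘(ℝ, ℝ) 𝓘(ℝ, E) (fun t => A (x, t)) 0 =
        (mfderiv 𝓘(ℝ, E) 𝓘(ℝ, E) φ (a (φ.symm x, 0))).comp
          (mfderiv 𝓘(ℝ, ℝ) 𝓘(ℝ, E) (fun t => a (φ.symm x, t)) 0) :=
      mfderiv_comp (0 : ℝ) (g := φ) (f := fun t : ℝ => a (φ.symm x, t)) d2 d1
    rw [e1, ← mfderiv_eq_fderiv, mpullbackWithin_extChartAt_symm_eq V h1, e2]
    -- `a (φ.symm x, 0)` equals `φ.symm x` only propositionally, so the two differentials are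
    -- compared as maps of the model space.
    have e3 : ∀ q, q = φ.symm x → ∀ u : E, (mfderiv 𝓘(ℝ, E) 𝓘(ℝ, E) φ q : E →L[ℝ] E) u =
        (mfderiv 𝓘(ℝ, E) 𝓘(ℝ, E) φ (φ.symm x) : E →L[ℝ] E) u := by
      rintro _ rfl u; rfl
    exact e3 _ (ha0 _) _
  have main := hasDerivAt_lieBracket_of_fderiv hA2 hA0 hYd hZ'
  refine main.congr_deriv (Eq.trans (EventuallyEq.lieBracket_vectorField_eq (W := mpullbackWithin
    𝓘(ℝ, E) 𝓘(ℝ, E) φ.symm Y (Set.range 𝓘(ℝ, E))) hV EventuallyEq.rfl) ?_)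
  -- The manifold bracket is the chart bracket transported by the differential of the chart at its
  -- own centre, which is the identity.
  have h1 := mlieBracketWithin_apply (I := 𝓘(ℝ, E)) (s := Set.univ) (V := V) (W := Y) (x₀ := p)
  rw [mfderiv_extChartAt_self, Set.preimage_univ, Set.univ_inter,
    ModelWithCorners.range_eq_univ] at h1
  rw [ModelWithCorners.range_eq_univ]
  refine ((congrFun (lieBracketWithin_univ (𝕜 := ℝ)) x₀).symm).trans (Eq.trans ?_ h1.symm)
  exact (congrArg (fun L : E →L[ℝ] E => L _) ContinuousLinearMap.inverse_id).symm

end Chart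

/-! ### Differentiation of curves in finite-dimensional vector spaces -/

section WeakDeriv

variable {V W : Type*} [AddCommGroup V] [Module ℝ V] [AddCommGroup W] [Module ℝ W]

/-- The curve `u` in a vector space has derivative `u'` at `t`, tested by linear functionals. -/
def HasWeakDerivAt (u : ℝ → V) (u' : V) (t : ℝ) : Prop :=
  ∀ l : V →ₗ[ℝ] ℝ, HasDerivAt (fun s => l (u s)) (l u') t

theorem HasWeakDerivAt.map {u : ℝ → V} {u' : V} {t : ℝ} (h : HasWeakDerivAt u u' t)
    (L : V →ₗ[ℝ] W) : HasWeakDerivAt (fun s => L (u s)) (L u') t :=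
  fun l => h (l ∘ₗ L)

theorem HasWeakDerivAt.add {u v : ℝ → V} {u' v' : V} {t : ℝ} (hu : HasWeakDerivAt u u' t)
    (hv : HasWeakDerivAt v v' t) : HasWeakDerivAt (fun s => u s + v s) (u' + v') t := by
  intro l
  simpa using! (hu l).add (hv l)

theorem hasWeakDerivAt_const (v : V) (t : ℝ) : HasWeakDerivAt (fun _ => v) 0 t := by
  intro l
  simpa using hasDerivAt_const t (l v)

theorem HasWeakDerivAt.unique [Module.Finite ℝ V] {u : ℝ → V} {u' v' : V} {t : ℝ}
    (h : HasWeakDerivAt u u' t) (h' : HasWeakDerivAt u v' t) : u' = v' := by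
  rw [← sub_eq_zero, ← Module.forall_dual_apply_eq_zero_iff ℝ]
  intro l
  rw [map_sub, sub_eq_zero]
  exact (h l).unique (h' l)

theorem HasWeakDerivAt.congr {u v : ℝ → V} {u' : V} {t : ℝ} (h : HasWeakDerivAt u u' t)
    (e : v =ᶠ[𝓝 t] u) : HasWeakDerivAt v u' t :=
  fun l => (h l).congr_of_eventuallyEq (e.fun_comp l)

/-- Coordinates in a basis are functionals, and functionals are continuous in finite dimension.
Testing by functionals allows curves in `𝕜 ⊗ 𝔤` to be differentiated without choosing a norm there.
-/
theorem hasWeakDerivAt_iff {E : Type*} [NormedAddCommGroup E] [NormedSpace ℝ E]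
    [FiniteDimensional ℝ E] {u : ℝ → E} {u' : E} {t : ℝ} :
    HasWeakDerivAt u u' t ↔ HasDerivAt u u' t := by
  refine ⟨fun h => ?_, fun h l => ?_⟩
  · let b := Module.finBasis ℝ E
    have h1 : HasDerivAt (fun s => ∑ i, b.coord i (u s) • b i) (∑ i, b.coord i u' • b i) t :=
      HasDerivAt.fun_sum fun i _ => (h (b.coord i)).smul_const (b i)
    simpa only [Module.Basis.coord_apply, b.sum_repr] using h1
  · exact (LinearMap.toContinuousLinearMap l).hasFDerivAt.comp_hasDerivAt t h

/-- The Leibniz rule for a curve of operators through the identity. -/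
theorem HasWeakDerivAt.apply_operator [Module.Finite ℝ V] {ρ : ℝ → V →ₗ[ℝ] V} {D : V →ₗ[ℝ] V}
    (hρ0 : ρ 0 = LinearMap.id) (hρ : ∀ v, HasWeakDerivAt (fun t => ρ t v) (D v) 0) {u : ℝ → V}
    {u' : V} (hu : HasWeakDerivAt u u' 0) :
    HasWeakDerivAt (fun t => ρ t (u t)) (u' + D (u 0)) 0 := by
  let b := Module.finBasis ℝ V
  intro l
  have hb : ∀ (L : V →ₗ[ℝ] ℝ) v, L v = ∑ i, b.coord i v * L (b i) := by
    intro L v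
    conv_lhs => rw [← b.sum_repr v]
    simp only [map_sum, map_smul, smul_eq_mul, Module.Basis.coord_apply]
  have h1 : ∀ t, l (ρ t (u t)) = ∑ i, b.coord i (u t) * l (ρ t (b i)) :=
    fun t => hb (l ∘ₗ ρ t) (u t)
  simp_rw [h1]
  have h2 := HasDerivAt.fun_sum (u := Finset.univ) (A := fun i t => b.coord i (u t) * l (ρ t (b i)))
    (fun i _ => (hu (b.coord i)).mul (hρ (b i) l))
  refine h2.congr_deriv ?_
  have h3 := hb (l ∘ₗ D) (u 0)
  simp only [LinearMap.comp_apply] at h3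
  rw [map_add, hb l u', h3, Finset.sum_add_distrib, hρ0]
  rfl

/-- In the standard basis `f` is a polynomial in the coordinates. The continuity is what the product
rule for continuous multilinear maps requires. -/
theorem continuous_multilinear_pi {ι κ : Type*} [Fintype ι] [Fintype κ] [DecidableEq ι]
    (f : MultilinearMap ℝ (fun _ : ι => κ → ℝ) ℝ) : Continuous f := by
  classical
  have h : ∀ v : ι → κ → ℝ, f v =
      ∑ J : ι → κ, (∏ i, v i (J i)) * f (fun i => Pi.single (J i) 1) := by
    intro v
    have hv : v = fun i => ∑ j, v i j • (Pi.single j 1 : κ → ℝ) := by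
      funext i
      exact (pi_eq_sum_univ' (v i))
    conv_lhs => rw [hv, MultilinearMap.map_sum]
    simp only [MultilinearMap.map_smul_univ, smul_eq_mul]
  have h' : (f : (ι → κ → ℝ) → ℝ) =
      fun v => ∑ J : ι → κ, (∏ i, v i (J i)) * f (fun i => Pi.single (J i) 1) := funext h
  rw [h']
  fun_prop

/-- The Leibniz rule for multilinear maps. -/
theorem HasWeakDerivAt.multilinear [Module.Finite ℝ V] {ι : Type*} [Fintype ι] [DecidableEq ι]
    (f : MultilinearMap ℝ (fun _ : ι => V) W) {u : ι → ℝ → V} {u' : ι → V} {t : ℝ}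
    (hu : ∀ i, HasWeakDerivAt (u i) (u' i) t) :
    HasWeakDerivAt (fun s => f (fun i => u i s))
      (∑ j, f (Function.update (fun i => u i t) j (u' j))) t := by
  intro l
  let b := Module.finBasis ℝ V
  let e := b.equivFun
  let F : MultilinearMap ℝ (fun _ : ι => Fin (Module.finrank ℝ V) → ℝ) ℝ :=
    (l.compMultilinearMap f).compLinearMap (fun _ => e.symm.toLinearMap)
  let Fc : ContinuousMultilinearMap ℝ (fun _ : ι => Fin (Module.finrank ℝ V) → ℝ) ℝ :=
    ⟨F, continuous_multilinear_pi F⟩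
  have h1 : ∀ i, HasFDerivAt (fun s => e (u i s))
      (ContinuousLinearMap.toSpanSingleton ℝ (e (u' i))) t :=
    fun i => (hasWeakDerivAt_iff.1 ((hu i).map e.toLinearMap)).hasFDerivAt
  have h2 := (HasFDerivAt.multilinear_comp Fc h1).hasDerivAt
  have h3 : ∀ s, Fc (fun i => e (u i s)) = l (f fun i => u i s) := by
    intro s
    change l (f fun i => e.symm (e (u i s))) = _
    simp
  simp only [h3] at h2
  refine h2.congr_deriv ?_
  simp only [sum_apply, ContinuousLinearMap.comp_apply,
    ContinuousLinearMap.toSpanSingleton_apply, one_smul, map_sum]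
  refine Finset.sum_congr rfl fun j _ => ?_
  change l (f fun i => e.symm (Function.update (fun i => e (u i t)) j (e (u' j)) i)) = _
  congr 2
  funext i
  by_cases hij : i = j
  · subst hij; simp
  · simp [hij]

end WeakDeriv

/-! ### Smoothness and differentiation on manifolds -/

section Manifold

theorem hasDerivAt_comp_mfderiv {E : Type*} [NormedAddCommGroup E]
    [NormedSpace ℝ E] {P : Type*} [TopologicalSpace P] [ChartedSpace E P] {f : P → ℝ} {c : ℝ → P} {p : P}
    (hf : MDifferentiableAt 𝓘(ℝ, E) 𝓘(ℝ, ℝ) f p) (hc : MDifferentiableAt 𝓘(ℝ, ℝ) 𝓘(ℝ, E) c 0)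
    (h0 : c 0 = p) :
    HasDerivAt (fun t => f (c t)) ((mfderiv 𝓘(ℝ, E) 𝓘(ℝ, ℝ) f p : E →L[ℝ] ℝ)
      (mfderiv 𝓘(ℝ, ℝ) 𝓘(ℝ, E) c 0 (1 : ℝ))) 0 := by
  subst h0
  have h := HasMFDerivAt.comp (0 : ℝ) hf.hasMFDerivAt hc.hasMFDerivAt
  let D₁ : E →L[ℝ] ℝ := mfderiv 𝓘(ℝ, E) 𝓘(ℝ, ℝ) f (c 0)
  let D₂ : ℝ →L[ℝ] E := mfderiv 𝓘(ℝ, ℝ) 𝓘(ℝ, E) c 0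
  have h' : HasFDerivAt (fun t => f (c t)) (D₁.comp D₂) 0 := h.hasFDerivAt
  exact h'.hasDerivAt

variable {E : Type*} [NormedAddCommGroup E] [NormedSpace ℝ E] {P : Type*} [TopologicalSpace P]
  [ChartedSpace E P] [IsManifold 𝓘(ℝ, E) ∞ P]

/-- The tangent trivialization at `p` is the differential of the chart at `p`, which is the identity
over `p` itself. So smoothness of a map into one fixed fibre and into the tangent bundle agree. -/
theorem trivializationAt_self_snd (p : P) (v : TangentSpace 𝓘(ℝ, E) p) :
    (trivializationAt E (TangentSpace 𝓘(ℝ, E) : P → Type _) p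
      (⟨p, v⟩ : TangentBundle 𝓘(ℝ, E) P)).2 = v := by
  have : IsManifold 𝓘(ℝ, E) 1 P := IsManifold.of_le (n := ∞) (by simp)
  have h := TangentBundle.continuousLinearMapAt_trivializationAt (I := 𝓘(ℝ, E))
    (mem_chart_source E p)
  rw [mfderiv_extChartAt_self] at h
  have h2 := congrFun (congrArg DFunLike.coe h) v
  rw [Bundle.Trivialization.continuousLinearMapAt_apply,
    Bundle.Trivialization.coe_linearMapAt_of_mem _ (by simp)] at h2
  exact h2

variable {EN : Type*} [NormedAddCommGroup EN] [NormedSpace ℝ EN] {N : Type*} [TopologicalSpace N]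
  [ChartedSpace EN N]

theorem contMDiffAt_mk_const {p : P} {v : N → E} {x₀ : N}
    (hv : ContMDiffAt 𝓘(ℝ, EN) 𝓘(ℝ, E) ∞ v x₀) :
    ContMDiffAt 𝓘(ℝ, EN) 𝓘(ℝ, E).tangent ∞
      (fun x => (⟨p, v x⟩ : TangentBundle 𝓘(ℝ, E) P)) x₀ := by
  rw [Bundle.contMDiffAt_totalSpace]
  refine ⟨contMDiffAt_const, hv.congr_of_eventuallyEq (Eventually.of_forall fun x => ?_)⟩
  exact trivializationAt_self_snd p (v x)

theorem contMDiffAt_snd_of_const {p : P} {q : N → P} {v : ∀ x, TangentSpace 𝓘(ℝ, E) (q x)} {x₀ : N}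
    (hq : ∀ x, q x = p) (hv : ContMDiffAt 𝓘(ℝ, EN) 𝓘(ℝ, E).tangent ∞
      (fun x => (⟨q x, v x⟩ : TangentBundle 𝓘(ℝ, E) P)) x₀) :
    ContMDiffAt 𝓘(ℝ, EN) 𝓘(ℝ, E) ∞ (fun x => (v x : E)) x₀ := by
  obtain rfl : q = fun _ => p := funext hq
  rw [Bundle.contMDiffAt_totalSpace] at hv
  refine hv.2.congr_of_eventuallyEq (Eventually.of_forall fun x => ?_)
  exact (trivializationAt_self_snd p (v x)).symm

variable [IsManifold 𝓘(ℝ, EN) ∞ N] {EA : Type*} [NormedAddCommGroup EA] [NormedSpace ℝ EA]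
  {A : Type*} [TopologicalSpace A]
  [ChartedSpace EA A] [IsManifold 𝓘(ℝ, EA) ∞ A]

/-- Applying the differentials of a smooth family of maps to a smooth family of tangent vectors
gives a smooth family of tangent vectors. -/
theorem contMDiffAt_mfderiv_apply {F : N → A → P} {a : N → A} {v : ∀ x, TangentSpace 𝓘(ℝ, EA) (a x)}
    {x₀ : N}
    (hF : ContMDiffAt (𝓘(ℝ, EN).prod 𝓘(ℝ, EA)) 𝓘(ℝ, E) ∞ (Function.uncurry F) (x₀, a x₀))
    (hv : ContMDiffAt 𝓘(ℝ, EN) 𝓘(ℝ, EA).tangent ∞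
      (fun x => (⟨a x, v x⟩ : TangentBundle 𝓘(ℝ, EA) A)) x₀) :
    ContMDiffAt 𝓘(ℝ, EN) 𝓘(ℝ, E).tangent ∞
      (fun x => (⟨F x (a x), mfderiv 𝓘(ℝ, EA) 𝓘(ℝ, E) (F x) (a x) (v x)⟩ :
        TangentBundle 𝓘(ℝ, E) P)) x₀ := by
  have ha : ContMDiffAt 𝓘(ℝ, EN) 𝓘(ℝ, EA) ∞ a x₀ := (Bundle.contMDiffAt_totalSpace.1 hv).1
  have h1 := ContMDiffAt.mfderiv F a hF ha (m := ∞) (by simp)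
  have hb : ContMDiffAt 𝓘(ℝ, EN) 𝓘(ℝ, E) ∞ (fun x => F x (a x)) x₀ :=
    ContMDiffAt.comp x₀ (g := Function.uncurry F) hF (contMDiffAt_id.prodMk ha)
  exact ContMDiffAt.clm_apply_of_inCoordinates h1 hv hb

end Manifold

/-! ### The adjoint representation -/

section Adjoint

variable {n : ℕ} {G : Type*} [TopologicalSpace G] [ChartedSpace (EuclideanSpace ℝ (Fin n)) G]
  [Group G]

theorem Ad_one : Ad n (1 : G) = LinearMap.id := by
  have h : (fun h : G => 1 * h * 1⁻¹) = id := by funext h; simp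
  ext η
  unfold Ad
  rw [h]
  exact congrFun (congrArg DFunLike.coe (mfderiv_id (I := 𝓡 n) (x := (1 : G)))) η

/-- The Lie algebra of `G` as a Euclidean space. -/
def toModel : LieAlg n G ≃ₗ[ℝ] EuclideanSpace ℝ (Fin n) := LinearEquiv.refl ℝ _

/-- A curve in `G` through `1` with velocity `ξ`. -/
def curve (ξ : LieAlg n G) (t : ℝ) : G :=
  (extChartAt (𝓡 n) (1 : G)).symm
    (extChartAt (𝓡 n) (1 : G) 1 + t • toModel ξ)

theorem curve_zero (ξ : LieAlg n G) : curve ξ 0 = (1 : G) := by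
  unfold curve
  rw [zero_smul, add_zero]
  exact extChartAt_to_inv (1 : G)

variable [LieGroup (𝓡 n) ∞ G]

theorem isManifold_of_lieGroup : IsManifold (𝓡 n) ∞ G :=
  (inferInstance : LieGroup (𝓡 n) ∞ G).toContMDiffMul.toIsManifold

theorem contMDiff_conj (g : G) : ContMDiff (𝓡 n) (𝓡 n) ∞ (fun h : G => g * h * g⁻¹) :=
  (contMDiff_const.mul contMDiff_id).mul contMDiff_const

/-- `Ad_g η` is the differential at `h = 1` of the smooth family `(g, h) ↦ g h g⁻¹`, applied to a
constant vector; all its values lie over the single point `1`. -/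
theorem contMDiff_Ad (η : LieAlg n G) :
    ContMDiff (𝓡 n) (𝓡 n) (M' := EuclideanSpace ℝ (Fin n)) ∞ (fun g : G => Ad n g η) := by
  have : IsManifold (𝓡 n) ∞ G := isManifold_of_lieGroup
  intro g₀
  have hF : ContMDiffAt ((𝓡 n).prod (𝓡 n)) (𝓡 n) ∞
      (Function.uncurry fun g h : G => g * h * g⁻¹) (g₀, 1) :=
    ((contMDiff_fst.mul contMDiff_snd).mul contMDiff_fst.inv).contMDiffAt
  have h := contMDiffAt_mfderiv_apply (a := fun _ : G => (1 : G)) (v := fun _ => η) hF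
    contMDiffAt_const
  exact contMDiffAt_snd_of_const (p := (1 : G)) (q := fun x : G => x * 1 * x⁻¹)
    (fun x => by simp) h

theorem Ad_mul_apply (g h : G) (η : LieAlg n G) : Ad n (g * h) η = Ad n g (Ad n h η) := by
  have e : (fun x : G => g * h * x * (g * h)⁻¹) =
      (fun x => g * x * g⁻¹) ∘ (fun x => h * x * h⁻¹) := by funext x; simp [mul_assoc]
  have h1 : MDifferentiableAt (𝓡 n) (𝓡 n) (fun x : G => g * x * g⁻¹) (h * 1 * h⁻¹) :=
    (contMDiff_conj g).mdifferentiable (by simp) _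
  have h2 : MDifferentiableAt (𝓡 n) (𝓡 n) (fun x : G => h * x * h⁻¹) 1 :=
    (contMDiff_conj h).mdifferentiable (by simp) _
  have h3 := mfderiv_comp (1 : G) h1 h2
  unfold Ad
  rw [e, h3, show h * 1 * h⁻¹ = 1 by simp]
  rfl

theorem Ad_mul (g h : G) : Ad n (g * h) = Ad n g ∘ₗ Ad n h :=
  LinearMap.ext fun η => Ad_mul_apply g h η

theorem Ad_inv_apply_Ad (g : G) (η : LieAlg n G) : Ad n g⁻¹ (Ad n g η) = η := by
  rw [← Ad_mul_apply, inv_mul_cancel, Ad_one]; rfl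

theorem Ad_apply_Ad_inv (g : G) (η : LieAlg n G) : Ad n g (Ad n g⁻¹ η) = η := by
  rw [← Ad_mul_apply, mul_inv_cancel, Ad_one]; rfl

theorem contMDiffAt_curve (ξ : LieAlg n G) : ContMDiffAt 𝓘(ℝ, ℝ) (𝓡 n) ∞ (curve ξ : ℝ → G) 0 := by
  have : IsManifold (𝓡 n) ∞ G := isManifold_of_lieGroup
  have h1 : ContMDiffAt 𝓘(ℝ, ℝ) (𝓡 n) ∞ (fun t : ℝ => extChartAt (𝓡 n) (1 : G) 1 +
      t • toModel ξ) 0 := by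
    apply ContDiff.contMDiff
    fun_prop
  have h2 : ContMDiffAt (𝓡 n) (𝓡 n) ∞ (extChartAt (𝓡 n) (1 : G)).symm
      (extChartAt (𝓡 n) (1 : G) 1 + (0 : ℝ) • toModel ξ) := by
    rw [zero_smul, add_zero]
    exact (contMDiffOn_extChartAt_symm (1 : G)).contMDiffAt (extChartAt_target_mem_nhds (1 : G))
  exact ContMDiffAt.comp (0 : ℝ) h2 h1

theorem mfderiv_curve (ξ : LieAlg n G) :
    (mfderiv 𝓘(ℝ, ℝ) (𝓡 n) (curve ξ : ℝ → G) 0 : ℝ →L[ℝ] EuclideanSpace ℝ (Fin n)) 1 = ξ := by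
  have : IsManifold (𝓡 n) ∞ G := isManifold_of_lieGroup
  have h1 : HasFDerivAt (fun t : ℝ => extChartAt (𝓡 n) (1 : G) 1 +
      t • toModel ξ)
      (ContinuousLinearMap.toSpanSingleton ℝ (toModel ξ)) 0 := by
    have h := ((hasDerivAt_id (0 : ℝ)).smul_const (toModel ξ)).const_add
      (extChartAt (𝓡 n) (1 : G) 1)
    rw [one_smul] at h
    exact h.hasFDerivAt
  have h2 : HasMFDerivAt (𝓡 n) (𝓡 n) (extChartAt (𝓡 n) (1 : G)).symm
      (extChartAt (𝓡 n) (1 : G) 1 + (0 : ℝ) • toModel ξ)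
      (ContinuousLinearMap.id ℝ (EuclideanSpace ℝ (Fin n))) := by
    rw [zero_smul, add_zero, ← mfderiv_extChartAt_symm_self (1 : G)]
    exact (mdifferentiableAt_extChartAt_symm (mem_extChartAt_target (1 : G))).hasMFDerivAt
  have h3 := HasMFDerivAt.comp (0 : ℝ) h2 h1.hasMFDerivAt
  have h4 := h3.mfderiv
  have h5 := congrArg (fun L : ℝ →L[ℝ] EuclideanSpace ℝ (Fin n) => L 1) h4
  refine Eq.trans h5 ?_
  change (1 : ℝ) • toModel ξ = toModel ξ
  exact one_smul _ _

theorem mfderiv_comp_curve {E : Type*} [NormedAddCommGroup E] [NormedSpace ℝ E] {P : Type*}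
    [TopologicalSpace P] [ChartedSpace E P] {f : G → P}
    (hf : MDifferentiableAt (𝓡 n) 𝓘(ℝ, E) f 1) (ξ : LieAlg n G) :
    (mfderiv 𝓘(ℝ, ℝ) 𝓘(ℝ, E) (fun t => f (curve ξ t)) 0 : ℝ →L[ℝ] E) 1 =
      (mfderiv (𝓡 n) 𝓘(ℝ, E) f 1 : EuclideanSpace ℝ (Fin n) →L[ℝ] E) ξ := by
  have h1 : HasMFDerivAt (𝓡 n) 𝓘(ℝ, E) f (curve ξ 0) (mfderiv (𝓡 n) 𝓘(ℝ, E) f (curve ξ 0)) := by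
    rw [curve_zero]; exact hf.hasMFDerivAt
  have h2 := (contMDiffAt_curve (G := G) ξ).mdifferentiableAt (by simp)
  have h3 := (HasMFDerivAt.comp (0 : ℝ) h1 h2.hasMFDerivAt).mfderiv
  rw [curve_zero] at h3
  refine (congrArg (fun L : ℝ →L[ℝ] E => L 1) h3).trans ?_
  exact congrArg (mfderiv (𝓡 n) 𝓘(ℝ, E) f 1 : EuclideanSpace ℝ (Fin n) →L[ℝ] E) (mfderiv_curve ξ)

/-- Apply the bracket formula to `a(q, t) = q · curve ξ t`. Its velocity field is the left-invariant
field of `ξ`, and pulling back the left-invariant field of `η` to `1` gives `Ad (curve ξ t) η`. -/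
theorem hasWeakDerivAt_Ad_curve (ξ η : LieAlg n G) :
    HasWeakDerivAt (fun t => Ad n (curve ξ t) η) ⁅ξ, η⁆ 0 := by
  have : IsManifold (𝓡 n) ∞ G := isManifold_of_lieGroup
  let a : G × ℝ → G := fun z => z.1 * curve (G := G) ξ z.2
  have ha : ContMDiffAt ((𝓡 n).prod 𝓘(ℝ, ℝ)) (𝓡 n) 2 a (1, 0) :=
    (contMDiffAt_fst.mul (ContMDiffAt.comp ((1, 0) : G × ℝ) (contMDiffAt_curve ξ)
      contMDiffAt_snd)).of_le (WithTop.coe_le_coe.mpr (le_top : (2 : ℕ∞) ≤ ⊤))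
  have ha0 : ∀ q, a (q, 0) = q := fun q => by
    change q * curve (G := G) ξ 0 = q
    rw [curve_zero, mul_one]
  have h := hasDerivAt_mlieBracket_of_mfderiv ha ha0
    (mdifferentiableAt_mulInvariantVectorField (I := 𝓡 n) η)
    (Z := fun t => Ad n (curve ξ t) η) (Eventually.of_forall fun t => ?_)
  · refine hasWeakDerivAt_iff.2 (h.congr_deriv ?_)
    rw [GroupLieAlgebra.bracket_def]
    congr 1
    funext q
    exact mfderiv_comp_curve (f := fun h : G => q * h)
      ((contMDiff_mul_left (I := 𝓡 n) (n := ∞)).mdifferentiable (by simp) _) ξ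
  -- Left translation is conjugation followed by right translation; this is the pull-back relation
  -- required of `Z`.
  · have e : (fun x : G => 1 * curve ξ t * x) =
        (fun x => x * curve ξ t) ∘ (fun x => curve ξ t * x * (curve ξ t)⁻¹) := by
      funext x; simp
    have d1 : MDifferentiableAt (𝓡 n) (𝓡 n) (fun x : G => x * curve ξ t)
        (curve ξ t * 1 * (curve ξ t)⁻¹) :=
      (contMDiff_mul_right (I := 𝓡 n) (n := ∞)).mdifferentiable (by simp) _
    have d2 : MDifferentiableAt (𝓡 n) (𝓡 n)
        (fun x : G => curve ξ t * x * (curve ξ t)⁻¹) 1 :=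
      (contMDiff_conj _).mdifferentiable (by simp) _
    have h3 := mfderiv_comp (1 : G) d1 d2
    unfold mulInvariantVectorField
    change _ = (mfderiv (𝓡 n) (𝓡 n) (fun x : G => 1 * curve ξ t * x) 1) η
    rw [e, h3, show curve ξ t * 1 * (curve ξ t)⁻¹ = (1 : G) by simp]
    rfl

end Adjoint

/-! ### Smooth vector-valued maps at a point -/

section SmoothInto

variable {k : ℕ} {P : Type*} [TopologicalSpace P] [ChartedSpace (EuclideanSpace ℝ (Fin k)) P]
  {V W : Type*} [AddCommGroup V] [Module ℝ V] [AddCommGroup W] [Module ℝ W]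

/-- Smoothness at a point of a map with values in a finite-dimensional real vector space. -/
def SmoothIntoAt (k : ℕ) {P : Type*} [TopologicalSpace P]
    [ChartedSpace (EuclideanSpace ℝ (Fin k)) P] {V : Type*} [AddCommGroup V] [Module ℝ V]
    (f : P → V) (p : P) : Prop :=
  ∀ l : V →ₗ[ℝ] ℝ, ContMDiffAt (𝓡 k) 𝓘(ℝ, ℝ) ∞ (fun p => l (f p)) p

theorem smoothInto_iff_forall {f : P → V} : SmoothInto k f ↔ ∀ p, SmoothIntoAt k f p :=
  ⟨fun h p l => h l p, fun h l p => h p l⟩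

theorem SmoothIntoAt.congr {f g : P → V} {p : P} (hf : SmoothIntoAt k f p) (h : g =ᶠ[𝓝 p] f) :
    SmoothIntoAt k g p :=
  fun l => (hf l).congr_of_eventuallyEq (h.fun_comp l)

theorem SmoothIntoAt.add {f g : P → V} {p : P} (hf : SmoothIntoAt k f p)
    (hg : SmoothIntoAt k g p) : SmoothIntoAt k (fun q => f q + g q) p := by
  intro l
  simpa [Pi.add_def] using (hf l).add (hg l)

theorem SmoothIntoAt.sum {ι : Type*} (S : Finset ι) {f : ι → P → V} {p : P}
    (h : ∀ i ∈ S, SmoothIntoAt k (f i) p) : SmoothIntoAt k (fun q => ∑ i ∈ S, f i q) p := by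
  intro l
  simp only [map_sum]
  exact contMDiffAt_finsetSum fun i hi => h i hi l

theorem SmoothIntoAt.fun_smul {c : P → ℝ} {f : P → V} {p : P}
    (hc : ContMDiffAt (𝓡 k) 𝓘(ℝ, ℝ) ∞ c p) (hf : SmoothIntoAt k f p) :
    SmoothIntoAt k (fun q => c q • f q) p := by
  intro l
  simp only [map_smul, smul_eq_mul]
  exact hc.mul (hf l)

theorem smoothIntoAt_of_contMDiffAt {E : Type*} [NormedAddCommGroup E] [NormedSpace ℝ E]
    [FiniteDimensional ℝ E] {f : P → E} {p : P} (hf : ContMDiffAt (𝓡 k) 𝓘(ℝ, E) ∞ f p) :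
    SmoothIntoAt k f p := by
  intro l
  exact ContMDiffAt.comp p (LinearMap.toContinuousLinearMap l).contMDiff.contMDiffAt hf

theorem SmoothIntoAt.contMDiffAt {E : Type*} [NormedAddCommGroup E] [NormedSpace ℝ E]
    [FiniteDimensional ℝ E] {f : P → E} {p : P} (hf : SmoothIntoAt k f p) :
    ContMDiffAt (𝓡 k) 𝓘(ℝ, E) ∞ f p := by
  let b := Module.finBasis ℝ E
  have h : ContMDiffAt (𝓡 k) 𝓘(ℝ, E) ∞ (fun q => ∑ i, b.coord i (f q) • b i) p :=
    contMDiffAt_finsetSum fun i _ => (hf (b.coord i)).smul contMDiffAt_const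
  simpa only [Module.Basis.coord_apply, b.sum_repr] using h

/-- Application of a smooth family of operators to a smooth map. -/
theorem SmoothIntoAt.apply_operator [Module.Finite ℝ V] {ρ : P → V →ₗ[ℝ] W} {f : P → V} {p : P}
    (hρ : ∀ v, SmoothIntoAt k (fun q => ρ q v) p) (hf : SmoothIntoAt k f p) :
    SmoothIntoAt k (fun q => ρ q (f q)) p := by
  let b := Module.finBasis ℝ V
  have h : SmoothIntoAt k (fun q => ∑ i, b.coord i (f q) • ρ q (b i)) p :=
    SmoothIntoAt.sum _ fun i _ => SmoothIntoAt.fun_smul (hf (b.coord i)) (hρ (b i))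
  refine h.congr (Eventually.of_forall fun q => ?_)
  change ρ q (f q) = _
  conv_lhs => rw [← b.sum_repr (f q)]
  simp only [map_sum, map_smul, Module.Basis.coord_apply]

/-- Expansion of a multilinear family along a smooth family of vectors. -/
theorem smoothIntoAt_multilinear {ι κ : Type*} [Fintype ι] [DecidableEq ι] [Fintype κ]
    {T : P → Type*} [∀ q, AddCommGroup (T q)] [∀ q, Module ℝ (T q)]
    (β : ∀ q, MultilinearMap ℝ (fun _ : ι => T q) W) {p : P} {Z : ι → ∀ q, T q} {e : κ → ∀ q, T q}
    {c : ι → κ → P → ℝ} (hc : ∀ i j, ContMDiffAt (𝓡 k) 𝓘(ℝ, ℝ) ∞ (c i j) p)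
    (hβ : ∀ J : ι → κ, SmoothIntoAt k (fun q => β q (fun i => e (J i) q)) p)
    (hZ : ∀ᶠ q in 𝓝 p, ∀ i, Z i q = ∑ j, c i j q • e j q) :
    SmoothIntoAt k (fun q => β q (fun i => Z i q)) p := by
  classical
  have h : SmoothIntoAt k
      (fun q => ∑ J : ι → κ, (∏ i, c i (J i) q) • β q (fun i => e (J i) q)) p :=
    SmoothIntoAt.sum _ fun J _ => SmoothIntoAt.fun_smul
      (contMDiffAt_finsetProd fun i _ => hc i (J i)) (hβ J)
  refine h.congr (hZ.mono fun q hq => ?_)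
  have hq' : (fun i => Z i q) = fun i => ∑ j, c i j q • e j q := funext hq
  simp only [hq', MultilinearMap.map_sum, MultilinearMap.map_smul_univ]

/-- `dirDeriv` is written in a chosen basis. Compatibility with every functional shows that the
choice is immaterial. -/
theorem map_dirDeriv [Module.Finite ℝ V] {f : P → V} {p : P} (hf : SmoothIntoAt k f p)
    (v : TangentSpace (𝓡 k) p) (l : V →ₗ[ℝ] ℝ) :
    l (dirDeriv (k := k) f p v) =
      (mfderiv (𝓡 k) 𝓘(ℝ, ℝ) (fun q => l (f q)) p : EuclideanSpace ℝ (Fin k) →L[ℝ] ℝ) v := by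
  let b := Module.finBasis ℝ V
  let F : P → Fin (Module.finrank ℝ V) → ℝ := fun q i => b.coord i (f q)
  have hF : MDifferentiableAt (𝓡 k) 𝓘(ℝ, Fin (Module.finrank ℝ V) → ℝ) F p :=
    (contMDiffAt_pi_space.2 fun i => hf (b.coord i)).mdifferentiableAt (n := ∞) (by simp)
  let D : EuclideanSpace ℝ (Fin k) →L[ℝ] (Fin (Module.finrank ℝ V) → ℝ) :=
    mfderiv (𝓡 k) 𝓘(ℝ, Fin (Module.finrank ℝ V) → ℝ) F p
  have hcomp : ∀ L : (Fin (Module.finrank ℝ V) → ℝ) →L[ℝ] ℝ,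
      (mfderiv (𝓡 k) 𝓘(ℝ, ℝ) (fun q => L (F q)) p : EuclideanSpace ℝ (Fin k) →L[ℝ] ℝ) =
        L.comp D := fun L =>
    (HasMFDerivAt.comp p (L.hasMFDerivAt (x := F p)) hF.hasMFDerivAt).mfderiv
  have h1 : ∀ i, (mfderiv (𝓡 k) 𝓘(ℝ, ℝ) (fun q => b.repr (f q) i) p :
      EuclideanSpace ℝ (Fin k) →L[ℝ] ℝ) v = D v i := fun i =>
    congrArg (fun L : EuclideanSpace ℝ (Fin k) →L[ℝ] ℝ => L v) (hcomp (ContinuousLinearMap.proj i))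
  let L : (Fin (Module.finrank ℝ V) → ℝ) →L[ℝ] ℝ :=
    ∑ i, l (b i) • ContinuousLinearMap.proj (R := ℝ) (φ := fun _ => ℝ) i
  have hL : ∀ x, L x = ∑ i, x i * l (b i) := by
    intro x
    simp [L, mul_comm]
  have h2 : (fun q => l (f q)) = fun q => L (F q) := by
    funext q
    rw [hL]
    conv_lhs => rw [← b.sum_repr (f q)]
    simp only [map_sum, map_smul, smul_eq_mul, F, Module.Basis.coord_apply]
  have h3 : l (dirDeriv (k := k) f p v) = ∑ i, D v i * l (b i) := by
    unfold dirDeriv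
    rw [map_sum]
    refine Finset.sum_congr rfl fun i _ => ?_
    rw [map_smul, smul_eq_mul]
    exact congrArg (· * l (b i)) (h1 i)
  rw [h3, h2, ← hL]
  exact (congrArg (fun L : EuclideanSpace ℝ (Fin k) →L[ℝ] ℝ => L v) (hcomp L)).symm

theorem hasWeakDerivAt_dirDeriv [Module.Finite ℝ V] {f : P → V} {p : P} (hf : SmoothIntoAt k f p)
    {c : ℝ → P} (hc : MDifferentiableAt 𝓘(ℝ, ℝ) (𝓡 k) c 0) (h0 : c 0 = p)
    {v : TangentSpace (𝓡 k) p}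
    (hv : (mfderiv 𝓘(ℝ, ℝ) (𝓡 k) c 0 : ℝ →L[ℝ] EuclideanSpace ℝ (Fin k)) 1 = v) :
    HasWeakDerivAt (fun t => f (c t)) (dirDeriv (k := k) f p v) 0 := by
  intro l
  rw [map_dirDeriv hf v l, ← hv]
  exact hasDerivAt_comp_mfderiv ((hf l).mdifferentiableAt (by simp)) hc h0

end SmoothInto

/-! ### The adjoint representation on `𝕜 ⊗ 𝔤` -/

section Adjoint

variable {n : ℕ} {G : Type*} [TopologicalSpace G] [ChartedSpace (EuclideanSpace ℝ (Fin n)) G]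
  [Group G] (𝕜 : Type*) [RCLike 𝕜]

theorem AdK_one : AdK n 𝕜 (1 : G) = LinearMap.id := by
  rw [AdK, Ad_one, LinearMap.baseChange_id]

variable [LieGroup (𝓡 n) ∞ G]

theorem smoothInto_Ad (η : LieAlg n G) : SmoothInto n (fun g : G => Ad n g η) :=
  smoothInto_iff_forall.2 fun g => smoothIntoAt_of_contMDiffAt (E := EuclideanSpace ℝ (Fin n))
    (contMDiff_Ad η g)

theorem smoothInto_AdK (v : LieAlgK n G 𝕜) : SmoothInto n (fun g : G => AdK n 𝕜 g v) := by
  induction v using TensorProduct.induction_on with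
  | zero => simpa using SmoothInto.zero
  | tmul z η =>
    intro l
    exact smoothInto_Ad η (l ∘ₗ TensorProduct.mk ℝ 𝕜 (LieAlg n G) z)
  | add x y hx hy => simpa using hx.add hy

theorem AdK_mul_apply (g h : G) (v : LieAlgK n G 𝕜) :
    AdK n 𝕜 (g * h) v = AdK n 𝕜 g (AdK n 𝕜 h v) := by
  rw [AdK, Ad_mul, LinearMap.baseChange_comp]
  rfl

theorem AdK_inv_apply_AdK (g : G) (v : LieAlgK n G 𝕜) : AdK n 𝕜 g⁻¹ (AdK n 𝕜 g v) = v := by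
  rw [← AdK_mul_apply, inv_mul_cancel, AdK_one]; rfl

theorem AdK_apply_AdK_inv (g : G) (v : LieAlgK n G 𝕜) : AdK n 𝕜 g (AdK n 𝕜 g⁻¹ v) = v := by
  rw [← AdK_mul_apply, mul_inv_cancel, AdK_one]; rfl

theorem hasWeakDerivAt_AdK_curve (ξ : LieAlg n G) (v : LieAlgK n G 𝕜) :
    HasWeakDerivAt (fun t => AdK n 𝕜 (curve ξ t) v) (adK n 𝕜 ξ v) 0 := by
  induction v using TensorProduct.induction_on with
  | zero => simpa using hasWeakDerivAt_const (0 : LieAlgK n G 𝕜) 0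
  | tmul z η =>
    intro l
    exact hasWeakDerivAt_Ad_curve ξ η (l ∘ₗ TensorProduct.mk ℝ 𝕜 (LieAlg n G) z)
  | add x y hx hy => simpa using hx.add hy

end Adjoint

/-! ### From infinitesimal to global statements on a connected group -/

section Connected

variable {n : ℕ} {G : Type*} [TopologicalSpace G] [ChartedSpace (EuclideanSpace ℝ (Fin n)) G]
  [Group G] [LieGroup (𝓡 n) ∞ G]

theorem mfderiv_mul_left_surjective (g : G) (v : TangentSpace (𝓡 n) g) :
    ∃ ξ : LieAlg n G, (mfderiv (𝓡 n) (𝓡 n) (fun h : G => g * h) 1 :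
      EuclideanSpace ℝ (Fin n) →L[ℝ] EuclideanSpace ℝ (Fin n)) ξ = v := by
  have e : (fun h : G => g * h) ∘ (fun h => g⁻¹ * h) = id := by funext h; simp
  have d : ∀ a : G, MDifferentiable (𝓡 n) (𝓡 n) (fun h : G => a * h) := fun a =>
    (contMDiff_mul_left (I := 𝓡 n) (n := ∞)).mdifferentiable (by simp)
  have h := mfderiv_comp g (d g (g⁻¹ * g)) (d g⁻¹ g)
  rw [e, mfderiv_id, inv_mul_cancel] at h
  refine ⟨(mfderiv (𝓡 n) (𝓡 n) (fun h : G => g⁻¹ * h) g :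
    EuclideanSpace ℝ (Fin n) →L[ℝ] EuclideanSpace ℝ (Fin n)) v, ?_⟩
  exact (congrArg (fun L : EuclideanSpace ℝ (Fin n) →L[ℝ] EuclideanSpace ℝ (Fin n) => L v) h).symm

/-- The velocities of `t ↦ g · curve ξ t` fill `T_gG`, so `df = 0`. Then `f` is constant on a ball
in each chart, hence locally constant, hence constant on the connected group. -/
theorem eq_one_of_hasDerivAt_curve [PreconnectedSpace G] {f : G → ℝ}
    (hf : ContMDiff (𝓡 n) 𝓘(ℝ, ℝ) ∞ f)
    (h : ∀ (g : G) (ξ : LieAlg n G), HasDerivAt (fun t => f (g * curve ξ t)) 0 0) (g : G) :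
    f g = f 1 := by
  have : IsManifold (𝓡 n) ∞ G := isManifold_of_lieGroup
  have d : ∀ a : G, MDifferentiable (𝓡 n) (𝓡 n) (fun h : G => a * h) := fun a =>
    (contMDiff_mul_left (I := 𝓡 n) (n := ∞)).mdifferentiable (by simp)
  have h0 : ∀ g : G, (mfderiv (𝓡 n) 𝓘(ℝ, ℝ) f g : EuclideanSpace ℝ (Fin n) →L[ℝ] ℝ) = 0 := by
    intro g
    ext v
    obtain ⟨ξ, hξ⟩ := mfderiv_mul_left_surjective g v
    have hc0 : g * curve ξ 0 = g := by rw [curve_zero, mul_one]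
    have hc : MDifferentiableAt 𝓘(ℝ, ℝ) (𝓡 n) (fun t => g * curve ξ t) 0 :=
      MDifferentiableAt.comp (0 : ℝ) (d g _)
        ((contMDiffAt_curve ξ).mdifferentiableAt (by simp))
    have h1 := hasDerivAt_comp_mfderiv (hf.mdifferentiable (by simp) g) hc hc0
    have h2 := mfderiv_comp_curve (d g 1) ξ
    have h3 := h1.unique (h g ξ)
    exact (congrArg (mfderiv (𝓡 n) 𝓘(ℝ, ℝ) f g : EuclideanSpace ℝ (Fin n) →L[ℝ] ℝ)
      (h2.trans hξ).symm).trans h3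
  have hloc : IsLocallyConstant f := by
    rw [IsLocallyConstant.iff_eventually_eq]
    intro g₀
    set φ := extChartAt (𝓡 n) g₀ with hφ
    obtain ⟨r, hr, hball⟩ := Metric.mem_nhds_iff.1 (extChartAt_target_mem_nhds (I := 𝓡 n) g₀)
    have hfd : ∀ x ∈ φ.target, HasFDerivAt (fun x => f (φ.symm x))
        (0 : EuclideanSpace ℝ (Fin n) →L[ℝ] ℝ) x := by
      intro x hx
      have h1 := HasMFDerivAt.comp x (hf.mdifferentiable (by simp) (φ.symm x)).hasMFDerivAt
        (mdifferentiableAt_extChartAt_symm hx).hasMFDerivAt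
      rw [h0] at h1
      exact h1.hasFDerivAt
    have hconst : ∀ x ∈ Metric.ball (φ g₀) r, f (φ.symm x) = f (φ.symm (φ g₀)) := by
      intro x hx
      refine Metric.isOpen_ball.is_const_of_fderiv_eq_zero (𝕜 := ℝ)
        (convex_ball (φ g₀) r).isPreconnected
        (f := fun x => f (φ.symm x))
        (fun y hy => (hfd y (hball hy)).differentiableAt.differentiableWithinAt)
        (fun y hy => (hfd y (hball hy)).fderiv) hx (Metric.mem_ball_self hr)
    have hcont : ContinuousAt φ g₀ := continuousAt_extChartAt g₀
    filter_upwards [extChartAt_source_mem_nhds (I := 𝓡 n) g₀,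
      hcont (Metric.ball_mem_nhds _ hr)] with y hy hy'
    have h1 := hconst (φ y) hy'
    rwa [φ.left_inv hy, hφ, extChartAt_to_inv g₀] at h1
  exact hloc.apply_eq_of_preconnectedSpace g 1

/-- Components of `v` along the other basis vectors repeat an argument. Summed over `j`, this turns
the derivative of a determinant into a trace. -/
theorem det_update_self {V : Type*} [AddCommGroup V] [Module ℝ V] {ι : Type*} [Fintype ι]
    [DecidableEq ι] (b : Module.Basis ι ℝ V) (j : ι) (v : V) :
    b.det (Function.update b j v) = b.coord j v := by
  conv_lhs => rw [← b.sum_repr v]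
  rw [AlternatingMap.map_update_sum, Finset.sum_eq_single j]
  · rw [AlternatingMap.map_update_smul, Function.update_eq_self, b.det_self]
    simp
  · intro i _ hij
    rw [AlternatingMap.map_update_smul, AlternatingMap.map_update_self _ _ hij.symm, smul_zero]
  · simp

/-- Along `g · curve ξ t` the determinant has derivative `det(Ad_g) · tr(ad ξ)` at `t = 0`, which is
zero by unimodularity. -/
theorem det_Ad_basis [PreconnectedSpace G] (b : Module.Basis (Fin n) ℝ (LieAlg n G))
    (hu : ∀ ξ : LieAlg n G, LinearMap.trace ℝ _ (LieAlgebra.ad ℝ (LieAlg n G) ξ) = 0) (g : G) :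
    b.det (fun i => Ad n g (b i)) = 1 := by
  have hsmooth : ContMDiff (𝓡 n) 𝓘(ℝ, ℝ) ∞ (fun g : G => b.det (fun i => Ad n g (b i))) := by
    simp only [Module.Basis.det_apply, Matrix.det_apply', Module.Basis.toMatrix_apply]
    exact contMDiff_finsetSum fun σ _ => contMDiff_const.mul
      (contMDiff_finsetProd fun i _ => smoothInto_Ad (b i) (b.coord (σ i)))
  have hd : ∀ (g : G) (ξ : LieAlg n G),
      HasDerivAt (fun t => b.det (fun i => Ad n (g * curve ξ t) (b i))) 0 0 := by
    intro g ξ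
    have h1 := HasWeakDerivAt.multilinear b.det.toMultilinearMap
      (u := fun i t => Ad n (curve ξ t) (b i)) (fun i => hasWeakDerivAt_Ad_curve ξ (b i))
    have h2 := (h1 LinearMap.id).const_mul (LinearMap.det (Ad n g))
    refine (h2.congr_of_eventuallyEq (Eventually.of_forall fun t => ?_)).congr_deriv ?_
    · simp only [Ad_mul]
      exact b.det_comp (Ad n g) (fun i => Ad n (curve ξ t) (b i))
    · have h3 : ∑ j, b.det (Function.update b j ⁅ξ, b j⁆) = 0 := by
        rw [← hu ξ, LinearMap.trace_eq_matrix_trace ℝ b, Matrix.trace]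
        refine Finset.sum_congr rfl fun j _ => ?_
        rw [det_update_self]
        simp [LinearMap.toMatrix_apply]
      have h4 : (fun i => Ad n (curve ξ 0) (b i)) = b := by
        funext i
        rw [curve_zero, Ad_one]; rfl
      simp only [h4, LinearMap.id_apply]
      erw [h3]
      rw [mul_zero]
  rw [eq_one_of_hasDerivAt_curve hsmooth hd g, Ad_one]
  exact b.det_self

end Connected

/-! ### Exterior algebra: the coefficient of top inner degree -/

section Algebra

theorem append_update_left {X : Type*} {r n : ℕ} (y : Fin r → X) (z : Fin n → X) (i : Fin r)
    (c : X) :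
    Fin.append (Function.update y i c) z =
      Function.update (Fin.append y z) (Fin.castAdd n i) c := by
  funext j
  refine Fin.addCases (fun j => ?_) (fun j => ?_) j
  · by_cases hj : j = i
    · subst hj; simp
    · have : Fin.castAdd n j ≠ Fin.castAdd n i := fun h => hj (Fin.castAdd_injective r n h)
      simp [hj, this]
  · have : Fin.natAdd r j ≠ Fin.castAdd n i := by
      intro h
      have := congrArg Fin.val h
      simp at this
      omega
    simp [this]

theorem append_update_right {X : Type*} {r n : ℕ} (y : Fin r → X) (z : Fin n → X) (i : Fin n)
    (c : X) :
    Fin.append y (Function.update z i c) =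
      Function.update (Fin.append y z) (Fin.natAdd r i) c := by
  funext j
  refine Fin.addCases (fun j => ?_) (fun j => ?_) j
  · have : Fin.castAdd n j ≠ Fin.natAdd r i := by
      intro h
      have := congrArg Fin.val h
      simp at this
      omega
    simp [this]
  · by_cases hj : j = i
    · subst hj; simp
    · have : Fin.natAdd r j ≠ Fin.natAdd r i := fun h => hj (Fin.natAdd_injective n r h)
      simp [hj, this]

variable {V W : Type*} [AddCommGroup V] [Module ℝ V] [AddCommGroup W] [Module ℝ W]

/-- A multilinear map which vanishes when one argument lies in `K` depends only on the classes of
its arguments modulo `K`. -/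
theorem multilinear_eq_of_sub_mem {ι : Type*} [Fintype ι] [DecidableEq ι]
    (f : MultilinearMap ℝ (fun _ : ι => V) W) (K : Submodule ℝ V)
    (hK : ∀ v i, v i ∈ K → f v = 0) {v w : ι → V} (h : ∀ i, v i - w i ∈ K) : f v = f w := by
  -- The arguments are exchanged one at a time; each exchange changes the value by a term with one
  -- argument in `K`.
  have key : ∀ S : Finset ι, f (S.piecewise v w) = f w := by
    intro S
    induction S using Finset.induction_on with
    | empty => simp
    | insert j S hj ih =>
      rw [Finset.piecewise_insert, ← ih, ← sub_eq_zero]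
      have h1 : f (S.piecewise v w) = f (Function.update (S.piecewise v w) j (w j)) := by
        congr 1
        rw [Function.eq_update_iff]
        simp [hj]
      rw [h1, ← MultilinearMap.map_update_sub]
      exact hK _ j (by simpa using h j)
  simpa using key Finset.univ

/-- The alternating map obtained by fixing the last arguments. -/
def fixRight {r n : ℕ} (R : V [⋀^Fin (r + n)]→ₗ[ℝ] W) (z : Fin n → V) : V [⋀^Fin r]→ₗ[ℝ] W where
  toFun y := R (Fin.append y z)
  map_update_add' {inst} y i a c := by
    rw [Subsingleton.elim inst (instDecidableEqFin r)]
    simp only [append_update_left, AlternatingMap.map_update_add]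
  map_update_smul' {inst} y i a c := by
    rw [Subsingleton.elim inst (instDecidableEqFin r)]
    simp only [append_update_left, AlternatingMap.map_update_smul]
  map_eq_zero_of_eq' y i j h hij := by
    refine R.map_eq_zero_of_eq (i := Fin.castAdd n i) (j := Fin.castAdd n j) _ (by simpa using h) ?_
    exact fun h => hij (Fin.castAdd_injective r n h)

/-- The alternating map obtained by fixing the first arguments. -/
def fixLeft {r n : ℕ} (R : V [⋀^Fin (r + n)]→ₗ[ℝ] W) (y : Fin r → V) : V [⋀^Fin n]→ₗ[ℝ] W where
  toFun z := R (Fin.append y z)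
  map_update_add' {inst} z i a c := by
    rw [Subsingleton.elim inst (instDecidableEqFin n)]
    simp only [append_update_right, AlternatingMap.map_update_add]
  map_update_smul' {inst} z i a c := by
    rw [Subsingleton.elim inst (instDecidableEqFin n)]
    simp only [append_update_right, AlternatingMap.map_update_smul]
  map_eq_zero_of_eq' z i j h hij := by
    refine R.map_eq_zero_of_eq (i := Fin.natAdd r i) (j := Fin.natAdd r j) _ (by simpa using h) ?_
    exact fun h => hij (Fin.natAdd_injective n r h)

variable {T L : Type*} [AddCommGroup T] [Module ℝ T] [AddCommGroup L] [Module ℝ L] {r n : ℕ}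

/-- The part of inner degree `n` of a form on `T ⊕ L`, evaluated on the basis `b` of `L`. -/
def innerPart (b : Fin n → L) (R : (T × L) [⋀^Fin (r + n)]→ₗ[ℝ] W) : T [⋀^Fin r]→ₗ[ℝ] W :=
  (fixRight R (fun j => (0, b j))).compLinearMap (LinearMap.inl ℝ T L)

theorem innerPart_apply (b : Fin n → L) (R : (T × L) [⋀^Fin (r + n)]→ₗ[ℝ] W) (Y : Fin r → T) :
    innerPart b R Y = R (Fin.append (fun i => (Y i, 0)) (fun j => (0, b j))) := rfl

/-- A further vector of `L` is a combination of the basis vectors already present, so each term of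
its expansion repeats an argument. -/
theorem fixRight_eq_zero (b : Module.Basis (Fin n) ℝ L) (R : (T × L) [⋀^Fin (r + n)]→ₗ[ℝ] W)
    (y : Fin r → T × L) (i : Fin r) (hi : (y i).1 = 0) :
    R (Fin.append y (fun j => (0, b j))) = 0 := by
  have h1 : y i = ∑ a, b.repr (y i).2 a • ((0, b a) : T × L) := by
    refine Prod.ext ?_ ?_
    · simpa [Prod.fst_sum] using hi
    · simp [Prod.snd_sum, b.sum_repr]
  have h2 : Fin.append y (fun j => ((0, b j) : T × L)) =
      Function.update (Fin.append y (fun j => ((0, b j) : T × L))) (Fin.castAdd n i)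
        (∑ a, b.repr (y i).2 a • ((0, b a) : T × L)) := by
    rw [← h1, ← append_update_left, Function.update_eq_self]
  rw [h2, AlternatingMap.map_update_sum]
  refine Finset.sum_eq_zero fun a _ => ?_
  rw [AlternatingMap.map_update_smul]
  have h3 : Fin.castAdd n i ≠ Fin.natAdd r a := by
    intro h
    have := congrArg Fin.val h
    simp at this
    omega
  rw [R.map_eq_zero_of_eq (i := Fin.castAdd n i) (j := Fin.natAdd r a) _ _ h3, smul_zero]
  rw [Function.update_self, Function.update_of_ne h3.symm, Fin.append_right]

/-- On the basis `b`, a form of top inner degree depends only on the `T`-components. -/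
theorem apply_append_basis (b : Module.Basis (Fin n) ℝ L) (R : (T × L) [⋀^Fin (r + n)]→ₗ[ℝ] W)
    (y : Fin r → T × L) :
    R (Fin.append y (fun j => (0, b j))) = innerPart b R (fun i => (y i).1) := by
  rw [innerPart_apply]
  refine multilinear_eq_of_sub_mem (fixRight R (fun j => (0, b j))).toMultilinearMap
    (LinearMap.ker (LinearMap.fst ℝ T L)) (fun v i hi => fixRight_eq_zero b R v i hi) ?_
  intro i
  simp

/-- Vanishing on every choice of `n` arguments from `L` reduces to one choice: alternation moves
these arguments to the last places, and an `n`-form on the `n`-dimensional `L` is determined by its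
value on `b`. -/
theorem innerDegreeLT_iff (b : Module.Basis (Fin n) ℝ L) (R : (T × L) [⋀^Fin (r + n)]→ₗ[ℝ] W) :
    InnerDegreeLT n R ↔ ∀ Y, innerPart b R Y = 0 := by
  classical
  constructor
  · intro h Y
    rw [innerPart_apply]
    refine h _ (Finset.univ.map (Fin.natAddEmb r)) (by simp) fun i hi => ?_
    obtain ⟨j, -, rfl⟩ := Finset.mem_map.1 hi
    simp
  · intro h v S hS hv
    -- A bijection from the last `n` indices to `S`, extended to a permutation of all indices.
    let e : {x // x ∈ Finset.univ.map (Fin.natAddEmb (m := n) r)} ≃ {x // x ∈ S} :=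
      Finset.equivOfCardEq (by simp [hS])
    let σ : Equiv.Perm (Fin (r + n)) := e.extendSubtype
    have hσ : ∀ j : Fin n, σ (Fin.natAdd r j) ∈ S := fun j =>
      e.extendSubtype_mem _ (Finset.mem_map.2 ⟨j, Finset.mem_univ _, rfl⟩)
    have h1 := R.map_perm v σ
    suffices h2 : R (v ∘ σ) = 0 by
      rw [h2] at h1
      have h3 := congrArg (fun w => (Equiv.Perm.sign σ) • w) h1
      simpa [smul_smul] using h3.symm
    let y : Fin r → T × L := fun i => v (σ (Fin.castAdd n i))
    let f : L [⋀^Fin n]→ₗ[ℝ] W := (fixLeft R y).compLinearMap (LinearMap.inr ℝ T L)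
    have hf : f = 0 := by
      refine b.ext_alternating fun u hu => ?_
      let u' : Equiv.Perm (Fin n) := Equiv.ofBijective u (Finite.injective_iff_bijective.1 hu)
      have h4 : f (b ∘ u') = Equiv.Perm.sign u' • f b := f.map_perm b u'
      have h5 : f b = 0 := (apply_append_basis b R y).trans (h _)
      change f (b ∘ u') = 0
      rw [h4, h5, smul_zero]
    have h6 : v ∘ σ = Fin.append y (fun j => ((0, (v (σ (Fin.natAdd r j))).2) : T × L)) := by
      funext i
      refine Fin.addCases (fun i => ?_) (fun i => ?_) i
      · simp [y]
      · simp only [Function.comp_apply, Fin.append_right]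
        exact Prod.ext (hv _ (hσ i)) rfl
    rw [h6]
    exact congrArg (fun f : L [⋀^Fin n]→ₗ[ℝ] W => f fun j => (v (σ (Fin.natAdd r j))).2) hf

/-- In the sum over shuffles only the trivial one survives: any other feeds to `α` some `z j`, whose
`T` component is zero. -/
theorem wedge_append (α : T [⋀^Fin r]→ₗ[ℝ] W) (β : (T × L) [⋀^Fin n]→ₗ[ℝ] ℝ)
    (y : Fin r → T × L) (z : Fin n → T × L) (hz : ∀ j, (z j).1 = 0) :
    wedge α β (Fin.append y z) = β z • α (fun i => (y i).1) := by
  classical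
  unfold wedge
  rw [AlternatingMap.domDomCongr_apply]
  have hv : (Fin.append y z ∘ finSumFinEquiv) = Sum.elim y z := by
    funext i
    rcases i with i | i <;> simp
  rw [hv]
  change TensorProduct.rid ℝ W
    (((α.compLinearMap (LinearMap.fst ℝ T L)).domCoprod β).toMultilinearMap (Sum.elim y z)) = _
  rw [AlternatingMap.domCoprod_coe, sum_apply]
  refine (congrArg (TensorProduct.rid ℝ W) (Finset.sum_eq_single
    (Quotient.mk'' (1 : Equiv.Perm (Fin r ⊕ Fin n))) ?_ ?_)).trans ?_
  rotate_left 2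
  · rw [AlternatingMap.domCoprod.summand_mk'']
    simp [MultilinearMap.domCoprod_apply]
  · intro σ _ hσ
    induction σ using Quotient.inductionOn' with | _ σ
    rw [AlternatingMap.domCoprod.summand_mk'']
    -- A permutation that keeps the left block in the left block lies in the subgroup that is
    -- divided out, so its class is trivial.
    have h1 : ∃ i j, σ (Sum.inl i) = Sum.inr j := by
      by_contra hcon
      push Not at hcon
      apply hσ
      refine (Quotient.sound' ?_).symm
      rw [QuotientGroup.leftRel_apply, inv_one, one_mul]
      refine Equiv.Perm.mem_sumCongrHom_range_of_perm_mapsTo_inl ?_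
      rintro _ ⟨i, rfl⟩
      rcases h : σ (Sum.inl i) with j | j
      · exact ⟨j, rfl⟩
      · exact absurd h (hcon i j)
    obtain ⟨i, j, hij⟩ := h1
    have h2 : α (fun i => (Sum.elim y z (σ (Sum.inl i))).1) = 0 :=
      α.map_coord_zero i (by rw [hij]; exact hz j)
    rw [smul_apply, MultilinearMap.domDomCongr_apply, MultilinearMap.domCoprod_apply]
    have h3 : (α.compLinearMap (LinearMap.fst ℝ T L)).toMultilinearMap
        (fun i => Sum.elim y z (σ (Sum.inl i))) = 0 := h2
    erw [h3]
    rw [TensorProduct.zero_tmul, smul_zero]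
  · simp

/-- This turns both integration conditions into one equation for a coefficient. It determines `α` as
soon as `β` is nonzero on the basis. -/
theorem innerDegreeLT_sub_wedge_iff (b : Module.Basis (Fin n) ℝ L)
    (R : (T × L) [⋀^Fin (r + n)]→ₗ[ℝ] W) (α : T [⋀^Fin r]→ₗ[ℝ] W)
    (β : (T × L) [⋀^Fin n]→ₗ[ℝ] ℝ) :
    InnerDegreeLT n (R - wedge α β) ↔ ∀ Y, innerPart b R Y = β (fun j => (0, b j)) • α Y := by
  rw [innerDegreeLT_iff b]
  refine forall_congr' fun Y => ?_
  rw [innerPart_apply, AlternatingMap.sub_apply, wedge_append _ _ _ _ (fun _ => rfl), sub_eq_zero]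
  rfl

end Algebra

/-! ### The tangent maps of a principal bundle -/

section ChainRule

variable {E₁ E₂ E₃ E₄ : Type*} [NormedAddCommGroup E₁] [NormedSpace ℝ E₁] [NormedAddCommGroup E₂]
  [NormedSpace ℝ E₂] [NormedAddCommGroup E₃] [NormedSpace ℝ E₃] [NormedAddCommGroup E₄]
  [NormedSpace ℝ E₄] {A B C D : Type*}
  [TopologicalSpace A] [ChartedSpace E₁ A] [TopologicalSpace B] [ChartedSpace E₂ B]
  [TopologicalSpace C] [ChartedSpace E₃ C] [TopologicalSpace D] [ChartedSpace E₄ D]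

/-- The differential of `f` at `x` as a map between the model spaces. -/
def tmap (f : A → B) (x : A) : E₁ →L[ℝ] E₂ := mfderiv 𝓘(ℝ, E₁) 𝓘(ℝ, E₂) f x

theorem tmap_id (x : A) (v : E₁) : tmap (E₁ := E₁) (E₂ := E₁) (fun a : A => a) x v = v :=
  congrArg (fun L : E₁ →L[ℝ] E₁ => L v) (mfderiv_id (I := 𝓘(ℝ, E₁)) (x := x))

theorem tmap_const (x : A) (y : B) (v : E₁) :
    tmap (E₁ := E₁) (E₂ := E₂) (fun _ : A => y) x v = 0 :=
  congrArg (fun L : E₁ →L[ℝ] E₂ => L v)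
    (mfderiv_const (I := 𝓘(ℝ, E₁)) (I' := 𝓘(ℝ, E₂)) (x := x) (c := y))

/-- The intermediate point and the composite are given by equations, and vectors live in the model
spaces. Points that are only propositionally equal, such as `p · 1` and `p`, then need no transport.
-/
theorem tmap_comp {f : A → B} {g : B → C} {h : A → C} {x : A} {y : B}
    (hg : MDifferentiableAt 𝓘(ℝ, E₂) 𝓘(ℝ, E₃) g y) (hf : MDifferentiableAt 𝓘(ℝ, E₁) 𝓘(ℝ, E₂) f x)
    (hy : f x = y) (hh : ∀ᶠ a in 𝓝 x, h a = g (f a)) (v : E₁) :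
    tmap (E₁ := E₁) (E₂ := E₃) h x v = tmap (E₁ := E₂) (E₂ := E₃) g y
      (tmap (E₁ := E₁) (E₂ := E₂) f x v) := by
  subst hy
  have h1 : HasMFDerivAt 𝓘(ℝ, E₁) 𝓘(ℝ, E₃) h x _ :=
    (HasMFDerivAt.comp x hg.hasMFDerivAt hf.hasMFDerivAt).congr_of_eventuallyEq hh
  exact congrArg (fun L : E₁ →L[ℝ] E₃ => L v) h1.mfderiv

theorem tmap_comp_prod {F : B × C → D} {f : A → B} {g : A → C} {h : A → D} {x : A} {y : B} {z : C}
    (hF : MDifferentiableAt (𝓘(ℝ, E₂).prod 𝓘(ℝ, E₃)) 𝓘(ℝ, E₄) F (y, z))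
    (hf : MDifferentiableAt 𝓘(ℝ, E₁) 𝓘(ℝ, E₂) f x) (hg : MDifferentiableAt 𝓘(ℝ, E₁) 𝓘(ℝ, E₃) g x)
    (hy : f x = y) (hz : g x = z) (hh : ∀ᶠ a in 𝓝 x, h a = F (f a, g a)) (v : E₁) :
    tmap (E₁ := E₁) (E₂ := E₄) h x v =
      tmap (E₁ := E₂) (E₂ := E₄) (fun b => F (b, z)) y (tmap (E₁ := E₁) (E₂ := E₂) f x v) +
      tmap (E₁ := E₃) (E₂ := E₄) (fun c => F (y, c)) z (tmap (E₁ := E₁) (E₂ := E₃) g x v) := by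
  subst hy hz
  have h1 : HasMFDerivAt 𝓘(ℝ, E₁) 𝓘(ℝ, E₄) h x _ :=
    (HasMFDerivAt.comp x hF.hasMFDerivAt
      (hf.hasMFDerivAt.prodMk hg.hasMFDerivAt)).congr_of_eventuallyEq hh
  have h2 := congrArg (fun L : E₁ →L[ℝ] E₄ => L v) h1.mfderiv
  refine h2.trans ?_
  exact mfderiv_prod_eq_add_apply hF

end ChainRule

/-! ### Tangent vectors of a principal bundle in a local trivialization -/

section Geometry

variable {n k m : ℕ} {G P M : Type*}
  [TopologicalSpace G] [ChartedSpace (EuclideanSpace ℝ (Fin n)) G] [Group G]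
  [TopologicalSpace P] [ChartedSpace (EuclideanSpace ℝ (Fin k)) P]
  [TopologicalSpace M] [ChartedSpace (EuclideanSpace ℝ (Fin m)) M]

namespace PrincipalBundle

variable (Q : PrincipalBundle n k m G P M)

theorem contMDiff_act_right (g : G) : ContMDiff (𝓡 k) (𝓡 k) ∞ (fun p => Q.act p g) :=
  Q.smooth_act.comp (contMDiff_id.prodMk contMDiff_const)

theorem contMDiff_act_left (p : P) : ContMDiff (𝓡 n) (𝓡 k) ∞ (fun g => Q.act p g) :=
  Q.smooth_act.comp (contMDiff_const.prodMk contMDiff_id)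

theorem mdiff_act_right (g : G) : MDifferentiable (𝓡 k) (𝓡 k) (fun p => Q.act p g) :=
  (Q.contMDiff_act_right g).mdifferentiable (by simp)

theorem mdiff_act_left (p : P) : MDifferentiable (𝓡 n) (𝓡 k) (fun g => Q.act p g) :=
  (Q.contMDiff_act_left p).mdifferentiable (by simp)

theorem mdiff_proj : MDifferentiable (𝓡 k) (𝓡 m) Q.proj := Q.smooth_proj.mdifferentiable (by simp)

theorem act_act_inv (p : P) (g : G) : Q.act (Q.act p g) g⁻¹ = p := by
  rw [← Q.act_mul, mul_inv_cancel, Q.act_one]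

theorem act_inv_act (p : P) (g : G) : Q.act (Q.act p g⁻¹) g = p := by
  rw [← Q.act_mul, inv_mul_cancel, Q.act_one]

/-- The fundamental vector fields at `p`, as a linear map. -/
def fundLin (p : P) : LieAlg n G →ₗ[ℝ] TangentSpace (𝓡 k) p :=
  (mfderiv (𝓡 n) (𝓡 k) (fun g : G => Q.act p g) 1 :
    EuclideanSpace ℝ (Fin n) →L[ℝ] EuclideanSpace ℝ (Fin k)).toLinearMap

theorem fundLin_apply (p : P) (ξ : LieAlg n G) : Q.fundLin p ξ = Q.fund ξ p := rfl

theorem dproj_dR (g : G) (p : P) (Y : TangentSpace (𝓡 k) p) :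
    (Q.dproj (Q.act p g) (Q.dR g p Y) : EuclideanSpace ℝ (Fin m)) = Q.dproj p Y :=
  (tmap_comp (h := Q.proj) (Q.mdiff_proj (Q.act p g)) (Q.mdiff_act_right g p) rfl
    (Eventually.of_forall fun a => (Q.proj_act a g).symm) Y).symm

/-- Differentiate `(p h) g = (p g)(g⁻¹ h g)` at `h = 1`. -/
theorem dR_fund [LieGroup (𝓡 n) ∞ G] (g : G) (p : P) (ξ : LieAlg n G) :
    Q.dR g p (Q.fund ξ p) = Q.fund (Ad n g⁻¹ ξ) (Q.act p g) := by
  have h1 := tmap_comp (Q.mdiff_act_right g p) (Q.mdiff_act_left p 1) (Q.act_one p)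
    (Eventually.of_forall fun a => rfl) ξ
  have h2 := tmap_comp (h := fun a => Q.act (Q.act p a) g) (Q.mdiff_act_left (Q.act p g) 1)
    (((contMDiff_conj g⁻¹).mdifferentiable (by simp)) (1 : G)) (by simp)
    (Eventually.of_forall fun a => by
      rw [← Q.act_mul, ← Q.act_mul]; congr 1; simp [mul_assoc]) ξ
  exact h1.symm.trans h2

theorem tangentBundle_mk_eq {E : Type*} [NormedAddCommGroup E] [NormedSpace ℝ E] {N : Type*}
    [TopologicalSpace N] [ChartedSpace E N] {p q : N} (h : p = q) (v : E) :
    (⟨p, v⟩ : TangentBundle 𝓘(ℝ, E) N) = ⟨q, v⟩ := by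
  subst h; rfl

/-- In the local trivialization with section `s` and fibre coordinate `τ`, the tangent vector at
`p` which lies over a tangent vector of the base and is tangent to the translate of the section. -/
def lift (s : M → P) (τ : P → G) (p : P) :
    TangentSpace (𝓡 m) (Q.proj p) →ₗ[ℝ] TangentSpace (𝓡 k) p :=
  (tmap (fun x => Q.act (s x) (τ p)) (Q.proj p) :
    EuclideanSpace ℝ (Fin m) →L[ℝ] EuclideanSpace ℝ (Fin k)).toLinearMap

section Triv

variable {Q} {U : Set M} {s : M → P} {τ : P → G}

theorem _root_.AtiyahLie.IsLocalTriv.fibre_act_mul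
    (ht : IsLocalTriv (n := n) (k := k) (m := m) Q.proj Q.act U s τ)
    {p : P} (hp : Q.proj p ∈ U) (g : G) :
    τ (Q.act p g) = τ p * g := by
  conv_lhs => rw [← ht.section_act p hp, ← Q.act_mul]
  exact ht.fibre_act _ hp _

theorem _root_.AtiyahLie.IsLocalTriv.section_at
    (ht : IsLocalTriv (n := n) (k := k) (m := m) Q.proj Q.act U s τ) {x : M} (hx : x ∈ U) :
    ContMDiffAt (𝓡 m) (𝓡 k) ∞ s x :=
  ht.smooth_section.contMDiffAt (ht.isOpen.mem_nhds hx)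

theorem _root_.AtiyahLie.IsLocalTriv.mem_nhds
    (ht : IsLocalTriv (n := n) (k := k) (m := m) Q.proj Q.act U s τ) {p : P} (hp : Q.proj p ∈ U) :
    Q.proj ⁻¹' U ∈ 𝓝 p :=
  Q.smooth_proj.continuous.continuousAt.preimage_mem_nhds (ht.isOpen.mem_nhds hp)

theorem _root_.AtiyahLie.IsLocalTriv.fibre_at
    (ht : IsLocalTriv (n := n) (k := k) (m := m) Q.proj Q.act U s τ) {p : P} (hp : Q.proj p ∈ U) :
    ContMDiffAt (𝓡 k) (𝓡 n) ∞ τ p :=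
  ht.smooth_fibre.contMDiffAt (ht.mem_nhds hp)

theorem _root_.AtiyahLie.IsLocalTriv.mdiff_translate
    (ht : IsLocalTriv (n := n) (k := k) (m := m) Q.proj Q.act U s τ) {x : M} (hx : x ∈ U) (g : G) :
    MDifferentiableAt (𝓡 m) (𝓡 k) (fun x => Q.act (s x) g) x :=
  MDifferentiableAt.comp x (Q.mdiff_act_right g (s x)) ((ht.section_at hx).mdifferentiableAt (by simp))

theorem dproj_lift
    (ht : IsLocalTriv (n := n) (k := k) (m := m) Q.proj Q.act U s τ)
    {p : P} (hp : Q.proj p ∈ U) (v : TangentSpace (𝓡 m) (Q.proj p)) :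
    Q.dproj p (Q.lift s τ p v) = v := by
  have h := tmap_comp (E₁ := EuclideanSpace ℝ (Fin m)) (h := fun x => x) (Q.mdiff_proj p)
    (ht.mdiff_translate hp (τ p)) (ht.section_act p hp) (by
      filter_upwards [ht.isOpen.mem_nhds hp] with x hx
      rw [Q.proj_act, ht.proj_section x hx]) v
  exact h.symm.trans (tmap_id (E₁ := EuclideanSpace ℝ (Fin m)) (Q.proj p) v)

theorem dR_lift
    (ht : IsLocalTriv (n := n) (k := k) (m := m) Q.proj Q.act U s τ)
    {p : P} (hp : Q.proj p ∈ U) (g : G) (v : TangentSpace (𝓡 m) (Q.proj p)) :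
    (Q.dR g p (Q.lift s τ p v) : EuclideanSpace ℝ (Fin k)) = Q.lift s τ (Q.act p g)
      (v : EuclideanSpace ℝ (Fin m)) := by
  have h := tmap_comp (E₁ := EuclideanSpace ℝ (Fin m)) (h := fun x => Q.act (s x) (τ (Q.act p g)))
    (Q.mdiff_act_right g p)
    (ht.mdiff_translate hp (τ p)) (ht.section_act p hp) (Eventually.of_forall fun x => by
      rw [ht.fibre_act_mul hp, Q.act_mul]) v
  refine h.symm.trans ?_
  unfold lift
  rw [Q.proj_act]
  rfl

/-- Write `q = (s(π q) · τ(p)) · (τ(p)⁻¹ τ(q))` and differentiate at `q = p`. The first factor gives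
the lift of the projected vector, the second a fundamental vector. -/
theorem exists_eq_lift_add_fund
    (ht : IsLocalTriv (n := n) (k := k) (m := m) Q.proj Q.act U s τ)
    [LieGroup (𝓡 n) ∞ G] {p : P} (hp : Q.proj p ∈ U)
    (Y : TangentSpace (𝓡 k) p) :
    ∃ ξ : LieAlg n G, Y = Q.lift s τ p (Q.dproj p Y) + Q.fund ξ p := by
  have hf : MDifferentiableAt (𝓡 k) (𝓡 k) (fun q => Q.act (s (Q.proj q)) (τ p)) p :=
    MDifferentiableAt.comp p (ht.mdiff_translate hp (τ p)) (Q.mdiff_proj p)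
  have hg : MDifferentiableAt (𝓡 k) (𝓡 n) (fun q => (τ p)⁻¹ * τ q) p :=
    (contMDiffAt_const.mul (ht.fibre_at hp)).mdifferentiableAt (n := ∞) (by simp)
  have h := tmap_comp_prod (E₁ := EuclideanSpace ℝ (Fin k)) (h := fun q : P => q)
    (Q.smooth_act.mdifferentiable (by simp) (p, (1 : G))) hf hg (ht.section_act p hp) (by simp) (by
      filter_upwards [ht.mem_nhds hp] with q hq
      rw [← Q.act_mul, mul_inv_cancel_left, ht.section_act q hq]) Y
  have h1 := tmap_comp (E₁ := EuclideanSpace ℝ (Fin k))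
    (h := fun q => Q.act (s (Q.proj q)) (τ p)) (ht.mdiff_translate hp (τ p)) (Q.mdiff_proj p) rfl
    (Eventually.of_forall fun _ => rfl) Y
  have h2 : (fun b => Q.act b (1 : G)) = fun b => b := funext Q.act_one
  refine ⟨tmap (E₁ := EuclideanSpace ℝ (Fin k)) (E₂ := EuclideanSpace ℝ (Fin n))
    (fun q => (τ p)⁻¹ * τ q) p Y, ?_⟩
  refine (tmap_id (E₁ := EuclideanSpace ℝ (Fin k)) p Y).symm.trans (h.trans ?_)
  refine (congrArg₂ (fun a b : EuclideanSpace ℝ (Fin k) => a + b) ?_ rfl)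
  refine (congrArg _ h1).trans ?_
  change tmap (E₁ := EuclideanSpace ℝ (Fin k)) (E₂ := EuclideanSpace ℝ (Fin k))
    (fun b => Q.act b (1 : G)) p _ = _
  rw [h2]
  exact tmap_id (E₁ := EuclideanSpace ℝ (Fin k)) _ _

variable [IsManifold (𝓡 k) ∞ P] [IsManifold (𝓡 m) ∞ M]

theorem contMDiffAt_lift
    (ht : IsLocalTriv (n := n) (k := k) (m := m) Q.proj Q.act U s τ)
    {p : P} (hp : Q.proj p ∈ U) {v : ∀ q, TangentSpace (𝓡 m) (Q.proj q)}
    (hv : ContMDiffAt (𝓡 k) (𝓡 m).tangent ∞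
      (fun q => (⟨Q.proj q, v q⟩ : TangentBundle (𝓡 m) M)) p) :
    ContMDiffAt (𝓡 k) (𝓡 k).tangent ∞
      (fun q => (⟨q, Q.lift s τ q (v q)⟩ : TangentBundle (𝓡 k) P)) p := by
  have hF : ContMDiffAt ((𝓡 k).prod (𝓡 m)) (𝓡 k) ∞
      (Function.uncurry fun (q : P) (x : M) => Q.act (s x) (τ q)) (p, Q.proj p) :=
    ContMDiffAt.comp (p, Q.proj p) (Q.smooth_act _)
      ((ContMDiffAt.comp (p, Q.proj p) (ht.section_at hp) contMDiffAt_snd).prodMk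
        (ContMDiffAt.comp (p, Q.proj p) (ht.fibre_at hp) contMDiffAt_fst))
  refine (contMDiffAt_mfderiv_apply hF hv).congr_of_eventuallyEq ?_
  filter_upwards [ht.mem_nhds hp] with q hq
  exact (tangentBundle_mk_eq (ht.section_act q hq) _).symm

end Triv

theorem exists_fund_of_dproj_eq_zero [LieGroup (𝓡 n) ∞ G] {p : P} {Y : TangentSpace (𝓡 k) p}
    (hY : Q.dproj p Y = 0) : ∃ ξ : LieAlg n G, Q.fund ξ p = Y := by
  obtain ⟨U, s, τ, hx₀, ht⟩ := Q.locally_trivial (Q.proj p)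
  obtain ⟨ξ, hξ⟩ := exists_eq_lift_add_fund ht hx₀ Y
  rw [hY, map_zero, zero_add] at hξ
  exact ⟨ξ, hξ.symm⟩

theorem dproj_surjective (p : P) : Function.Surjective (Q.dproj p) := by
  obtain ⟨U, s, τ, hx₀, ht⟩ := Q.locally_trivial (Q.proj p)
  exact fun v => ⟨_, dproj_lift ht hx₀ v⟩

theorem contMDiffAt_fund [LieGroup (𝓡 n) ∞ G] [IsManifold (𝓡 k) ∞ P] {c : P → LieAlg n G} {p : P}
    (hc : SmoothIntoAt k c p) :
    ContMDiffAt (𝓡 k) (𝓡 k).tangent ∞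
      (fun q => (⟨q, Q.fund (c q) q⟩ : TangentBundle (𝓡 k) P)) p := by
  have : IsManifold (𝓡 n) ∞ G := isManifold_of_lieGroup
  have hv := contMDiffAt_mk_const (p := (1 : G))
    (SmoothIntoAt.contMDiffAt (E := EuclideanSpace ℝ (Fin n)) hc)
  refine (contMDiffAt_mfderiv_apply (F := Q.act) (a := fun _ : P => (1 : G))
    (Q.smooth_act (p, 1)) hv).congr_of_eventuallyEq ?_
  exact Eventually.of_forall fun q => (tangentBundle_mk_eq (Q.act_one q) _).symm

end PrincipalBundle

end Geometry

/-! ### Local frames -/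

section Frame

variable {m : ℕ} {M : Type*} [TopologicalSpace M] [ChartedSpace (EuclideanSpace ℝ (Fin m)) M]

theorem exists_cutoff [IsManifold (𝓡 m) ∞ M] [T2Space M] {x₀ : M} {U : Set M} (hU : U ∈ 𝓝 x₀) :
    ∃ χ : M → ℝ, ContMDiff (𝓡 m) 𝓘(ℝ, ℝ) ∞ χ ∧ tsupport χ ⊆ U ∧ ∀ᶠ x in 𝓝 x₀, χ x = 1 := by
  obtain ⟨f, -, hf⟩ := (SmoothBumpFunction.nhds_basis_tsupport (I := 𝓡 m) x₀).mem_iff.1 hU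
  exact ⟨f, f.contMDiff, hf, f.eventuallyEq_one⟩

theorem eq_zero_of_tsupport_subset {X : Type*} [TopologicalSpace X] {χ : X → ℝ} {U : Set X}
    (hU : tsupport χ ⊆ U) {x : X} (hx : x ∉ U) : χ x = 0 :=
  image_eq_zero_of_notMem_tsupport fun h => hx (hU h)

theorem exists_vectorField_smul [IsManifold (𝓡 m) ∞ M] {χ : M → ℝ}
    (hχ : ContMDiff (𝓡 m) 𝓘(ℝ, ℝ) ∞ χ) {U : Set M} (hU : IsOpen U) (hχU : tsupport χ ⊆ U)
    {Z : ∀ x : M, TangentSpace (𝓡 m) x}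
    (hZ : ∀ x ∈ U, ContMDiffAt (𝓡 m) (𝓡 m).tangent ∞
      (fun y => (⟨y, Z y⟩ : TangentBundle (𝓡 m) M)) x) :
    ∃ X : VF m M, ∀ x, X x = χ x • Z x :=
  ⟨⟨fun x => χ x • Z x, ContMDiffOn.smul_section_of_tsupport hχ.contMDiffOn hU hχU
    fun x hx => (hZ x hx).contMDiffWithinAt⟩, fun _ => rfl⟩

/-- The coordinates of a tangent vector in the chart at `x₀`. -/
def chartCoord (x₀ x : M) : TangentSpace (𝓡 m) x →ₗ[ℝ] EuclideanSpace ℝ (Fin m) :=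
  (tmap (extChartAt (𝓡 m) x₀) x :
    EuclideanSpace ℝ (Fin m) →L[ℝ] EuclideanSpace ℝ (Fin m)).toLinearMap

variable [IsManifold (𝓡 m) ∞ M]

theorem contMDiffAt_chartCoord {E N : Type*} [NormedAddCommGroup E] [NormedSpace ℝ E]
    [TopologicalSpace N] [ChartedSpace E N] [IsManifold 𝓘(ℝ, E) ∞ N] {x₀ : M} {f : N → M} {y : N}
    (hy : f y ∈ (chartAt (EuclideanSpace ℝ (Fin m)) x₀).source)
    {v : ∀ y, TangentSpace (𝓡 m) (f y)}
    (hv : ContMDiffAt 𝓘(ℝ, E) (𝓡 m).tangent ∞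
      (fun y => (⟨f y, v y⟩ : TangentBundle (𝓡 m) M)) y) :
    ContMDiffAt 𝓘(ℝ, E) 𝓘(ℝ, EuclideanSpace ℝ (Fin m)) ∞
      (fun y => chartCoord x₀ (f y) (v y)) y := by
  have hF : ContMDiffAt (𝓘(ℝ, E).prod (𝓡 m)) 𝓘(ℝ, EuclideanSpace ℝ (Fin m)) ∞
      (Function.uncurry fun (_ : N) (x : M) => extChartAt (𝓡 m) x₀ x) (y, f y) :=
    ContMDiffAt.comp (y, f y) (contMDiffAt_extChartAt' hy) contMDiffAt_snd
  have h := contMDiffAt_mfderiv_apply hF hv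
  exact ContMDiffAt.comp y (contMDiff_snd_tangentBundle_modelSpace (EuclideanSpace ℝ (Fin m))
    𝓘(ℝ, EuclideanSpace ℝ (Fin m)) _) h

theorem contMDiffAt_chartField {x₀ x : M}
    (hx : x ∈ (chartAt (EuclideanSpace ℝ (Fin m)) x₀).source) (u : EuclideanSpace ℝ (Fin m)) :
    ContMDiffAt (𝓡 m) (𝓡 m).tangent ∞
      (fun y => (⟨y, tmap (E₁ := EuclideanSpace ℝ (Fin m)) (E₂ := EuclideanSpace ℝ (Fin m))
        (extChartAt (𝓡 m) x₀).symm (extChartAt (𝓡 m) x₀ y) u⟩ : TangentBundle (𝓡 m) M)) x := by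
  have hx' : x ∈ (extChartAt (𝓡 m) x₀).source := by rwa [extChartAt_source]
  have hF : ContMDiffAt ((𝓡 m).prod (𝓡 m)) (𝓡 m) ∞
      (Function.uncurry fun (_ : M) (z : EuclideanSpace ℝ (Fin m)) =>
        (extChartAt (𝓡 m) x₀).symm z) (x, extChartAt (𝓡 m) x₀ x) :=
    ContMDiffAt.comp (x, extChartAt (𝓡 m) x₀ x)
      ((contMDiffOn_extChartAt_symm x₀).contMDiffAt
        (extChartAt_target_mem_nhds' ((extChartAt (𝓡 m) x₀).map_source hx')))
      contMDiffAt_snd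
  have hv : ContMDiffAt (𝓡 m) (𝓡 m).tangent ∞ (fun y =>
      (⟨extChartAt (𝓡 m) x₀ y, u⟩ : TangentBundle (𝓡 m) (EuclideanSpace ℝ (Fin m)))) x :=
    Bundle.contMDiffAt_totalSpace.2 ⟨contMDiffAt_extChartAt' hx, by
      simpa using contMDiffAt_const⟩
  refine (contMDiffAt_mfderiv_apply hF hv).congr_of_eventuallyEq ?_
  filter_upwards [(isOpen_extChartAt_source (I := 𝓡 m) x₀).mem_nhds hx'] with y hy
  exact (PrincipalBundle.tangentBundle_mk_eq ((extChartAt (𝓡 m) x₀).left_inv hy) _).symm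

theorem tmap_symm_chartCoord {x₀ x : M}
    (hx : x ∈ (chartAt (EuclideanSpace ℝ (Fin m)) x₀).source) (v : TangentSpace (𝓡 m) x) :
    tmap (E₁ := EuclideanSpace ℝ (Fin m)) (E₂ := EuclideanSpace ℝ (Fin m))
        (extChartAt (𝓡 m) x₀).symm (extChartAt (𝓡 m) x₀ x) (chartCoord x₀ x v) = v := by
  have hx' : x ∈ (extChartAt (𝓡 m) x₀).source := by rwa [extChartAt_source]
  have h := tmap_comp (E₁ := EuclideanSpace ℝ (Fin m)) (h := fun y : M => y)
    (mdifferentiableAt_extChartAt_symm ((extChartAt (𝓡 m) x₀).map_source hx'))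
    ((contMDiffAt_extChartAt' (n := ∞) hx).mdifferentiableAt (by simp)) rfl (by
      filter_upwards [(isOpen_extChartAt_source (I := 𝓡 m) x₀).mem_nhds hx'] with y hy
      exact ((extChartAt (𝓡 m) x₀).left_inv hy).symm) v
  exact h.symm.trans (tmap_id (E₁ := EuclideanSpace ℝ (Fin m)) x v)

/-- Coordinate fields of the chart at `x₀`, multiplied by a cut-off so that they become global. The
expansion holds where the cut-off equals `1`. -/
theorem exists_frame [T2Space M] (x₀ : M) : ∃ V : Fin m → VF m M, ∀ᶠ x in 𝓝 x₀,
    ∀ v : TangentSpace (𝓡 m) x, v = ∑ j, chartCoord x₀ x v j • V j x := by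
  have hsrc := (chartAt (EuclideanSpace ℝ (Fin m)) x₀).open_source
  obtain ⟨χ, hχ, hχU, hχ1⟩ := exists_cutoff (m := m) (hsrc.mem_nhds (mem_chart_source _ x₀))
  choose V hV using fun j : Fin m => exists_vectorField_smul hχ hsrc hχU
    (fun x hx => contMDiffAt_chartField hx (EuclideanSpace.single j 1))
  refine ⟨V, ?_⟩
  filter_upwards [hχ1, hsrc.mem_nhds (mem_chart_source _ x₀)] with x hx hxs v
  have h1 : ∀ j, (V j x : EuclideanSpace ℝ (Fin m)) = tmap (E₁ := EuclideanSpace ℝ (Fin m))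
      (E₂ := EuclideanSpace ℝ (Fin m)) (extChartAt (𝓡 m) x₀).symm (extChartAt (𝓡 m) x₀ x)
      (EuclideanSpace.single j 1) := fun j => by
    refine (hV j x).trans ?_
    rw [hx]
    exact one_smul ℝ _
  refine (tmap_symm_chartCoord hxs v).symm.trans ?_
  have h2 : chartCoord x₀ x v = ∑ j, chartCoord x₀ x v j • EuclideanSpace.single j (1 : ℝ) := by
    have := (EuclideanSpace.basisFun (Fin m) ℝ).sum_repr (chartCoord x₀ x v)
    simpa using this.symm
  have h3 := congrArg (tmap (E₁ := EuclideanSpace ℝ (Fin m))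
      (E₂ := EuclideanSpace ℝ (Fin m)) (extChartAt (𝓡 m) x₀).symm (extChartAt (𝓡 m) x₀ x)) h2
  rw [map_sum] at h3
  refine h3.trans (Finset.sum_congr rfl fun j _ => ?_)
  rw [map_smul]
  exact congrArg (fun w : EuclideanSpace ℝ (Fin m) => chartCoord x₀ x v j • w) (h1 j).symm

end Frame

/-! ### Invariant fields and invariant frames on `P` -/

section InvariantFrame

variable {n k m : ℕ} {G P M : Type*}
  [TopologicalSpace G] [ChartedSpace (EuclideanSpace ℝ (Fin n)) G] [Group G]
  [TopologicalSpace P] [ChartedSpace (EuclideanSpace ℝ (Fin k)) P] [IsManifold (𝓡 k) ∞ P]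
  [TopologicalSpace M] [ChartedSpace (EuclideanSpace ℝ (Fin m)) M]

namespace PrincipalBundle

variable (Q : PrincipalBundle n k m G P M)

/-- A function pulled back from `M` is constant on orbits, so a cut-off on the base extends a local
invariant field by zero without losing invariance. -/
theorem exists_invField_smul {χ : M → ℝ} (hχ : ContMDiff (𝓡 m) 𝓘(ℝ, ℝ) ∞ χ) {U : Set M}
    (hU : IsOpen U) (hχU : tsupport χ ⊆ U) {Z : ∀ p : P, TangentSpace (𝓡 k) p}
    (hZ : ∀ p, Q.proj p ∈ U → ContMDiffAt (𝓡 k) (𝓡 k).tangent ∞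
      (fun q => (⟨q, Z q⟩ : TangentBundle (𝓡 k) P)) p)
    (hinv : ∀ g p, Q.proj p ∈ U → Q.dR g p (Z p) = Z (Q.act p g)) :
    ∃ X : Q.InvField, ∀ p, X.1 p = χ (Q.proj p) • Z p := by
  have hsupp : tsupport (fun p => χ (Q.proj p)) ⊆ Q.proj ⁻¹' U :=
    (tsupport_comp_subset_preimage χ Q.smooth_proj.continuous).trans (Set.preimage_mono hχU)
  obtain ⟨X, hX⟩ := exists_vectorField_smul (hχ.comp Q.smooth_proj)
    (hU.preimage Q.smooth_proj.continuous) hsupp hZ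
  refine ⟨⟨X, fun g p => ?_⟩, hX⟩
  rw [hX, hX, map_smul]
  change χ (Q.proj p) • _ = χ (Q.proj (Q.act p g)) • _
  rw [Q.proj_act]
  by_cases hp : Q.proj p ∈ U
  · rw [hinv g p hp]
  · rw [eq_zero_of_tsupport_subset hχU hp, zero_smul, zero_smul]

/-- The product of an invariant field with a function on the base. -/
theorem exists_invField_mul {f : M → ℝ} (hf : ContMDiff (𝓡 m) 𝓘(ℝ, ℝ) ∞ f) (X : Q.InvField) :
    ∃ Y : Q.InvField, ∀ p, Y.1 p = f (Q.proj p) • X.1 p :=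
  Q.exists_invField_smul hf isOpen_univ (Set.subset_univ _) (fun p _ => X.1.contMDiff p)
    fun g p _ => X.2 g p

variable [IsManifold (𝓡 m) ∞ M]

theorem contMDiffAt_chartCoord_dproj {x₀ : M} {p : P}
    (hp : Q.proj p ∈ (chartAt (EuclideanSpace ℝ (Fin m)) x₀).source) (Y : VF k P) (j : Fin m) :
    ContMDiffAt (𝓡 k) 𝓘(ℝ, ℝ) ∞
      (fun q => chartCoord x₀ (Q.proj q) (Q.dproj q (Y q)) j) p := by
  have h1 : ContMDiffAt (𝓡 k) (𝓡 m).tangent ∞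
      (fun q => (⟨Q.proj q, Q.dproj q (Y q)⟩ : TangentBundle (𝓡 m) M)) p :=
    contMDiffAt_mfderiv_apply (F := fun (_ : P) (q : P) => Q.proj q) (a := fun q => q)
      (ContMDiffAt.comp (p, p) (Q.smooth_proj p) contMDiffAt_snd) (Y.contMDiff p)
  have h2 := contMDiffAt_chartCoord hp h1
  exact ContMDiffAt.comp p
    (EuclideanSpace.proj j : EuclideanSpace ℝ (Fin m) →L[ℝ] ℝ).contMDiff.contMDiffAt h2

variable [T2Space M]

theorem exists_invField_lift (V : VF m M) (x₀ : M) :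
    ∃ X : Q.InvField, ∀ᶠ x in 𝓝 x₀, ∀ p, Q.proj p = x → Q.dproj p (X.1 p) = V (Q.proj p) := by
  obtain ⟨U, s, τ, hx₀, ht⟩ := Q.locally_trivial x₀
  obtain ⟨χ, hχ, hχU, hχ1⟩ := exists_cutoff (m := m) (ht.isOpen.mem_nhds hx₀)
  obtain ⟨X, hX⟩ := Q.exists_invField_smul (Z := fun p => Q.lift s τ p (V (Q.proj p))) hχ ht.isOpen
    hχU (fun p hp => contMDiffAt_lift ht hp
      (ContMDiffAt.comp p (V.contMDiff (Q.proj p)) (Q.smooth_proj p))) (fun g p hp => by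
        refine (dR_lift ht hp g _).trans ?_
        rw [Q.proj_act])
  refine ⟨X, ?_⟩
  filter_upwards [hχ1, ht.isOpen.mem_nhds hx₀] with x hx hxU p hp
  subst hp
  rw [hX, hx, one_smul, dproj_lift ht hxU]

/-- The frame consists of invariant lifts of a frame of `M` and of vertical fields made invariant in
a trivialization. The dual coefficients are read off from the projection and from the connection
form. Their invariance makes coefficients of invariant fields functions on `M`, obtained by
restriction to `s`. -/
theorem exists_invFrame [LieGroup (𝓡 n) ∞ G] (conn : Q.Connection)
    (b : Module.Basis (Fin n) ℝ (LieAlg n G)) (x₀ : M) :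
    ∃ (W : Set M) (s : M → P) (e : Fin m ⊕ Fin n → Q.InvField)
      (c : Fin m ⊕ Fin n → ∀ p : P, TangentSpace (𝓡 k) p →ₗ[ℝ] ℝ),
      IsOpen W ∧ x₀ ∈ W ∧
      (∀ x ∈ W, ContMDiffAt (𝓡 m) (𝓡 k) ∞ s x ∧ Q.proj (s x) = x) ∧
      (∀ p, Q.proj p ∈ W → ∃ g, Q.act (s (Q.proj p)) g = p) ∧
      (∀ p, Q.proj p ∈ W → ∀ Y, Y = ∑ j, c j p Y • (e j).1 p) ∧
      (∀ p, Q.proj p ∈ W → ∀ (Y : VF k P) j,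
        ContMDiffAt (𝓡 k) 𝓘(ℝ, ℝ) ∞ (fun q => c j q (Y q)) p) ∧
      (∀ p, Q.proj p ∈ W → ∀ g j Y, c j (Q.act p g) (Q.dR g p Y) = c j p Y) := by
  obtain ⟨U, s, τ, hx₀, ht⟩ := Q.locally_trivial x₀
  obtain ⟨V, hV⟩ := exists_frame (m := m) x₀
  choose H hH using fun j => Q.exists_invField_lift (V j) x₀
  obtain ⟨χ, hχ, hχU, hχ1⟩ := exists_cutoff (m := m) (ht.isOpen.mem_nhds hx₀)
  have hAd : ∀ (p : P), Q.proj p ∈ U → ∀ η : LieAlg n G,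
      SmoothIntoAt k (fun q => Ad n (τ q) η) p := fun p hp η l =>
    ContMDiffAt.comp p (g := fun h => l (Ad n h η)) (smoothInto_Ad η l (τ p)) (ht.fibre_at hp)
  have hAd' : ∀ (p : P), Q.proj p ∈ U → ∀ η : LieAlg n G,
      SmoothIntoAt k (fun q => Ad n (τ q)⁻¹ η) p := fun p hp η l =>
    ContMDiffAt.comp p (g := fun h => l (Ad n h η)) (smoothInto_Ad η l (τ p)⁻¹) (ht.fibre_at hp).inv
  -- Right translation by `g` applies `Ad_{g⁻¹}` to a fundamental vector; the twist by `Ad_{τ⁻¹}`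
  -- compensates since `τ(pg) = τ(p) g`.
  choose F hF using fun a => Q.exists_invField_smul (Z := fun p => Q.fund (Ad n (τ p)⁻¹ (b a)) p)
    hχ ht.isOpen hχU (fun p hp => Q.contMDiffAt_fund (hAd' p hp (b a))) (fun g p hp => by
      rw [Q.dR_fund, ← Ad_mul_apply, ht.fibre_act_mul hp, mul_inv_rev])
  let ch : ∀ p : P, TangentSpace (𝓡 k) p →ₗ[ℝ] EuclideanSpace ℝ (Fin m) := fun p =>
    chartCoord x₀ (Q.proj p) ∘ₗ Q.dproj p
  let cj : Fin m → ∀ p : P, TangentSpace (𝓡 k) p →ₗ[ℝ] ℝ := fun j p =>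
    (EuclideanSpace.proj (𝕜 := ℝ) j).toLinearMap ∘ₗ ch p
  -- The lifts `H j` need not be horizontal for the connection, so their contribution is subtracted
  -- before the vertical component is read.
  let ver : ∀ p : P, TangentSpace (𝓡 k) p →ₗ[ℝ] LieAlg n G := fun p =>
    conn.form p - ∑ j, (cj j p).smulRight (conn.form p ((H j).1 p))
  let ca : Fin n → ∀ p : P, TangentSpace (𝓡 k) p →ₗ[ℝ] ℝ := fun a p =>
    b.coord a ∘ₗ Ad n (τ p) ∘ₗ ver p
  have hver : ∀ p Y, ver p Y = conn.form p (Y - ∑ j, cj j p Y • (H j).1 p) := by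
    intro p Y
    simp [ver]
  have hcjR : ∀ p g j Y, cj j (Q.act p g) (Q.dR g p Y) = cj j p Y := by
    intro p g j Y
    change chartCoord x₀ (Q.proj (Q.act p g)) (Q.dproj (Q.act p g) (Q.dR g p Y)) j =
      chartCoord x₀ (Q.proj p) (Q.dproj p Y) j
    have h1 : ∀ x y : M, x = y → (chartCoord (m := m) x₀ x :
        EuclideanSpace ℝ (Fin m) →ₗ[ℝ] EuclideanSpace ℝ (Fin m)) = chartCoord x₀ y := by
      rintro x _ rfl; rfl
    exact congrArg (fun v : EuclideanSpace ℝ (Fin m) => v j)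
      ((congrArg (fun L : EuclideanSpace ℝ (Fin m) →ₗ[ℝ] EuclideanSpace ℝ (Fin m) => L _)
      (h1 _ _ (Q.proj_act p g))).trans
      (congrArg (chartCoord x₀ (Q.proj p)) (Q.dproj_dR g p Y)))
  have hverR : ∀ p g Y, ver (Q.act p g) (Q.dR g p Y) = Ad n g⁻¹ (ver p Y) := by
    intro p g Y
    have hR : Q.dR g p (Y - ∑ j, cj j p Y • (H j).1 p) =
        Q.dR g p Y - ∑ j, cj j p Y • (H j).1 (Q.act p g) := by
      rw [map_sub, map_sum]
      refine congrArg _ (Finset.sum_congr rfl fun j _ => ?_)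
      rw [map_smul, (H j).2 g p]
    rw [hver, hver, ← conn.equivariant, hR]
    simp only [hcjR]
  have hnhds : ∀ᶠ x in 𝓝 x₀, x ∈ U ∧ x ∈ (chartAt (EuclideanSpace ℝ (Fin m)) x₀).source ∧
      χ x = 1 ∧ (∀ v : TangentSpace (𝓡 m) x, v = ∑ j, chartCoord x₀ x v j • V j x) ∧
      ∀ j p, Q.proj p = x → Q.dproj p ((H j).1 p) = V j (Q.proj p) := by
    filter_upwards [ht.isOpen.mem_nhds hx₀, (chartAt (EuclideanSpace ℝ (Fin m))
      x₀).open_source.mem_nhds (mem_chart_source _ x₀), hχ1, hV, eventually_all.2 hH]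
      with x h1 h2 h3 h4 h5 using ⟨h1, h2, h3, h4, h5⟩
  obtain ⟨W, hW, hWo, hxW⟩ := eventually_nhds_iff.1 hnhds
  have hcj : ∀ p, Q.proj p ∈ W → ∀ (Y : VF k P) j,
      ContMDiffAt (𝓡 k) 𝓘(ℝ, ℝ) ∞ (fun q => cj j q (Y q)) p := by
    intro p hp Y j
    exact Q.contMDiffAt_chartCoord_dproj (hW _ hp).2.1 Y j
  refine ⟨W, s, Sum.elim H F, Sum.elim cj ca, hWo, hxW, fun x hx => ⟨ht.section_at (hW x hx).1,
    ht.proj_section x (hW x hx).1⟩, fun p hp => ⟨τ p, ht.section_act p (hW _ hp).1⟩,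
    fun p hp Y => ?_, ?_, ?_⟩
  · obtain ⟨hU, -, h1, hfr, hlift⟩ := hW _ hp
    have hd : Q.dproj p (Y - ∑ j, cj j p Y • (H j).1 p) = 0 := by
      rw [map_sub, sub_eq_zero]
      refine (hfr (Q.dproj p Y)).trans ?_
      rw [map_sum]
      refine Finset.sum_congr rfl fun j _ => ?_
      rw [map_smul, hlift j p rfl]
      rfl
    obtain ⟨ξ, hξ⟩ := Q.exists_fund_of_dproj_eq_zero hd
    have hv : ver p Y = ξ := by rw [hver, ← hξ, conn.form_fund]
    have h2 : ∑ a, ca a p Y • (F a).1 p = Q.fund ξ p := by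
      have h3 : ∀ a, (F a).1 p = Q.fundLin p (Ad n (τ p)⁻¹ (b a)) := fun a => by
        rw [hF, h1, one_smul]; rfl
      simp only [h3, ← map_smul, ← map_sum]
      rw [← Q.fundLin_apply]
      congr 1
      have h4 : ∑ a, ca a p Y • b a = Ad n (τ p) ξ := by
        rw [← hv]
        exact b.sum_repr (Ad n (τ p) (ver p Y))
      rw [h4, Ad_inv_apply_Ad]
    rw [Fintype.sum_sum_type]
    simp only [Sum.elim_inl, Sum.elim_inr]
    rw [h2, hξ]
    abel
  · intro p hp Y j
    rcases j with j | a
    · exact hcj p hp Y j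
    · refine (SmoothIntoAt.apply_operator (ρ := fun q => Ad n (τ q)) (hAd p (hW _ hp).1)
        (f := fun q => ver q (Y q)) ?_) (b.coord a)
      have h1 : SmoothIntoAt k (fun q => conn.form q (Y q) +
          ∑ j, (-cj j q (Y q)) • conn.form q ((H j).1 q)) p :=
        SmoothIntoAt.add (smoothInto_iff_forall.1 (conn.smooth Y) p)
          (SmoothIntoAt.sum _ fun j _ => SmoothIntoAt.fun_smul (hcj p hp Y j).neg
            (smoothInto_iff_forall.1 (conn.smooth (H j).1) p))
      refine h1.congr (Eventually.of_forall fun q => ?_)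
      change ver q (Y q) = _
      rw [hver, map_sub, map_sum, sub_eq_add_neg, ← Finset.sum_neg_distrib]
      simp only [map_smul, neg_smul]
  · intro p hp g j Y
    rcases j with j | a
    · exact hcjR p g j Y
    · change b.coord a (Ad n (τ (Q.act p g)) (ver (Q.act p g) (Q.dR g p Y))) =
        b.coord a (Ad n (τ p) (ver p Y))
      rw [hverR, ht.fibre_act_mul (hW _ hp).1, Ad_mul_apply, Ad_apply_Ad_inv]

end PrincipalBundle

end InvariantFrame

/-! ### Forms of the Atiyah Lie algebroid as pointwise forms -/

section Pointwise

variable {n k m : ℕ} {G P M : Type*}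
  [TopologicalSpace G] [ChartedSpace (EuclideanSpace ℝ (Fin n)) G] [Group G]
  [TopologicalSpace P] [ChartedSpace (EuclideanSpace ℝ (Fin k)) P] [IsManifold (𝓡 k) ∞ P]
  [TopologicalSpace M] [ChartedSpace (EuclideanSpace ℝ (Fin m)) M]

namespace PrincipalBundle

variable (Q : PrincipalBundle n k m G P M)

/-- The evaluation of invariant fields at a point. -/
def evalField (p : P) : Q.InvField →ₗ[ℝ] TangentSpace (𝓡 k) p where
  toFun X := X.1 p
  map_add' _ _ := rfl
  map_smul' _ _ := rfl

variable (𝕜 : Type*) [RCLike 𝕜]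

/-- The evaluation of equivariant maps at a point. -/
def evalMap (p : P) : Q.EquivMap 𝕜 →ₗ[ℝ] LieAlgK n G 𝕜 where
  toFun v := v.1 p
  map_add' _ _ := rfl
  map_smul' _ _ := rfl

variable {𝕜}
variable [LieGroup (𝓡 n) ∞ G] [IsManifold (𝓡 m) ∞ M] [T2Space M]
variable {Q}

/-- Forms of the Atiyah Lie algebroid are local in their arguments, to order zero. -/
theorem LieForm.apply_eq_zero (conn : Q.Connection)
    (b : Module.Basis (Fin n) ℝ (LieAlg n G)) {q : ℕ} (w : Q.LieForm 𝕜 q)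
    (X : Fin q → Q.InvField) (i : Fin q) {p : P} (h : (X i).1 p = 0) : (w.1 X).1 p = 0 := by
  obtain ⟨W, s, e, c, hWo, hpW, hs, hsurj, hexp, hsmooth, hinv⟩ :=
    Q.exists_invFrame conn b (Q.proj p)
  obtain ⟨χ, hχ, hχW, hχ1⟩ := exists_cutoff (m := m) (hWo.mem_nhds hpW)
  -- The coefficients of an invariant field are constant along the fibres, so they can be evaluated
  -- on the section.
  have hdesc : ∀ p', Q.proj p' ∈ W → ∀ j,
      c j (s (Q.proj p')) ((X i).1 (s (Q.proj p'))) = c j p' ((X i).1 p') := by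
    intro p' hp' j
    obtain ⟨g, hg⟩ := hsurj p' hp'
    have h1 : Q.proj (s (Q.proj p')) ∈ W := by rwa [(hs _ hp').2]
    generalize s (Q.proj p') = q' at *
    subst hg
    rw [← (X i).2 g q', hinv q' h1 g j]
  have hf : ∀ j, ContMDiff (𝓡 m) 𝓘(ℝ, ℝ) ∞ (fun x => χ x * c j (s x) ((X i).1 (s x))) := by
    intro j
    refine contMDiff_of_tsupport fun x hx => ?_
    have hxW : x ∈ W := hχW (tsupport_mul_subset_left hx)
    refine (hχ x).mul (ContMDiffAt.comp x (g := fun q => c j q ((X i).1 q))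
      (hsmooth (s x) ?_ (X i).1 j) (hs x hxW).1)
    rwa [(hs x hxW).2]
  obtain ⟨Y, hY⟩ := Q.exists_invField_mul hχ (X i)
  choose E hE using fun j => Q.exists_invField_mul (hf j) (e j)
  -- Globally `χ X_i = ∑ f_j e_j` with `f_j` smooth on `M`, so multilinearity over `C^∞(M)` applies.
  -- At `p` the cut-off is `1` and every `f_j` vanishes.
  have hsum : Y = ∑ j, E j := by
    refine Subtype.ext (ContMDiffSection.ext fun p' => ?_)
    have h1 : (∑ j, E j).1 p' = ∑ j, (E j).1 p' := map_sum (Q.evalField p') E Finset.univ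
    rw [h1, hY]
    by_cases hp' : Q.proj p' ∈ W
    · conv_lhs => rw [hexp p' hp' ((X i).1 p')]
      rw [Finset.smul_sum]
      refine Finset.sum_congr rfl fun j _ => ?_
      rw [hE, hdesc p' hp' j, smul_smul]
    · have h0 := eq_zero_of_tsupport_subset hχW hp'
      rw [h0, zero_smul, Finset.sum_eq_zero]
      intro j _
      rw [hE, h0, zero_mul, zero_smul]
  have h1 := w.2 χ hχ X i Y hY p
  rw [hχ1.self_of_nhds, one_smul] at h1
  rw [← h1, hsum, AlternatingMap.map_update_sum]
  refine (map_sum (Q.evalMap 𝕜 p) _ Finset.univ).trans (Finset.sum_eq_zero fun j _ => ?_)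
  have h2 := w.2 _ (hf j) (Function.update X i (e j)) i (E j)
    (fun p' => by rw [hE j p', Function.update_self]) p
  rw [Function.update_idem] at h2
  refine h2.trans ?_
  rw [hdesc p hpW j, h, map_zero, mul_zero, zero_smul]

theorem evalField_surjective (conn : Q.Connection)
    (b : Module.Basis (Fin n) ℝ (LieAlg n G)) (p : P) : Function.Surjective (Q.evalField p) := by
  intro Y
  obtain ⟨W, s, e, c, hWo, hpW, hs, hsurj, hexp, hsmooth, hinv⟩ :=
    Q.exists_invFrame conn b (Q.proj p)
  refine ⟨∑ j, c j p Y • e j, ?_⟩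
  rw [map_sum]
  conv_rhs => rw [hexp p hpW Y]
  refine Finset.sum_congr rfl fun j _ => ?_
  rw [map_smul]
  rfl

variable (conn : Q.Connection) (b : Module.Basis (Fin n) ℝ (LieAlg n G))

/-- A linear choice of invariant fields with given values at `p`. -/
def extendField (p : P) : TangentSpace (𝓡 k) p →ₗ[ℝ] Q.InvField :=
  ((Q.evalField p).exists_rightInverse_of_surjective
    (LinearMap.range_eq_top.2 (evalField_surjective conn b p))).choose

theorem extendField_apply (p : P) (Y : TangentSpace (𝓡 k) p) :
    (extendField conn b p Y).1 p = Y :=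
  LinearMap.congr_fun ((Q.evalField p).exists_rightInverse_of_surjective
    (LinearMap.range_eq_top.2 (evalField_surjective conn b p))).choose_spec Y

/-- The value at `p` of a form of the Atiyah Lie algebroid. -/
def pointForm {q : ℕ} (w : Q.LieForm 𝕜 q) (p : P) :
    TangentSpace (𝓡 k) p [⋀^Fin q]→ₗ[ℝ] LieAlgK n G 𝕜 :=
  (Q.evalMap 𝕜 p).compAlternatingMap (w.1.compLinearMap (extendField conn b p))

/-- Two invariant fields with the same value at `p` differ by one that vanishes there, so the choice
made in `extendField` does not matter. -/
theorem pointForm_apply {q : ℕ} (w : Q.LieForm 𝕜 q) (p : P) (X : Fin q → Q.InvField)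
    {Y : Fin q → TangentSpace (𝓡 k) p} (h : ∀ i, (X i).1 p = Y i) :
    pointForm conn b w p Y = (w.1 X).1 p := by
  refine multilinear_eq_of_sub_mem ((Q.evalMap 𝕜 p).compMultilinearMap w.1.toMultilinearMap)
    (LinearMap.ker (Q.evalField p)) (fun v i hi => LieForm.apply_eq_zero conn b w v i hi)
    (v := fun i => extendField conn b p (Y i)) (w := X) fun i => ?_
  rw [LinearMap.mem_ker, map_sub, sub_eq_zero]
  exact (extendField_apply conn b p (Y i)).trans (h i).symm

/-- Invariant fields that extend `Y_i` at `p` take the values `dR_g Y_i` at `pg`, so the same fields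
compute both sides. -/
theorem pointForm_act {q : ℕ} (w : Q.LieForm 𝕜 q) (g : G) (p : P)
    (Y : Fin q → TangentSpace (𝓡 k) p) :
    pointForm conn b w (Q.act p g) (fun i => Q.dR g p (Y i)) =
      AdK n 𝕜 g⁻¹ (pointForm conn b w p Y) := by
  have h := extendField_apply conn b p
  rw [pointForm_apply conn b w p (fun i => extendField conn b p (Y i)) fun i => h (Y i),
    pointForm_apply conn b w (Q.act p g) (fun i => extendField conn b p (Y i)) fun i => ?_]
  · exact (w.1 _).2.2 g p
  · rw [← (extendField conn b p (Y i)).2 g p, h]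

theorem smoothInto_pointForm {q : ℕ} (w : Q.LieForm 𝕜 q) (Z : Fin q → VF k P) :
    SmoothInto k (fun p => pointForm conn b w p (fun i => Z i p)) := by
  refine smoothInto_iff_forall.2 fun p => ?_
  obtain ⟨W, s, e, c, hWo, hpW, hs, hsurj, hexp, hsmooth, hinv⟩ :=
    Q.exists_invFrame conn b (Q.proj p)
  refine smoothIntoAt_multilinear (fun p => (pointForm conn b w p).toMultilinearMap)
    (Z := fun i p => Z i p) (e := fun j p => (e j).1 p) (c := fun i j p => c j p (Z i p))
    (fun i j => hsmooth p hpW (Z i) j) (fun J => ?_) ?_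
  · have h1 := smoothInto_iff_forall.1 (w.1 fun i => e (J i)).2.1 p
    exact h1.congr (Eventually.of_forall fun q =>
      pointForm_apply conn b w q (fun i => e (J i)) fun i => rfl)
  · filter_upwards [Q.smooth_proj.continuous.continuousAt.preimage_mem_nhds (hWo.mem_nhds hpW)]
      with q hq i using hexp q hq (Z i q)

/-- The value at `p` of the form on the trivial Lie algebroid which corresponds to a form of the
Atiyah Lie algebroid. -/
def basicForm {q : ℕ} (w : Q.LieForm 𝕜 q) (p : P) :
    (TangentSpace (𝓡 k) p × LieAlg n G) [⋀^Fin q]→ₗ[ℝ] LieAlgK n G 𝕜 :=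
  (pointForm conn b w p).compLinearMap
    (LinearMap.fst ℝ (TangentSpace (𝓡 k) p) (LieAlg n G) -
      Q.fundLin p ∘ₗ LinearMap.snd ℝ (TangentSpace (𝓡 k) p) (LieAlg n G))

theorem basicForm_eq {q : ℕ} (w : Q.LieForm 𝕜 q) (p : P)
    (v : Fin q → TangentSpace (𝓡 k) p × LieAlg n G) :
    basicForm conn b w p v = pointForm conn b w p (fun i => (v i).1 - Q.fund (v i).2 p) := rfl

theorem basicForm_apply {q : ℕ} (w : Q.LieForm 𝕜 q) (p : P) (X : Fin q → Q.InvField)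
    {v : Fin q → TangentSpace (𝓡 k) p × LieAlg n G}
    (h : ∀ i, (X i).1 p = (v i).1 - Q.fund (v i).2 p) :
    basicForm conn b w p v = (w.1 X).1 p :=
  pointForm_apply conn b w p X h

theorem basicForm_act {q : ℕ} (w : Q.LieForm 𝕜 q) (g : G) (p : P)
    (v : Fin q → TangentSpace (𝓡 k) p × LieAlg n G) :
    basicForm conn b w (Q.act p g) (fun i => (Q.dR g p (v i).1, Ad n g⁻¹ (v i).2)) =
      AdK n 𝕜 g⁻¹ (basicForm conn b w p v) := by
  rw [basicForm_eq, basicForm_eq, ← pointForm_act]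
  congr 1
  funext i
  rw [map_sub, Q.dR_fund]

/-- The inclusion of the forms of the Atiyah Lie algebroid into those of the trivial one. -/
def inclusion (q : ℕ) : Q.LieForm 𝕜 q →ₗ[𝕜] TLAForm n k G P 𝕜 q where
  toFun w := ⟨fun p => basicForm conn b w p, fun Y c hc => by
    -- For variable `c_i` the difference `Y_i - c_i^P` is still a smooth vector field, though in
    -- general not an invariant one.
    choose Z hZ using fun i => (⟨⟨_, (Y i).contMDiff.sub_section (fun p =>
      Q.contMDiffAt_fund (smoothInto_iff_forall.1 (hc i) p))⟩, fun p => rfl⟩ :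
        ∃ Z : VF k P, ∀ p, Z p = Y i p - Q.fund (c i p) p)
    have h := smoothInto_pointForm conn b w Z
    simp only [hZ] at h
    exact h⟩
  map_add' _ _ := rfl
  map_smul' _ _ := rfl

end PrincipalBundle

end Pointwise

/-! ### Basic forms -/

section Basic

variable {n k m : ℕ} {G P M : Type*}
  [TopologicalSpace G] [ChartedSpace (EuclideanSpace ℝ (Fin n)) G] [Group G]
  [TopologicalSpace P] [ChartedSpace (EuclideanSpace ℝ (Fin k)) P]
  [TopologicalSpace M] [ChartedSpace (EuclideanSpace ℝ (Fin m)) M]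

theorem dirDeriv_const {V : Type*} [AddCommGroup V] [Module ℝ V] [Module.Finite ℝ V] (u : V)
    (p : P) (v : TangentSpace (𝓡 k) p) : dirDeriv (k := k) (fun _ : P => u) p v = 0 := by
  have hs : SmoothIntoAt k (fun _ : P => u) p := fun l => contMDiffAt_const
  rw [← Module.forall_dual_apply_eq_zero_iff ℝ]
  intro l
  rw [map_dirDeriv hs v l]
  exact tmap_const (E₁ := EuclideanSpace ℝ (Fin k)) (E₂ := ℝ) p (l u) v

namespace PrincipalBundle

variable (Q : PrincipalBundle n k m G P M) {𝕜 : Type*} [RCLike 𝕜]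

theorem orbit_zero (ξ : LieAlg n G) (p : P) : Q.act p (curve ξ 0) = p := by
  rw [curve_zero, Q.act_one]

theorem dR_dR_inv (g : G) (p : P) (Y : TangentSpace (𝓡 k) (Q.act p g)) :
    (Q.dR g p (Q.dR g⁻¹ (Q.act p g) Y : EuclideanSpace ℝ (Fin k)) :
      EuclideanSpace ℝ (Fin k)) = Y := by
  have h := tmap_comp (E₁ := EuclideanSpace ℝ (Fin k)) (Q.mdiff_act_right g p)
    (Q.mdiff_act_right g⁻¹ (Q.act p g))
    (Q.act_act_inv p g) (Eventually.of_forall fun a => (Q.act_inv_act a g).symm) Y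
  exact h.symm.trans (tmap_id (E₁ := EuclideanSpace ℝ (Fin k)) _ Y)

theorem dR_one {g : G} (hg : g = 1) (p : P) (Y : EuclideanSpace ℝ (Fin k)) :
    (Q.dR g p Y : EuclideanSpace ℝ (Fin k)) = Y := by
  subst hg
  have h2 : (fun b => Q.act b (1 : G)) = fun b => b := funext Q.act_one
  change tmap (E₁ := EuclideanSpace ℝ (Fin k)) (E₂ := EuclideanSpace ℝ (Fin k))
    (fun b => Q.act b (1 : G)) p Y = Y
  rw [h2]
  exact tmap_id (E₁ := EuclideanSpace ℝ (Fin k)) p Y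

variable [LieGroup (𝓡 n) ∞ G]

theorem mdifferentiableAt_orbit (ξ : LieAlg n G) (p : P) :
    MDifferentiableAt 𝓘(ℝ, ℝ) (𝓡 k) (fun t => Q.act p (curve ξ t)) 0 :=
  MDifferentiableAt.comp (0 : ℝ) (Q.mdiff_act_left p _)
    ((contMDiffAt_curve ξ).mdifferentiableAt (by simp))

theorem mfderiv_orbit (ξ : LieAlg n G) (p : P) :
    (mfderiv 𝓘(ℝ, ℝ) (𝓡 k) (fun t => Q.act p (curve ξ t)) 0 :
      ℝ →L[ℝ] EuclideanSpace ℝ (Fin k)) 1 = Q.fund ξ p :=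
  mfderiv_comp_curve (Q.mdiff_act_left p 1) ξ

/-- The action of `ξ^P ⊕ ξ` on `𝔤`-valued maps is the derivative of the translates `Ad_g f(pg)`.
This links invariance with equivariance. -/
theorem hasWeakDerivAt_AdK_translate (ξ : LieAlg n G) {f : P → LieAlgK n G 𝕜} {p : P}
    (hf : SmoothIntoAt k f p) :
    HasWeakDerivAt (fun t => AdK n 𝕜 (curve ξ t) (f (Q.act p (curve ξ t))))
      (dirDeriv (k := k) f p (Q.fund ξ p) + adK n 𝕜 ξ (f p)) 0 := by
  have h := HasWeakDerivAt.apply_operator (ρ := fun t => (AdK n 𝕜 (curve ξ t)).restrictScalars ℝ)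
    (D := (adK n 𝕜 ξ).restrictScalars ℝ)
    (by rw [curve_zero, AdK_one]; rfl) (fun v => hasWeakDerivAt_AdK_curve 𝕜 ξ v)
    (hasWeakDerivAt_dirDeriv hf (Q.mdifferentiableAt_orbit ξ p) (Q.orbit_zero ξ p)
      (Q.mfderiv_orbit ξ p))
  simp only [Q.orbit_zero ξ p] at h
  exact h

theorem hasWeakDerivAt_Ad_translate (ξ : LieAlg n G) {f : P → LieAlg n G} {p : P}
    (hf : SmoothIntoAt k f p) :
    HasWeakDerivAt (fun t => Ad n (curve ξ t) (f (Q.act p (curve ξ t))))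
      (dirDeriv (k := k) f p (Q.fund ξ p) + ⁅ξ, f p⁆) 0 := by
  have h := HasWeakDerivAt.apply_operator (ρ := fun t => Ad n (curve ξ t))
    (D := LieAlgebra.ad ℝ (LieAlg n G) ξ)
    (by rw [curve_zero, Ad_one]) (fun v => hasWeakDerivAt_Ad_curve ξ v)
    (hasWeakDerivAt_dirDeriv hf (Q.mdifferentiableAt_orbit ξ p) (Q.orbit_zero ξ p)
      (Q.mfderiv_orbit ξ p))
  simp only [Q.orbit_zero ξ p] at h
  exact h

variable [IsManifold (𝓡 k) ∞ P]

/-- The Lie bracket with a fundamental field is the derivative along right translations. -/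
theorem hasDerivAt_translate (ξ : LieAlg n G) (Y : VF k P) (p : P)
    {Z : ℝ → EuclideanSpace ℝ (Fin k)}
    (hZ : ∀ t, Q.dR (curve ξ t) p (Z t) = Y (Q.act p (curve ξ t))) :
    HasDerivAt Z (mlieBracket (𝓡 k) (Q.fund ξ) Y p : EuclideanSpace ℝ (Fin k)) 0 := by
  have ha : ContMDiffAt ((𝓡 k).prod 𝓘(ℝ, ℝ)) (𝓡 k) 2
      (fun z : P × ℝ => Q.act z.1 (curve (G := G) ξ z.2)) (p, 0) :=
    (ContMDiffAt.comp ((p, 0) : P × ℝ) (Q.smooth_act (p, curve ξ 0)) (contMDiffAt_fst.prodMk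
      (ContMDiffAt.comp ((p, 0) : P × ℝ) (contMDiffAt_curve ξ) contMDiffAt_snd))).of_le
      (WithTop.coe_le_coe.mpr (le_top : (2 : ℕ∞) ≤ ⊤))
  have h := hasDerivAt_mlieBracket_of_mfderiv ha (Q.orbit_zero ξ)
    (Y.contMDiff.mdifferentiable (by simp) p) (Z := Z) (Eventually.of_forall hZ)
  refine h.congr_deriv ?_
  have e : (fun q => (mfderiv 𝓘(ℝ, ℝ) (𝓡 k) (fun t => Q.act q (curve (G := G) ξ t)) 0 :
      ℝ →L[ℝ] EuclideanSpace ℝ (Fin k)) 1) = Q.fund ξ := funext fun q => Q.mfderiv_orbit ξ q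
  exact congrArg (fun F : ∀ q : P, TangentSpace (𝓡 k) q => mlieBracket (𝓡 k) F Y p) e

/-- Pulled back to `p` by right translations, an invariant field is the constant curve `X p`. -/
theorem mlieBracket_fund_invField (ξ : LieAlg n G) (X : Q.InvField) (p : P) :
    mlieBracket (𝓡 k) (Q.fund ξ) X.1 p = 0 := by
  have h := Q.hasDerivAt_translate ξ X.1 p (Z := fun _ => X.1 p) fun t => X.2 _ p
  exact h.unique (hasDerivAt_const (0 : ℝ) _)

/-- An equivariant form on the trivial Lie algebroid is invariant. -/
theorem lieDeriv_eq_zero {q : ℕ} (w : TLAForm n k G P 𝕜 q)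
    (hw : ∀ g p (v : Fin q → TangentSpace (𝓡 k) p × LieAlg n G),
      w.1 (Q.act p g) (fun i => (Q.dR g p (v i).1, Ad n g⁻¹ (v i).2)) = AdK n 𝕜 g⁻¹ (w.1 p v))
    (ξ : LieAlg n G) (Y : Fin q → VF k P) (c : Fin q → P → LieAlg n G)
    (hc : ∀ i, SmoothInto k (c i)) (p : P) : Q.lieDeriv ξ w Y c p = 0 := by
  have h1 := Q.hasWeakDerivAt_AdK_translate ξ (smoothInto_iff_forall.1 (w.2 Y c hc) p)
  -- `Z` and `C` are the arguments at `p · curve ξ t` carried back to `p`. Their joint derivative at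
  -- `0` is the bracket with `ξ^P ⊕ ξ`.
  let Z : Fin q → ℝ → EuclideanSpace ℝ (Fin k) := fun i t =>
    Q.dR (curve ξ t)⁻¹ (Q.act p (curve ξ t)) (Y i (Q.act p (curve ξ t)))
  have hZ : ∀ i t, Q.dR (curve ξ t) p (Z i t) = Y i (Q.act p (curve ξ t)) := fun i t =>
    Q.dR_dR_inv _ _ _
  let C : Fin q → ℝ → LieAlg n G := fun i t => Ad n (curve ξ t) (c i (Q.act p (curve ξ t)))
  have hu : ∀ i, HasWeakDerivAt (V := EuclideanSpace ℝ (Fin k) × LieAlg n G)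
      (fun t => (Z i t, C i t)) (tlaBracket (Q.fund ξ) (Y i) (fun _ => ξ) (c i) p) 0 := by
    intro i
    have h2 := (hasWeakDerivAt_iff.2 (Q.hasDerivAt_translate ξ (Y i) p (hZ i))).map
      (LinearMap.inl ℝ (EuclideanSpace ℝ (Fin k)) (LieAlg n G))
    have h3 := (Q.hasWeakDerivAt_Ad_translate ξ (smoothInto_iff_forall.1 (hc i) p)).map
      (LinearMap.inr ℝ (EuclideanSpace ℝ (Fin k)) (LieAlg n G))
    have h4 := h2.add h3
    have e1 : (fun t => (Z i t, C i t)) = fun t =>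
        LinearMap.inl ℝ (EuclideanSpace ℝ (Fin k)) (LieAlg n G) (Z i t) +
        LinearMap.inr ℝ (EuclideanSpace ℝ (Fin k)) (LieAlg n G) (C i t) := by
      funext t; simp
    have e2 : (tlaBracket (Q.fund ξ) (Y i) (fun _ => ξ) (c i) p :
        EuclideanSpace ℝ (Fin k) × LieAlg n G) =
        LinearMap.inl ℝ (EuclideanSpace ℝ (Fin k)) (LieAlg n G)
          (mlieBracket (𝓡 k) (Q.fund ξ) (Y i) p) +
        LinearMap.inr ℝ (EuclideanSpace ℝ (Fin k)) (LieAlg n G)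
          (dirDeriv (k := k) (c i) p (Q.fund ξ p) + ⁅ξ, c i p⁆) := by
      unfold tlaBracket
      rw [dirDeriv_const, sub_zero]
      exact Prod.ext (add_zero _).symm (zero_add _).symm
    rw [e1, e2]
    exact h4
  have hfin : Module.Finite ℝ (EuclideanSpace ℝ (Fin k) × LieAlg n G) :=
    inferInstanceAs (Module.Finite ℝ (EuclideanSpace ℝ (Fin k) × EuclideanSpace ℝ (Fin n)))
  let f : MultilinearMap ℝ (fun _ : Fin q => EuclideanSpace ℝ (Fin k) × LieAlg n G)
    (LieAlgK n G 𝕜) := (w.1 p).toMultilinearMap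
  have h5 := HasWeakDerivAt.multilinear f hu
  have e3 : ∀ t, AdK n 𝕜 (curve ξ t) (w.1 (Q.act p (curve ξ t))
      (fun i => (Y i (Q.act p (curve ξ t)), c i (Q.act p (curve ξ t))))) =
      w.1 p (fun i => (Z i t, C i t)) := by
    intro t
    have h6 := hw (curve ξ t) p (fun i => (Z i t, C i t))
    rw [← AdK_apply_AdK_inv 𝕜 (curve ξ t) (w.1 p fun i => (Z i t, C i t)), ← h6]
    congr 2
    funext i
    refine Prod.ext (hZ i t).symm ?_
    exact (Ad_inv_apply_Ad _ _).symm
  have e4 : ∀ i, (Z i 0, C i 0) = ((Y i p, c i p) : EuclideanSpace ℝ (Fin k) × LieAlg n G) := by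
    intro i
    have h6 : ∀ p', p' = p → (Y i p' : EuclideanSpace ℝ (Fin k)) = Y i p := by rintro _ rfl; rfl
    refine Prod.ext ?_ ?_
    · exact (Q.dR_one (curve_zero ξ) p (Z i 0)).symm.trans
        ((hZ i 0).trans (h6 _ (Q.orbit_zero ξ p)))
    · change Ad n (curve ξ 0) (c i (Q.act p (curve ξ 0))) = c i p
      rw [Q.orbit_zero, curve_zero, Ad_one]
      rfl
  -- By equivariance both curves coincide. One derivative gives the first two terms of the Lie
  -- derivative; the other, by the Leibniz rule, gives the sum of the bracket terms.
  have h7 := (h1.congr (Eventually.of_forall fun t => (e3 t).symm)).unique h5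
  unfold lieDeriv
  rw [h7, sub_eq_zero]
  simp only [e4]
  rfl

end PrincipalBundle

end Basic

/-! ### The inclusion into the trivial Lie algebroid and its image -/

section Inclusion

variable {n k m : ℕ} {G P M : Type*}
  [TopologicalSpace G] [ChartedSpace (EuclideanSpace ℝ (Fin n)) G] [Group G]
  [LieGroup (𝓡 n) ∞ G]
  [TopologicalSpace P] [ChartedSpace (EuclideanSpace ℝ (Fin k)) P] [IsManifold (𝓡 k) ∞ P]
  [TopologicalSpace M] [ChartedSpace (EuclideanSpace ℝ (Fin m)) M]

namespace PrincipalBundle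

variable {Q : PrincipalBundle n k m G P M} {𝕜 : Type*} [RCLike 𝕜]

/-- By horizontality arguments count only modulo the vectors `ξ^P ⊕ ξ`; subtracting the one with `ξ
= (v i).2` removes the `𝔤` part. -/
theorem IsBasic.apply_eq {q : ℕ} {w : TLAForm n k G P 𝕜 q} (hw : Q.IsBasic w) (p : P)
    (v : Fin q → TangentSpace (𝓡 k) p × LieAlg n G) :
    w.1 p v = w.1 p (fun i => ((v i).1 - Q.fund (v i).2 p, 0)) := by
  refine multilinear_eq_of_sub_mem (w.1 p).toMultilinearMap
    (LinearMap.range ((Q.fundLin p).prod LinearMap.id)) (fun u i hi => ?_) fun i => ?_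
  · obtain ⟨ξ, hξ⟩ := hi
    exact hw.horizontal ξ p u i hξ.symm
  · refine ⟨(v i).2, Prod.ext ?_ ?_⟩
    · exact (sub_sub_cancel _ _).symm
    · exact (sub_zero _).symm

/-- On arguments `X_j ⊕ 0` with `X_j` invariant the bracket terms of the Lie derivative vanish, so
invariance reads `ξ^P · f + [ξ, f] = 0`. Then `g ↦ Ad_g f(pg)` has zero derivative on the connected
group and keeps its value at `1`. -/
theorem IsBasic.equivariant [PreconnectedSpace G] {q : ℕ} {w : TLAForm n k G P 𝕜 q}
    (hw : Q.IsBasic w) (X : Fin q → Q.InvField) (g : G) (p : P) :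
    w.1 (Q.act p g) (fun i => ((X i).1 (Q.act p g), 0)) =
      AdK n 𝕜 g⁻¹ (w.1 p (fun i => ((X i).1 p, 0))) := by
  let f : P → LieAlgK n G 𝕜 := fun p => w.1 p (fun i => ((X i).1 p, 0))
  have hf : SmoothInto k f := w.2 (fun i => (X i).1) (fun _ _ => 0) fun _ => SmoothInto.zero
  have hd : ∀ (ξ : LieAlg n G) (p : P),
      dirDeriv (k := k) f p (Q.fund ξ p) + adK n 𝕜 ξ (f p) = 0 := by
    intro ξ p
    have h1 := hw.invariant ξ (fun i => (X i).1) (fun _ _ => 0) (fun _ => SmoothInto.zero) p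
    unfold lieDeriv at h1
    rw [Finset.sum_eq_zero, sub_zero] at h1
    · exact h1
    · intro j _
      refine (w.1 p).map_coord_zero j ?_
      rw [Function.update_self]
      refine Prod.ext (Q.mlieBracket_fund_invField ξ (X j) p) ?_
      change dirDeriv (k := k) (fun _ : P => (0 : LieAlg n G)) p (Q.fund ξ p) -
        dirDeriv (k := k) (fun _ : P => ξ) p ((X j).1 p) + ⁅ξ, (0 : LieAlg n G)⁆ = 0
      rw [dirDeriv_const, dirDeriv_const, lie_zero, sub_zero, add_zero]
  have key : ∀ g, AdK n 𝕜 g (f (Q.act p g)) = f p := by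
    intro g
    rw [← sub_eq_zero, ← Module.forall_dual_apply_eq_zero_iff ℝ]
    intro l
    rw [map_sub, sub_eq_zero]
    have hs : ContMDiff (𝓡 n) 𝓘(ℝ, ℝ) ∞ (fun g : G => l (AdK n 𝕜 g (f (Q.act p g)))) := by
      intro g
      refine SmoothIntoAt.apply_operator (ρ := fun g => (AdK n 𝕜 g).restrictScalars ℝ)
        (f := fun g => f (Q.act p g))
        (fun v => smoothInto_iff_forall.1 (smoothInto_AdK 𝕜 v) g) (fun l' => ?_) l
      exact ContMDiffAt.comp g (g := fun p => l' (f p)) (hf l' _) (Q.contMDiff_act_left p g)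
    have h1 := eq_one_of_hasDerivAt_curve hs (fun g ξ => ?_) g
    · rw [h1, AdK_one, Q.act_one]
      rfl
    -- The derivative at `g` is `Ad_g` of the derivative at `1` for the base point `pg`.
    · have h2 := (Q.hasWeakDerivAt_AdK_translate ξ
        (smoothInto_iff_forall.1 hf (Q.act p g))).map ((AdK n 𝕜 g).restrictScalars ℝ)
      rw [hd, map_zero] at h2
      have h3 := h2 l
      rw [map_zero] at h3
      refine h3.congr_of_eventuallyEq (Eventually.of_forall fun t => ?_)
      change l (AdK n 𝕜 (g * curve ξ t) (f (Q.act p (g * curve ξ t)))) =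
        l (AdK n 𝕜 g (AdK n 𝕜 (curve ξ t) (f (Q.act (Q.act p g) (curve ξ t)))))
      rw [AdK_mul_apply, Q.act_mul]
  change f (Q.act p g) = AdK n 𝕜 g⁻¹ (f p)
  rw [← key g, AdK_inv_apply_AdK]

/-- A basic form restricts to a form of the Atiyah Lie algebroid. -/
theorem IsBasic.exists_corresponds [PreconnectedSpace G] {q : ℕ} {w : TLAForm n k G P 𝕜 q}
    (hw : Q.IsBasic w) : ∃ η : Q.LieForm 𝕜 q, Q.Corresponds w η := by
  let i₀ : ∀ p : P, Q.InvField →ₗ[ℝ] TangentSpace (𝓡 k) p × LieAlg n G := fun p =>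
    LinearMap.inl ℝ (TangentSpace (𝓡 k) p) (LieAlg n G) ∘ₗ Q.evalField p
  let R : ∀ p : P, Q.InvField [⋀^Fin q]→ₗ[ℝ] LieAlgK n G 𝕜 := fun p =>
    (w.1 p).compLinearMap (i₀ p)
  let F : Q.InvField [⋀^Fin q]→ₗ[ℝ] Q.EquivMap 𝕜 :=
    { toFun := fun X => ⟨fun p => R p X,
        w.2 (fun i => (X i).1) (fun _ _ => 0) fun _ => SmoothInto.zero,
        fun g p => hw.equivariant X g p⟩
      map_update_add' := fun X i a c => Subtype.ext (funext fun p => (R p).map_update_add' X i a c)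
      map_update_smul' := fun X i a c =>
        Subtype.ext (funext fun p => (R p).map_update_smul' X i a c)
      map_eq_zero_of_eq' := fun X i j h hij =>
        Subtype.ext (funext fun p => (R p).map_eq_zero_of_eq' X i j h hij) }
  refine ⟨⟨F, fun f _ X i Y hY p => ?_⟩, fun X p => rfl⟩
  have h1 : i₀ p Y = f (Q.proj p) • i₀ p (X i) := by
    rw [← map_smul]
    exact Prod.ext (hY p) rfl
  change w.1 p (i₀ p ∘ Function.update X i Y) = f (Q.proj p) • w.1 p (i₀ p ∘ X)
  rw [Function.comp_update, h1, AlternatingMap.map_update_smul]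
  congr 2
  exact Function.update_eq_self i (i₀ p ∘ X)

variable [IsManifold (𝓡 m) ∞ M] [T2Space M] (conn : Q.Connection)
  (b : Module.Basis (Fin n) ℝ (LieAlg n G))

theorem isBasic_inclusion {q : ℕ} (w : Q.LieForm 𝕜 q) : Q.IsBasic (inclusion conn b q w) where
  horizontal ξ p v i hi := by
    refine (pointForm conn b w p).map_coord_zero i ?_
    change (v i).1 - Q.fund (v i).2 p = 0
    rw [hi, sub_self]
  invariant ξ Y c hc p := Q.lieDeriv_eq_zero _ (basicForm_act conn b w) ξ Y c hc p

theorem corresponds_inclusion {q : ℕ} (w : Q.LieForm 𝕜 q) :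
    Q.Corresponds (inclusion conn b q w) w := by
  intro X p
  refine (basicForm_apply conn b w p X fun i => ?_).symm
  change (X i).1 p = (X i).1 p - Q.fundLin p 0
  rw [map_zero, sub_zero]

/-- A basic form is determined by its values on vectors `Y ⊕ 0`, and every such `Y` is the value at
`p` of an invariant field. -/
theorem inclusion_eq_iff {q : ℕ} (w : Q.LieForm 𝕜 q) (w' : TLAForm n k G P 𝕜 q) :
    inclusion conn b q w = w' ↔ Q.IsBasic w' ∧ Q.Corresponds w' w := by
  constructor
  · rintro rfl
    exact ⟨isBasic_inclusion conn b w, corresponds_inclusion conn b w⟩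
  · rintro ⟨hw, hc⟩
    refine Subtype.ext (funext fun p => AlternatingMap.ext fun v => ?_)
    have h : ∀ i, (extendField conn b p ((v i).1 - Q.fund (v i).2 p)).1 p =
        (v i).1 - Q.fund (v i).2 p := fun i => extendField_apply conn b p _
    rw [hw.apply_eq p v]
    refine (basicForm_apply conn b w p _ h).trans ((hc _ p).trans ?_)
    simp only [h]

theorem inclusion_injective (q : ℕ) :
    Function.Injective (inclusion conn b q : Q.LieForm 𝕜 q →ₗ[𝕜] TLAForm n k G P 𝕜 q) := by
  intro w η h
  refine Subtype.ext (AlternatingMap.ext fun X => Subtype.ext (funext fun p => ?_))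
  rw [corresponds_inclusion conn b w X p, h, ← corresponds_inclusion conn b η X p]

theorem exists_inclusion_eq [PreconnectedSpace G] {q : ℕ} {w : TLAForm n k G P 𝕜 q}
    (hw : Q.IsBasic w) : ∃ η, inclusion conn b q η = w := by
  obtain ⟨η, hη⟩ := hw.exists_corresponds
  exact ⟨η, (inclusion_eq_iff conn b η w).2 ⟨hw, hη⟩⟩

end PrincipalBundle

end Inclusion

/-! ### The algebraic integration -/

section AlgIntegral

variable {n k : ℕ} {G P : Type*}
  [TopologicalSpace G] [ChartedSpace (EuclideanSpace ℝ (Fin n)) G] [Group G]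
  [LieGroup (𝓡 n) ∞ G]

/-- The value is `√|k|`, nonzero because a semisimple real Lie algebra has nondegenerate Killing
form (Cartan's criterion). This permits the division in the integrations. -/
theorem killingVolume_self_ne_zero (hs : LieAlgebra.IsSemisimple ℝ (LieAlg n G))
    (b : Module.Basis (Fin n) ℝ (LieAlg n G)) : killingVolume b b ≠ 0 := by
  have h1 := LieAlgebra.IsKilling.killingForm_nondegenerate ℝ (LieAlg n G)
  have h2 := (LinearMap.BilinForm.nondegenerate_iff_det_ne_zero b).1 h1
  have h3 : (Matrix.of fun i j => killingForm ℝ (LieAlg n G) (b i) (b j)).det ≠ 0 := by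
    convert h2 using 2
    ext i j
    simp [LinearMap.BilinForm.toMatrix_apply]
  unfold killingVolume
  rw [AlternatingMap.smul_apply, b.det_self, smul_eq_mul, mul_one]
  exact (Real.sqrt_pos.2 (abs_pos.2 h3)).ne'

variable [TopologicalSpace P] [ChartedSpace (EuclideanSpace ℝ (Fin k)) P] [IsManifold (𝓡 k) ∞ P]
  {𝕜 : Type*} [RCLike 𝕜]

/-- The factor of `√|k| θ¹ ∧ ⋯ ∧ θⁿ` in a form on the trivial Lie algebroid. -/
def algIntegral (b : Module.Basis (Fin n) ℝ (LieAlg n G)) (r : ℕ) :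
    TLAForm n k G P 𝕜 (r + n) →ₗ[𝕜] VForm n k G P 𝕜 r where
  toFun w := ⟨fun p => (killingVolume b b)⁻¹ • innerPart b (w.1 p), fun Y => by
    -- Smoothness is tested on the sections `Y_i ⊕ 0` followed by the constant sections `0 ⊕ b_j`.
    have h := w.2 (Fin.append Y (fun _ => 0)) (Fin.append (fun _ _ => 0) (fun j _ => b j)) (by
      intro i
      refine Fin.addCases (fun i => ?_) (fun i => ?_) i
      · rw [Fin.append_left]; exact SmoothInto.zero
      · rw [Fin.append_right]; exact fun l => contMDiff_const)
    have e : ∀ p, (fun i => ((Fin.append Y (fun _ => 0) i : VF k P) p,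
        (Fin.append (fun _ _ => 0) (fun j _ => b j) i : P → LieAlg n G) p)) =
        Fin.append (fun i => ((Y i p, 0) : TangentSpace (𝓡 k) p × LieAlg n G))
          (fun j => (0, b j)) := by
      intro p
      funext i
      refine Fin.addCases (fun i => ?_) (fun i => ?_) i
      · simp only [Fin.append_left]
      · simp only [Fin.append_right]; rfl
    simp only [e] at h
    refine smoothInto_iff_forall.2 fun p => SmoothIntoAt.fun_smul contMDiffAt_const
      (smoothInto_iff_forall.1 h p)⟩
  map_add' w η := by
    refine Subtype.ext (funext fun p => AlternatingMap.ext fun Y => ?_)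
    exact smul_add (killingVolume b b)⁻¹ (innerPart b (w.1 p) Y) (innerPart b (η.1 p) Y)
  map_smul' c w := by
    refine Subtype.ext (funext fun p => AlternatingMap.ext fun Y => ?_)
    exact smul_comm (killingVolume b b)⁻¹ c (innerPart b (w.1 p) Y)

theorem algIntegral_apply (b : Module.Basis (Fin n) ℝ (LieAlg n G)) (r : ℕ)
    (w : TLAForm n k G P 𝕜 (r + n)) (p : P) (Y : Fin r → TangentSpace (𝓡 k) p) :
    (algIntegral b r w).1 p Y = (killingVolume b b)⁻¹ • innerPart b (w.1 p) Y := rfl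

theorem algIntegral_eq_iff (hs : LieAlgebra.IsSemisimple ℝ (LieAlg n G))
    (b : Module.Basis (Fin n) ℝ (LieAlg n G)) (r : ℕ)
    (w : TLAForm n k G P 𝕜 (r + n)) (η : VForm n k G P 𝕜 r) :
    algIntegral b r w = η ↔ IsAlgIntegral b w η := by
  have h0 := killingVolume_self_ne_zero hs b
  unfold IsAlgIntegral
  simp only [innerDegreeLT_sub_wedge_iff b]
  constructor
  · rintro rfl p Y
    rw [algIntegral_apply]
    exact (smul_inv_smul₀ h0 _).symm
  · intro h
    refine Subtype.ext (funext fun p => AlternatingMap.ext fun Y => ?_)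
    rw [algIntegral_apply, h p Y]
    exact inv_smul_smul₀ h0 _

end AlgIntegral

/-! ### Tensorial forms -/

section Tensorial

variable {n k m : ℕ} {G P M : Type*}
  [TopologicalSpace G] [ChartedSpace (EuclideanSpace ℝ (Fin n)) G] [Group G]
  [TopologicalSpace P] [ChartedSpace (EuclideanSpace ℝ (Fin k)) P]
  [TopologicalSpace M] [ChartedSpace (EuclideanSpace ℝ (Fin m)) M]

namespace PrincipalBundle

variable {𝕜 : Type*} [RCLike 𝕜]

theorem IsTensorial.apply_eq [IsManifold (𝓡 k) ∞ P]
    {Q : PrincipalBundle n k m G P M} {r : ℕ} {τ : VForm n k G P 𝕜 r}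
    (hτ : Q.IsTensorial τ) {p : P} {Y Y' : Fin r → TangentSpace (𝓡 k) p}
    (h : ∀ i, Q.dproj p (Y i) = Q.dproj p (Y' i)) : τ.1 p Y = τ.1 p Y' := by
  refine multilinear_eq_of_sub_mem (τ.1 p).toMultilinearMap (LinearMap.ker (Q.dproj p))
    (fun v i hi => hτ.horizontal p v i hi) fun i => ?_
  rw [LinearMap.mem_ker, map_sub, h, sub_self]

variable (Q : PrincipalBundle n k m G P M)

/-- A linear choice of tangent vectors at `p` over the tangent vectors of the base. -/
def dprojSection (p : P) : EuclideanSpace ℝ (Fin m) →ₗ[ℝ] TangentSpace (𝓡 k) p :=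
  ((Q.dproj p).exists_rightInverse_of_surjective
    (LinearMap.range_eq_top.2 (Q.dproj_surjective p))).choose

theorem dproj_dprojSection (p : P) (v : EuclideanSpace ℝ (Fin m)) :
    (Q.dproj p (Q.dprojSection p v) : EuclideanSpace ℝ (Fin m)) = v :=
  LinearMap.congr_fun ((Q.dproj p).exists_rightInverse_of_surjective
    (LinearMap.range_eq_top.2 (Q.dproj_surjective p))).choose_spec v

/-- Values of a bundle-valued form over equal base points. -/
theorem bundleForm_congr [IsManifold (𝓡 m) ∞ M] {r : ℕ} (η : Q.BundleForm 𝕜 r) {x y : M} (h : x = y)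
    {v : Fin r → EuclideanSpace ℝ (Fin m)} {v' : Fin r → EuclideanSpace ℝ (Fin m)} (hv : v = v')
    (p : P) (hp : Q.proj p = x) :
    (η.1 x v).1 ⟨p, hp⟩ = (η.1 y v').1 ⟨p, hp.trans h⟩ := by
  subst h hv; rfl

variable [IsManifold (𝓡 k) ∞ P] [IsManifold (𝓡 m) ∞ M] [T2Space M]

/-- The pull-back of bundle-valued forms on the base to forms on `P`. -/
def pullback (r : ℕ) : Q.BundleForm 𝕜 r →ₗ[𝕜] VForm n k G P 𝕜 r where
  toFun η := ⟨fun p => ((Q.evalFibre (Q.proj p) p rfl).compAlternatingMap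
      (η.1 (Q.proj p))).compLinearMap (Q.dproj p), fun Y => by
    refine smoothInto_iff_forall.2 fun p => ?_
    -- Smoothness of `η` is known only on vector fields of `M`, while the projection of `Y i` is
    -- merely a field along `proj`; it is expanded in a frame of the base.
    obtain ⟨V, hV⟩ := exists_frame (m := m) (Q.proj p)
    refine smoothIntoAt_multilinear (T := fun q => TangentSpace (𝓡 m) (Q.proj q))
      (fun q => ((Q.evalFibre (Q.proj q) q rfl).compAlternatingMap
        (η.1 (Q.proj q))).toMultilinearMap)
      (Z := fun i q => Q.dproj q (Y i q)) (e := fun j q => V j (Q.proj q))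
      (c := fun i j q => chartCoord (Q.proj p) (Q.proj q) (Q.dproj q (Y i q)) j)
      (fun i j => Q.contMDiffAt_chartCoord_dproj (mem_chart_source _ _) (Y i) j)
      (fun J => smoothInto_iff_forall.1 (η.2 fun i => V (J i)) p) ?_
    filter_upwards [Q.smooth_proj.continuous.continuousAt.eventually hV] with q hq i
    exact hq _⟩
  map_add' _ _ := rfl
  map_smul' _ _ := rfl

theorem pullback_apply {r : ℕ} (η : Q.BundleForm 𝕜 r) (p : P)
    (Y : Fin r → TangentSpace (𝓡 k) p) :
    (Q.pullback r η).1 p Y = (η.1 (Q.proj p) (fun i => Q.dproj p (Y i))).1 ⟨p, rfl⟩ := rfl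

theorem pullback_eq_iff {r : ℕ} (η : Q.BundleForm 𝕜 r) (τ : VForm n k G P 𝕜 r) :
    Q.pullback r η = τ ↔ Q.IsPullback η τ := by
  constructor
  · rintro rfl p Y
    rfl
  · intro h
    exact Subtype.ext (funext fun p => AlternatingMap.ext fun Y => (h p Y).symm)

theorem pullback_injective (r : ℕ) :
    Function.Injective (Q.pullback r : Q.BundleForm 𝕜 r →ₗ[𝕜] VForm n k G P 𝕜 r) := by
  intro η ζ h
  refine Subtype.ext (funext fun x => AlternatingMap.ext fun v => Subtype.ext (funext ?_))
  rintro ⟨p, rfl⟩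
  choose Y hY using fun i => Q.dproj_surjective p (v i)
  obtain rfl : (fun i => Q.dproj p (Y i)) = v := funext hY
  rw [← Q.pullback_apply, ← Q.pullback_apply, h]

theorem isTensorial_pullback {r : ℕ} (η : Q.BundleForm 𝕜 r) : Q.IsTensorial (Q.pullback r η) where
  horizontal p Y i hi :=
    (((Q.evalFibre (𝕜 := 𝕜) (Q.proj p) p rfl).compAlternatingMap
      (η.1 (Q.proj p)))).map_coord_zero i hi
  equivariant g p Y := by
    rw [Q.pullback_apply, Q.pullback_apply, ← (η.1 (Q.proj p) fun i => Q.dproj p (Y i)).2 g ⟨p, rfl⟩]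
    exact Q.bundleForm_congr η (Q.proj_act p g) (funext fun i => Q.dproj_dR g p (Y i)) _ _

/-- The form on the base is evaluated by lifting vectors to a point of the fibre. Horizontality
makes the lift irrelevant, and equivariance makes the values at different points of the fibre an
element of `AdFibre`. -/
theorem IsTensorial.exists_pullback {Q : PrincipalBundle n k m G P M} {r : ℕ}
    {τ : VForm n k G P 𝕜 r} (hτ : Q.IsTensorial τ) : ∃ η, Q.pullback r η = τ := by
  let R : ∀ (x : M) (p : P), TangentSpace (𝓡 m) x [⋀^Fin r]→ₗ[ℝ] LieAlgK n G 𝕜 := fun x p =>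
    (τ.1 p).compLinearMap (Q.dprojSection p : TangentSpace (𝓡 m) x →ₗ[ℝ] TangentSpace (𝓡 k) p)
  have hR : ∀ g x p v, R x (Q.act p g) v = AdK n 𝕜 g⁻¹ (R x p v) := by
    intro g x p v
    refine Eq.trans ?_ (hτ.equivariant g p fun i => Q.dprojSection p (v i))
    refine hτ.apply_eq fun i => ?_
    exact (Q.dproj_dprojSection (Q.act p g) (v i)).trans
      ((Q.dproj_dprojSection p (v i)).symm.trans (Q.dproj_dR g p _).symm)
  let F : ∀ x : M, TangentSpace (𝓡 m) x [⋀^Fin r]→ₗ[ℝ] Q.AdFibre 𝕜 x := fun x =>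
    { toFun := fun v => ⟨fun p => R x p.1 v, fun g p => hR g x p.1 v⟩
      map_update_add' := fun v i a c =>
        Subtype.ext (funext fun p => (R x p.1).map_update_add' v i a c)
      map_update_smul' := fun v i a c =>
        Subtype.ext (funext fun p => (R x p.1).map_update_smul' v i a c)
      map_eq_zero_of_eq' := fun v i j h hij =>
        Subtype.ext (funext fun p => (R x p.1).map_eq_zero_of_eq' v i j h hij) }
  refine ⟨⟨F, fun V => ?_⟩, ?_⟩
  · refine smoothInto_iff_forall.2 fun p => ?_
    -- The pointwise lifts `dprojSection` need not depend smoothly on the point; near `p` they are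
    -- exchanged for invariant fields over `V i`.
    choose X hX using fun i => Q.exists_invField_lift (V i) (Q.proj p)
    refine (smoothInto_iff_forall.1 (τ.2 fun i => (X i).1) p).congr ?_
    filter_upwards [Q.smooth_proj.continuous.continuousAt.eventually (eventually_all.2 hX)]
      with q hq
    refine hτ.apply_eq fun i => ?_
    exact (Q.dproj_dprojSection q _).trans (hq i q rfl).symm
  · rw [Q.pullback_eq_iff]
    intro p Y
    exact (hτ.apply_eq fun i => Q.dproj_dprojSection p _).symm

theorem isTensorial_iff {r : ℕ} (τ : VForm n k G P 𝕜 r) :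
    Q.IsTensorial τ ↔ ∃ η, Q.pullback r η = τ :=
  ⟨fun h => h.exists_pullback, by rintro ⟨η, rfl⟩; exact Q.isTensorial_pullback η⟩

end PrincipalBundle

end Tensorial

/-! ### The inner integration -/

section Inner

theorem alternating_apply_eq_det_smul {L W ι : Type*} [AddCommGroup L] [Module ℝ L]
    [AddCommGroup W] [Module ℝ W] [Fintype ι] [DecidableEq ι] (b : Module.Basis ι ℝ L)
    (f : L [⋀^ι]→ₗ[ℝ] W) (z : ι → L) : f z = b.det z • f b := by
  rw [← sub_eq_zero, ← Module.forall_dual_apply_eq_zero_iff ℝ]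
  intro l
  have h := congrArg (fun F : L [⋀^ι]→ₗ[ℝ] ℝ => F z)
    ((l.compAlternatingMap f).eq_smul_basis_det b)
  simp only [AlternatingMap.smul_apply, LinearMap.compAlternatingMap_apply, smul_eq_mul] at h
  rw [map_sub, h, map_smul, smul_eq_mul, mul_comm, sub_self]

variable {n k m : ℕ} {G P M : Type*}
  [TopologicalSpace G] [ChartedSpace (EuclideanSpace ℝ (Fin n)) G] [Group G]
  [LieGroup (𝓡 n) ∞ G]
  [TopologicalSpace P] [ChartedSpace (EuclideanSpace ℝ (Fin k)) P] [IsManifold (𝓡 k) ∞ P]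
  [TopologicalSpace M] [ChartedSpace (EuclideanSpace ℝ (Fin m)) M]

namespace PrincipalBundle

/-- On `0 ⊕ b_j` the mixed form gives `-b_j`, since the connection part sees only `TM`; the `n`
signs cancel the factor `(-1)^n`. -/
theorem mixed_volume {Q : PrincipalBundle n k m G P M} (conn : Q.Connection)
    (b : Module.Basis (Fin n) ℝ (LieAlg n G)) (s : M → P) (x : M) :
    ((-1 : ℝ) ^ n • (killingVolume b).compLinearMap (conn.mixed s x)) (fun j => (0, b j)) =
      killingVolume b b := by
  have h1 : ∀ j, conn.mixed s x (0, b j) = (-1 : ℝ) • b j := by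
    intro j
    simp [Connection.mixed]
  rw [AlternatingMap.smul_apply, AlternatingMap.compLinearMap_apply]
  simp only [h1]
  have h2 := (killingVolume b).toMultilinearMap.map_smul_univ (fun _ => (-1 : ℝ)) b
  refine (congrArg ((-1 : ℝ) ^ n • ·) h2).trans ?_
  rw [Finset.prod_const, Finset.card_univ, Fintype.card_fin, smul_smul, ← mul_pow]
  simp

variable [IsManifold (𝓡 m) ∞ M] [T2Space M] {Q : PrincipalBundle n k m G P M} {𝕜 : Type*} [RCLike 𝕜]
  (conn : Q.Connection) (b : Module.Basis (Fin n) ℝ (LieAlg n G))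

/-- The algebraic integral of a basic form is tensorial. -/
theorem isTensorial_algIntegral [PreconnectedSpace G]
    (hu : ∀ ξ : LieAlg n G, LinearMap.trace ℝ _ (LieAlgebra.ad ℝ (LieAlg n G) ξ) = 0)
    {r : ℕ} (w : Q.LieForm 𝕜 (r + n)) :
    Q.IsTensorial (algIntegral b r (inclusion conn b (r + n) w)) where
  horizontal p Y i hi := by
    obtain ⟨ξ, hξ⟩ := Q.exists_fund_of_dproj_eq_zero hi
    rw [algIntegral_apply]
    -- Beside the basis `b` the `𝔤` components are irrelevant, so the vertical argument `ξ^P ⊕ 0`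
    -- becomes `ξ^P ⊕ ξ`, which a basic form annihilates.
    have h1 := apply_append_basis b ((inclusion conn b (r + n) w).1 p)
      (fun j => (Y j, if j = i then ξ else 0))
    have h2 := (isBasic_inclusion conn b w).horizontal ξ p
      (Fin.append (fun j => (Y j, if j = i then ξ else 0)) (fun j => (0, b j)))
      (Fin.castAdd n i) (by rw [Fin.append_left, if_pos rfl, hξ])
    rw [h1] at h2
    exact (congrArg _ h2).trans (smul_zero _)
  equivariant g p Y := by
    rw [algIntegral_apply, algIntegral_apply, LinearMap.map_smul_of_tower]
    congr 1
    -- Starting from `Ad_g b_j` makes the translated arguments equal to `b_j`; returning from `Ad_g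
    -- b_j` to `b_j` at `p` costs the factor `det Ad_g = 1`.
    have h1 := basicForm_act conn b w g p
      (Fin.append (fun i => (Y i, 0)) (fun j => (0, Ad n g (b j))))
    have h2 : (fun i => ((Q.dR g p (Fin.append (fun i => (Y i, 0))
        (fun j => ((0, Ad n g (b j)) : TangentSpace (𝓡 k) p × LieAlg n G)) i).1,
        Ad n g⁻¹ (Fin.append (fun i => (Y i, 0))
        (fun j => ((0, Ad n g (b j)) : TangentSpace (𝓡 k) p × LieAlg n G)) i).2) :
        TangentSpace (𝓡 k) (Q.act p g) × LieAlg n G)) =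
        Fin.append (fun i => (Q.dR g p (Y i), 0)) (fun j => (0, b j)) := by
      funext i
      refine Fin.addCases (fun i => ?_) (fun i => ?_) i
      · simp only [Fin.append_left, map_zero]
      · simp only [Fin.append_right, map_zero, Ad_inv_apply_Ad]
    rw [h2] at h1
    refine h1.trans (congrArg (AdK n 𝕜 g⁻¹) ?_)
    have h3 := alternating_apply_eq_det_smul b
      ((fixLeft (basicForm conn b w p) (fun i => (Y i, 0))).compLinearMap
        (LinearMap.inr ℝ (TangentSpace (𝓡 k) p) (LieAlg n G))) (fun j => Ad n g (b j))
    rw [det_Ad_basis b hu g, one_smul] at h3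
    exact h3

/-- The matching condition `X(s(x)) = Ts(v) - c^P` is the substitution built into `basicForm`. So
the local expression over `U` exists, is unique, and is the pull-back of `ω̂` under `Ts ⊕ id`. -/
theorem isLocalExpr_iff {q : ℕ} (w : Q.LieForm 𝕜 q) (U : Set M) (s : M → P)
    (wloc : ∀ x : M, (TangentSpace (𝓡 m) x × LieAlg n G) [⋀^Fin q]→ₗ[ℝ] LieAlgK n G 𝕜) :
    Q.IsLocalExpr w U s wloc ↔ ∀ x ∈ U, ∀ v : Fin q → TangentSpace (𝓡 m) x × LieAlg n G,
      wloc x v = basicForm conn b w (s x)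
        (fun i => (mfderiv (𝓡 m) (𝓡 k) s x (v i).1, (v i).2)) := by
  constructor
  · intro h x hx v
    have hX := fun i => extendField_apply conn b (s x)
      (mfderiv (𝓡 m) (𝓡 k) s x (v i).1 - Q.fund (v i).2 (s x))
    exact (h _ x hx (fun i => (v i).1) (fun i => (v i).2) hX).trans
      (basicForm_apply conn b w (s x) _ hX).symm
  · intro h X x hx v c hX
    rw [h x hx]
    exact basicForm_apply conn b w (s x) X hX

/-- With the local expression pinned down over `U`, the condition becomes a comparison of
coefficients at points of the section, and the connection no longer occurs in the forms wedged with
`η`. -/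
theorem isInnerIntegral_iff {r : ℕ} (w : Q.LieForm 𝕜 (r + n)) (η : Q.BundleForm 𝕜 r) :
    Q.IsInnerIntegral b conn w η ↔ ∀ (U : Set M) (s : M → P) (τ : P → G)
      (hs : IsLocalTriv (n := n) (k := k) (m := m) Q.proj Q.act U s τ) (x : M) (hx : x ∈ U)
      (v : Fin r → TangentSpace (𝓡 m) x),
      innerPart b (basicForm conn b w (s x)) (fun i => mfderiv (𝓡 m) (𝓡 k) s x (v i)) =
        killingVolume b b • (η.1 x v).1 ⟨s x, hs.proj_section x hx⟩ := by
  have key : ∀ (s : M → P) (x : M)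
      (wx : (TangentSpace (𝓡 m) x × LieAlg n G) [⋀^Fin (r + n)]→ₗ[ℝ] LieAlgK n G 𝕜),
      (∀ v, wx v = basicForm conn b w (s x)
        (fun i => (mfderiv (𝓡 m) (𝓡 k) s x (v i).1, (v i).2))) →
      ∀ v, innerPart b wx v =
        innerPart b (basicForm conn b w (s x)) (fun i => mfderiv (𝓡 m) (𝓡 k) s x (v i)) := by
    intro s x wx h v
    rw [innerPart_apply, innerPart_apply, h]
    congr 1
    funext i
    refine Fin.addCases (fun i => ?_) (fun i => ?_) i
    · simp only [Fin.append_left]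
    · simp only [Fin.append_right, map_zero]
  unfold IsInnerIntegral
  refine forall_congr' fun U => forall_congr' fun s => forall_congr' fun τ =>
    forall_congr' fun hs => ?_
  simp only [isLocalExpr_iff conn b, innerDegreeLT_sub_wedge_iff b, mixed_volume]
  constructor
  · rintro ⟨wloc, h1, h2⟩ x hx v
    rw [← key s x (wloc x) (h1 x hx)]
    exact h2 x hx v
  · intro h
    refine ⟨fun x => (basicForm conn b w (s x)).compLinearMap
      ((mfderiv (𝓡 m) (𝓡 k) s x).toLinearMap.prodMap LinearMap.id), fun x hx v => rfl,
      fun x hx v => ?_⟩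
    exact (key s x _ (fun v => rfl) v).trans (h x hx v)

/-- The coefficient equation fixes the value at `s(x)`, and equivariance carries it to the other
points of the fibre. -/
theorem IsInnerIntegral.unique (hs : LieAlgebra.IsSemisimple ℝ (LieAlg n G)) {r : ℕ}
    {w : Q.LieForm 𝕜 (r + n)} {η ζ : Q.BundleForm 𝕜 r} (hη : Q.IsInnerIntegral b conn w η)
    (hζ : Q.IsInnerIntegral b conn w ζ) : η = ζ := by
  rw [isInnerIntegral_iff] at hη hζ
  refine Subtype.ext (funext fun x => AlternatingMap.ext fun v => Subtype.ext (funext ?_))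
  obtain ⟨U, s, τ, hx, ht⟩ := Q.locally_trivial x
  rintro ⟨p, rfl⟩
  have h1 : (η.1 (Q.proj p) v).1 ⟨s (Q.proj p), ht.proj_section _ hx⟩ =
      (ζ.1 (Q.proj p) v).1 ⟨s (Q.proj p), ht.proj_section _ hx⟩ :=
    smul_right_injective _ (killingVolume_self_ne_zero hs b)
      ((hη U s τ ht _ hx v).symm.trans (hζ U s τ ht _ hx v))
  have h2 : ∀ u : Q.AdFibre 𝕜 (Q.proj p), u.1 ⟨p, rfl⟩ =
      AdK n 𝕜 (τ p)⁻¹ (u.1 ⟨s (Q.proj p), ht.proj_section _ hx⟩) := by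
    intro u
    rw [← u.2 (τ p) ⟨s (Q.proj p), ht.proj_section _ hx⟩]
    exact congrArg u.1 (Subtype.ext (ht.section_act p hx).symm)
  rw [h2, h2, h1]

/-- The inner integral, as the form on the base whose pull-back is the algebraic integral. -/
theorem isInnerIntegral_of_pullback_eq (hs : LieAlgebra.IsSemisimple ℝ (LieAlg n G)) {r : ℕ}
    {w : Q.LieForm 𝕜 (r + n)} {η : Q.BundleForm 𝕜 r}
    (h : Q.pullback r η = algIntegral b r (inclusion conn b (r + n) w)) :
    Q.IsInnerIntegral b conn w η := by
  rw [isInnerIntegral_iff]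
  intro U s τ ht x hx v
  have h1 : (Q.pullback r η).1 (s x) (fun i => mfderiv (𝓡 m) (𝓡 k) s x (v i)) =
      (algIntegral b r (inclusion conn b (r + n) w)).1 (s x)
        (fun i => mfderiv (𝓡 m) (𝓡 k) s x (v i)) := by rw [h]
  rw [algIntegral_apply, Q.pullback_apply] at h1
  -- `s` is a section, so `Tπ ∘ Ts` is the identity.
  have h2 : ∀ i, (Q.dproj (s x) (mfderiv (𝓡 m) (𝓡 k) s x (v i)) : EuclideanSpace ℝ (Fin m)) =
      v i := by
    intro i
    have h3 := tmap_comp (E₁ := EuclideanSpace ℝ (Fin m)) (h := fun y : M => y)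
      (Q.mdiff_proj (s x)) ((ht.section_at hx).mdifferentiableAt (by simp)) rfl (by
        filter_upwards [ht.isOpen.mem_nhds hx] with y hy
        exact (ht.proj_section y hy).symm) (v i)
    exact h3.symm.trans (tmap_id (E₁ := EuclideanSpace ℝ (Fin m)) x (v i))
  have h4 := Q.bundleForm_congr η (ht.proj_section x hx)
    (v := fun i => Q.dproj (s x) (mfderiv (𝓡 m) (𝓡 k) s x (v i))) (funext h2) (s x) rfl
  have h5 : (η.1 x v).1 ⟨s x, ht.proj_section x hx⟩ =
      (killingVolume b b)⁻¹ • innerPart b (basicForm conn b w (s x))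
        (fun i => mfderiv (𝓡 m) (𝓡 k) s x (v i)) := h4.symm.trans h1
  rw [h5, smul_inv_smul₀ (killingVolume_self_ne_zero hs b)]

/-- The inner integration. -/
def innerIntegral [PreconnectedSpace G]
    (hu : ∀ ξ : LieAlg n G, LinearMap.trace ℝ _ (LieAlgebra.ad ℝ (LieAlg n G) ξ) = 0) (r : ℕ) :
    Q.LieForm 𝕜 (r + n) →ₗ[𝕜] Q.BundleForm 𝕜 r :=
  -- The algebraic integral of a basic form lies in the range of the pull-back, on which the
  -- pull-back is inverted.
  (LinearEquiv.ofInjective (Q.pullback r) (Q.pullback_injective r)).symm.toLinearMap ∘ₗ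
    (algIntegral b r ∘ₗ inclusion conn b (r + n)).codRestrict (LinearMap.range (Q.pullback r))
      fun w => (isTensorial_algIntegral conn b hu w).exists_pullback

theorem pullback_innerIntegral [PreconnectedSpace G]
    (hu : ∀ ξ : LieAlg n G, LinearMap.trace ℝ _ (LieAlgebra.ad ℝ (LieAlg n G) ξ) = 0) (r : ℕ)
    (w : Q.LieForm 𝕜 (r + n)) :
    Q.pullback r (innerIntegral conn b hu r w) =
      algIntegral b r (inclusion conn b (r + n) w) :=
  congrArg Subtype.val ((LinearEquiv.ofInjective (Q.pullback r)
    (Q.pullback_injective r)).apply_symm_apply _)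

/-- The square commutes by construction of `innerIntegral`. The content lies here: the form so
defined satisfies the local characterization of the inner integral and is the only one to do so. -/
theorem innerIntegral_eq_iff [PreconnectedSpace G] (hs : LieAlgebra.IsSemisimple ℝ (LieAlg n G))
    (hu : ∀ ξ : LieAlg n G, LinearMap.trace ℝ _ (LieAlgebra.ad ℝ (LieAlg n G) ξ) = 0) (r : ℕ)
    (w : Q.LieForm 𝕜 (r + n)) (η : Q.BundleForm 𝕜 r) :
    innerIntegral conn b hu r w = η ↔ Q.IsInnerIntegral b conn w η := by
  have h := isInnerIntegral_of_pullback_eq conn b hs (pullback_innerIntegral conn b hu r w)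
  exact ⟨by rintro rfl; exact h, fun h' => IsInnerIntegral.unique conn b hs h h'⟩

end PrincipalBundle

end Inner

end AtiyahLie

end

/-- The four maps of the square exist and are pinned down by their defining properties, the
horizontal ones are injective with the basic forms and the tensorial forms as their images, and the
square commutes. In degrees below `n` both integrations take their values in the zero space. -/
theorem mainTheorem9 {𝕜 : Type*} [RCLike 𝕜] {n k m : ℕ} {G P M : Type*}
    [TopologicalSpace G] [ChartedSpace (EuclideanSpace ℝ (Fin n)) G] [Group G]
    [LieGroup (𝓡 n) ∞ G] [T2Space G] [SecondCountableTopology G] [SimplyConnectedSpace G]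
    [TopologicalSpace P] [ChartedSpace (EuclideanSpace ℝ (Fin k)) P] [IsManifold (𝓡 k) ∞ P]
    [T2Space P] [SecondCountableTopology P]
    [TopologicalSpace M] [ChartedSpace (EuclideanSpace ℝ (Fin m)) M] [IsManifold (𝓡 m) ∞ M]
    [T2Space M] [SecondCountableTopology M]
    (Q : AtiyahLie.PrincipalBundle n k m G P M)
    (_semisimple : LieAlgebra.IsSemisimple ℝ (AtiyahLie.LieAlg n G))
    (_unimodular : ∀ ξ : AtiyahLie.LieAlg n G,
      LinearMap.trace ℝ _ (LieAlgebra.ad ℝ (AtiyahLie.LieAlg n G) ξ) = 0)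
    (b : Module.Basis (Fin n) ℝ (AtiyahLie.LieAlg n G)) (conn : Q.Connection) :
    ∃ (incl : ∀ q : ℕ, Q.LieForm 𝕜 q →ₗ[𝕜] AtiyahLie.TLAForm n k G P 𝕜 q)
      (inner : ∀ r : ℕ, Q.LieForm 𝕜 (r + n) →ₗ[𝕜] Q.BundleForm 𝕜 r)
      (alg : ∀ r : ℕ, AtiyahLie.TLAForm n k G P 𝕜 (r + n) →ₗ[𝕜] AtiyahLie.VForm n k G P 𝕜 r)
      (tens : ∀ r : ℕ, Q.BundleForm 𝕜 r →ₗ[𝕜] AtiyahLie.VForm n k G P 𝕜 r),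
      (∀ q w w', incl q w = w' ↔ Q.IsBasic w' ∧ Q.Corresponds w' w) ∧
      (∀ q, Function.Injective (incl q)) ∧
      (∀ q w', Q.IsBasic w' → ∃ w, incl q w = w') ∧
      (∀ r w η, inner r w = η ↔ Q.IsInnerIntegral b conn w η) ∧
      (∀ r w η, alg r w = η ↔ AtiyahLie.IsAlgIntegral b w η) ∧
      (∀ r η τ, tens r η = τ ↔ Q.IsPullback η τ) ∧
      (∀ r, Function.Injective (tens r)) ∧
      (∀ r τ, Q.IsTensorial τ ↔ ∃ η, tens r η = τ) ∧
      (∀ r w, alg r (incl (r + n) w) = tens r (inner r w)) := by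
  exact ⟨fun q => AtiyahLie.PrincipalBundle.inclusion conn b q,
    fun r => AtiyahLie.PrincipalBundle.innerIntegral conn b _unimodular r,
    fun r => AtiyahLie.algIntegral b r, fun r => Q.pullback r,
    fun q w w' => AtiyahLie.PrincipalBundle.inclusion_eq_iff conn b w w',
    fun q => AtiyahLie.PrincipalBundle.inclusion_injective conn b q,
    fun q w' hw => AtiyahLie.PrincipalBundle.exists_inclusion_eq conn b hw,
    fun r w η => AtiyahLie.PrincipalBundle.innerIntegral_eq_iff conn b _semisimple _unimodular r w η,
    fun r w η => AtiyahLie.algIntegral_eq_iff _semisimple b r w η,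
    fun r η τ => Q.pullback_eq_iff η τ, fun r => Q.pullback_injective r,
    fun r τ => Q.isTensorial_iff τ,
    fun r w => (AtiyahLie.PrincipalBundle.pullback_innerIntegral conn b _unimodular r w).symm⟩
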